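/- Let $a\ge 1$, $b\ge 0$, and let $V$ be a real vector space with an inner product of signature $(a,b)$, identified by linear coordinates with $\mathbb R^a\times\mathbb R^b$ carrying $\langle (x,y),(x',y')\rangle = x\cdot x'-y\cdot y'$; let $Q(v)=\langle v,v\rangle$ and $H^+=\{Q=1\}$. Extend the inner product to $\bigwedge^a V$ by $\langle v_1\wedge\dots\wedge v_a, w_1\wedge\dots\wedge w_a\rangle=\det(\langle v_i,w_j\rangle)$ and put $Q(\omega)=\langle\omega,\omega\rangle$. For a $C^1$ function $f:\mathbb R^a\to\mathbb R^b$ let $$N_f=\Bigl\{\bigl(x\sqrt{1+|f(x)|^2},\,f(x)\bigr) : x\in S^{a-1}\Bigr\}\subset H^+ ,$$ so that $N_0=S^{a-1}$ is a flat neck (the intersection of $H^+$ with a spacelike $a$-plane through the origin; every flat neck is $N_0$ in suitable coordinates). Let $Q[f]=Q(\overrightarrow{\mathrm{Vol}}\,N_f)$ be the energy of the directed volume enclosed by $N_f$, where the directed volume of a body parametrized by $F:U\to V$, $U\subset\mathbb R^a$, is $\int_U \partial_1F\wedge\dots\wedge\partial_aF\,dy\in\bigwedge^aV$, and that enclosed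 by $N_f$ is the directed volume of the cone over $N_f$ from the origin. Let $v_a$ be the volume of the unit ball of $\mathbb R^a$. Then: 1. $Q[0]=v_a^2$, and the flat neck is a local minimum in the $C^1$ topology: there is $\varepsilon>0$ such that $Q[f]\ge Q[0]$ for every $C^1$ function $f$ for which $|f|$ and the norm of the derivative of $f$ along the sphere are at most $\varepsilon$ on $S^{a-1}$. 2. For every $C^1$ function $f$ the first variation vanishes: $\frac{d}{dt}Q[tf]\big|_{t=0}=0$. 3. For every $C^1$ function $f$, let $f_k$ be the degree $k$ term of its harmonic expansion on $S^{a-1}$, that is, the $L^2$-orthogonal projection of $f|_{S^{a-1}}$ to the space of $\mathbb R^b$-valued functions on $S^{a-1}$ given by polynomials of degree at most $k$ and orthogonal to all polynomials of lower degree. Let $\|\cdot\|$ be the $L^2$ norm for the rotation-invariant probability measure on $S^{a-1}$. Then $t\mapsto Q[tf]$ is twice differentiable at $0$, and $$\frac12\,\frac{d^2}{dt^2}Q[tf]\Big|_{t=0}=v_a^2\cdot a\bigl(\|f_0\|^2+\|f_2\|^2+\|f_3\|^2+\dots\bigr).$$ 4. This second variation is nonnegative, and it is zero if and only if $f|_{S^{a-1}}$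 is the restriction of a linear map $\mathbb R^a\to\mathbb R^b$. These linear variations are exactly the ones coming from $\mathfrak{so}(a,b)$: $f|_{S^{a-1}}$ is the restriction of a linear map if and only if there is $X\in\mathfrak{so}(a,b)$ such that, for every $x\in S^{a-1}$, $f(x)$ is the $\mathbb R^b$-component of $X(x,0)$ (the component of $X(x,0)$ tangent to $H^+$ and normal to the flat neck). -/

import Mathlib

open MeasureTheory Filter Topology

noncomputable section

namespace Neck

/-- Euclidean space of dimension `n`. -/
abbrev Euc (n : ℕ) : Type := EuclideanSpace ℝ (Fin n)

/-- The standard inner product of signature `(a, b)` on `ℝ^a × ℝ^b`: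
`⟨(x, y), (x', y')⟩ = x ⬝ x' - y ⬝ y'`. -/
def stdForm (a b : ℕ) : LinearMap.BilinForm ℝ (Euc a × Euc b) :=
  (innerₗ (Euc a)).compl₁₂ (LinearMap.fst ℝ (Euc a) (Euc b)) (LinearMap.fst ℝ (Euc a) (Euc b)) -
    (innerₗ (Euc b)).compl₁₂ (LinearMap.snd ℝ (Euc a) (Euc b)) (LinearMap.snd ℝ (Euc a) (Euc b))

theorem stdForm_apply (a b : ℕ) (u v : Euc a × Euc b) :
    stdForm a b u v = inner ℝ u.1 v.1 - inner ℝ u.2 v.2 := rfl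

section ExteriorForm

variable {V : Type*} [AddCommGroup V] [Module ℝ V]

/-- The extension of a bilinear form `B` on `V` to the `k`-tensors `⋀^k V`, characterised by
`⟨v₁ ∧ ⋯ ∧ vₖ, w₁ ∧ ⋯ ∧ wₖ⟩ = det ⟨vᵢ, wⱼ⟩`. -/
def extForm (B : LinearMap.BilinForm ℝ V) (k : ℕ) : LinearMap.BilinForm ℝ (⋀[ℝ]^k V) :=
  exteriorPower.pairingDual ℝ V k ∘ₗ exteriorPower.map k B

theorem extForm_ιMulti (B : LinearMap.BilinForm ℝ V) (k : ℕ) (v w : Fin k → V) :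
    extForm B k (exteriorPower.ιMulti ℝ k v) (exteriorPower.ιMulti ℝ k w) =
      (Matrix.of fun i j => B (v i) (w j)).det := by
  have h : extForm B k (exteriorPower.ιMulti ℝ k v) (exteriorPower.ιMulti ℝ k w) =
      (Matrix.of fun i j => B (v j) (w i)).det := by
    simp [extForm, Function.comp_def]
  rw [h, ← Matrix.det_transpose]
  rfl

/-- The energy `Q(ω) = ⟨ω, ω⟩` of a `k`-tensor. -/
def energy (B : LinearMap.BilinForm ℝ V) {k : ℕ} (ω : ⋀[ℝ]^k V) : ℝ := extForm B k ω ω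

end ExteriorForm

section DirectedVolume

/-- The coordinatewise integral of a function with values in a finite-dimensional real vector
space without a chosen norm. -/
def vecIntegral {X W : Type*} [MeasurableSpace X] [AddCommGroup W] [Module ℝ W]
    [Module.Finite ℝ W] (μ : Measure X) (h : X → W) : W :=
  ∑ i, (∫ y, (Module.finBasis ℝ W).coord i (h y) ∂μ) • Module.finBasis ℝ W i

/-- The integral does not depend on the basis: it commutes with every linear functional. -/
theorem map_vecIntegral {X W : Type*} [MeasurableSpace X] [AddCommGroup W] [Module ℝ W]
    [Module.Finite ℝ W] (μ : Measure X) (h : X → W)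
    (hint : ∀ ℓ : Module.Dual ℝ W, Integrable (fun y => ℓ (h y)) μ) (ℓ : Module.Dual ℝ W) :
    ℓ (vecIntegral μ h) = ∫ y, ℓ (h y) ∂μ := by
  have key : ∀ y, ℓ (h y) =
      ∑ i, (Module.finBasis ℝ W).coord i (h y) * ℓ (Module.finBasis ℝ W i) := by
    intro y
    conv_lhs => rw [← (Module.finBasis ℝ W).sum_repr (h y)]
    simp [-Module.Basis.sum_repr]
  simp only [key]
  rw [integral_finsetSum _ fun i _ => (hint _).mul_const _]
  simp [vecIntegral, integral_mul_const]

variable {a : ℕ} {V : Type*} [NormedAddCommGroup V] [NormedSpace ℝ V] [FiniteDimensional ℝ V]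

/-- The directed volume `∫ ∂F/∂y₁ ∧ ⋯ ∧ ∂F/∂y_a dy` of the `a`-dimensional body parametrised
by a map `F` on the open unit ball of `ℝ^a`. -/
def directedVolume (F : Euc a → V) : ⋀[ℝ]^a V :=
  vecIntegral (volume.restrict (Metric.ball (0 : Euc a) 1)) fun y =>
    exteriorPower.ιMulti ℝ a fun i : Fin a => fderiv ℝ F y (EuclideanSpace.single i (1 : ℝ))

/-- The parametrisation, by the unit ball, of the cone from the origin over the closed
hypersurface parametrised by the restriction of `g` to the unit sphere. -/
def cone (g : Euc a → V) (y : Euc a) : V := ‖y‖ • g (‖y‖⁻¹ • y)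

/-- The directed volume enclosed by the closed `(a-1)`-manifold parametrised by the restriction
of `g` to the unit sphere `S^{a-1}`, that is, the directed volume of the cone over it, which is an
oriented body whose boundary is that manifold. -/
def enclosedVolume (g : Euc a → V) : ⋀[ℝ]^a V := directedVolume (cone g)

end DirectedVolume

section Necks

variable {a b : ℕ}

/-- The point `(x √(1 + |f(x)|²), f(x))` of the neck described by `f`. For `‖x‖ = 1` it lies on the
hyperboloid `Q = 1`; for `f = 0` these points form the flat neck `S^{a-1}`. -/
def graphMap (f : Euc a → Euc b) (x : Euc a) : Euc a × Euc b :=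
  (Real.sqrt (1 + ‖f x‖ ^ 2) • x, f x)

variable {V : Type*} [NormedAddCommGroup V] [NormedSpace ℝ V] [FiniteDimensional ℝ V]

/-- The functional `Q[f]`: the energy of the directed volume enclosed by the neck that `f`
describes, in the linear coordinates `T` on the space `V` with inner product `B`. -/
def neckEnergy (B : LinearMap.BilinForm ℝ V) (T : (Euc a × Euc b) ≃ₗ[ℝ] V)
    (f : Euc a → Euc b) : ℝ :=
  energy B (enclosedVolume fun x => T (graphMap f x))

/-- The function `f`, restricted to the unit sphere, has distance at most `ε` from `0` in the
`C^1` topology: its values and its derivatives along the sphere are bounded by `ε`. -/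
def C1Small (ε : ℝ) (f : Euc a → Euc b) : Prop :=
  ∀ x : Euc a, ‖x‖ = 1 →
    ‖f x‖ ≤ ε ∧ ∀ v : Euc a, inner ℝ x v = 0 → ‖fderiv ℝ f x v‖ ≤ ε * ‖v‖

/-- `q` is differentiable near `t₀`, and `c` is its second derivative at `t₀`. -/
def HasSecondDerivAt (q : ℝ → ℝ) (c t₀ : ℝ) : Prop :=
  ∃ q' : ℝ → ℝ, (∀ᶠ t in 𝓝 t₀, HasDerivAt q (q' t) t) ∧ HasDerivAt q' c t₀

end Necks

section Harmonics

/-- The unit sphere `S^{a-1}` in `ℝ^a`. -/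
abbrev Sph (a : ℕ) : Type := Metric.sphere (0 : Euc a) 1

/-- The rotation-invariant probability measure on the unit sphere (for `a ≥ 1`): the surface
measure divided by its total mass. -/
def unifMeasure (a : ℕ) : Measure (Sph a) :=
  ENNReal.ofReal (((volume : Measure (Euc a)).toSphere.real Set.univ)⁻¹) •
    (volume : Measure (Euc a)).toSphere

instance (a : ℕ) : IsFiniteMeasure (unifMeasure a) :=
  Measure.smul_finite _ ENNReal.ofReal_ne_top

/-- The Hilbert space `L²(S^{a-1}, ℝ^b)` for the uniform probability measure. -/
abbrev L2Sphere (a b : ℕ) : Type := Lp (Euc b) 2 (unifMeasure a)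

/-- The restriction of a continuous function to the sphere, as an element of `L²`. -/
def sphereLp {a b : ℕ} (f : Euc a → Euc b) (hf : Continuous f) : L2Sphere a b :=
  ContinuousMap.toLp (E := Euc b) 2 (unifMeasure a) ℝ
    ⟨fun x : Sph a => f x, hf.comp continuous_subtype_val⟩

/-- The continuous map `ℝ^a → ℝ^b` with polynomial components `p`. -/
def polyFun {a b : ℕ} (p : Fin b → MvPolynomial (Fin a) ℝ) (x : Euc a) : Euc b :=
  WithLp.toLp 2 fun j => MvPolynomial.eval (x : Fin a → ℝ) (p j)

theorem continuous_polyFun {a b : ℕ} (p : Fin b → MvPolynomial (Fin a) ℝ) :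
    Continuous (polyFun p) := by
  refine (PiLp.continuous_toLp 2 _).comp (continuous_pi fun j => ?_)
  exact (MvPolynomial.continuous_eval (p j)).comp (PiLp.continuous_ofLp 2 _)

/-- Restriction of polynomial maps to the sphere, as a linear map into `L²`. -/
def polyLp (a b : ℕ) : (Fin b → MvPolynomial (Fin a) ℝ) →ₗ[ℝ] L2Sphere a b where
  toFun p := sphereLp (polyFun p) (continuous_polyFun p)
  map_add' p q := by
    unfold sphereLp
    rw [← map_add]
    congr 1
    ext x j
    simp [polyFun]
  map_smul' c p := by
    unfold sphereLp
    rw [RingHom.id_apply, ← map_smul]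
    congr 1
    ext x j
    simp [polyFun]

/-- The functions on the sphere given by polynomials of degree at most `k`. -/
def polySpace (a b k : ℕ) : Submodule ℝ (L2Sphere a b) :=
  (Submodule.pi Set.univ fun _ : Fin b =>
    MvPolynomial.restrictTotalDegree (Fin a) ℝ k).map (polyLp a b)

instance (a b k : ℕ) : FiniteDimensional ℝ (polySpace a b k) := by
  have h : (Submodule.pi Set.univ fun _ : Fin b =>
      MvPolynomial.restrictTotalDegree (Fin a) ℝ k).FG :=
    Submodule.fg_pi fun _ => Module.Finite.iff_fg.mp inferInstance
  exact Module.Finite.iff_fg.mpr (h.map _)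

/-- The spherical harmonics of degree `k`: the functions given by a polynomial of degree at most
`k` that are orthogonal to all polynomials of lower degree. -/
def harmonicSpace (a b k : ℕ) : Submodule ℝ (L2Sphere a b) :=
  polySpace a b k ⊓ ⨅ j : Fin k, (polySpace a b j)ᗮ

instance (a b k : ℕ) : FiniteDimensional ℝ (harmonicSpace a b k) :=
  Submodule.finiteDimensional_inf_left _ _

/-- The degree `k` term of the harmonic expansion of `u`: its orthogonal projection to the
spherical harmonics of degree `k`. -/
def harmonicPart {a b : ℕ} (k : ℕ) (u : L2Sphere a b) : L2Sphere a b :=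
  (harmonicSpace a b k).starProjection u

end Harmonics

end Neck

end

/-! The energy is a signed sum of squares of Plücker coordinates of the directed volume: by a
Cauchy–Binet expansion, a coordinate that uses m negative directions enters with the sign (-1)^m
(`pairEnergy_eq_sum`). The leading coordinate, m = 0, is the volume enclosed by the projection of
the neck to ℝ^a. Only odd m can lower the energy, and m = 1 and m ≥ 3 are handled by different
means.

Coordinates with m = 1 are removed by a change of frame. On the compact set of linear isometries A
of slope at most δ the leading coordinate of A(neck) attains its minimum. Its derivative along the
boosts consists of the coordinates with m = 1, so these vanish at an interior minimum
(`exists_isometry_minorInt_eq_zero`). The minimum is interior because an almost flat neck, tilted by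
slope δ, has a larger leading coordinate than the untilted neck.

Coordinates with m ≥ 3 are small. Jacobian minors are null Lagrangians, so integration by parts
takes the derivative off one row (`exists_abs_integral_det_gradMat_le`). If r denotes the vertical
part of the rotated neck and κ bounds its derivative, two other vertical rows give κ², and the
squared coordinate is O(κ⁴ ∫|r|²). On the other hand the neck lies on the hyperboloid, so its
projection p satisfies |p|² = 1 + |r|² on the sphere and encloses a volume of at least v(1 +
∫|r|²/8), where v is the volume of the unit ball (`volume_add_le_integral_det`). The gain v²/4 ·
∫|r|² in the square absorbs the error when κ is small. As f is only C¹, the null Lagrangian property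
comes from the change of variables formula and not from second derivatives.

For the variations, the energy density of t • f depends on t only through τ = t², and is C¹ in τ up
to and beyond τ = 0. Hence Q[tf] = g(t²): the first variation vanishes and the second is 2g'(0). At
τ = 0 the Gram matrix is the identity, so g' is an integrated trace; with the divergence theorem on
the ball it becomes v² a (‖f‖² - a Σ (∫ xᵢ fⱼ)²). The subtracted term is ‖f₁‖², because the
harmonics of degree one are the linear maps. Density of polynomials and Pythagoras give the sum over
the other degrees, and the result vanishes exactly when f = f₁. -/

noncomputable section

namespace Neck

/-! ### Polar coordinates and the uniform measure on the sphere. -/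

section Polar

variable {a : ℕ}

instance nontrivial_euc [NeZero a] : Nontrivial (Euc a) :=
  Module.nontrivial_of_finrank_pos (R := ℝ) (by simpa using Nat.pos_of_ne_zero (NeZero.ne a))

/-- Integration in polar coordinates of the product of a radial function and a function that is
constant on rays. -/
theorem integral_radial_mul [NeZero a] (w : ℝ → ℝ) (h : Euc a → ℝ)
    (hh : ∀ t : ℝ, 0 < t → ∀ y, h (t • y) = h y) :
    ∫ y, w ‖y‖ * h y =
      (∫ r in Set.Ioi (0 : ℝ), r ^ (a - 1) * w r) *
        ∫ x : Sph a, h x ∂(volume : Measure (Euc a)).toSphere := by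
  have hdim : Module.finrank ℝ (Euc a) = a := by simp
  calc
    ∫ y, w ‖y‖ * h y = ∫ y : ({(0)}ᶜ : Set (Euc a)), w ‖y.1‖ * h y.1
        ∂((volume : Measure (Euc a)).comap (↑)) := by
      rw [integral_subtype_comap (measurableSet_singleton _).compl fun y => w ‖y‖ * h y,
        restrict_compl_singleton]
    _ = ∫ x, h x.1 * w x.2 ∂(volume : Measure (Euc a)).toSphere.prod
        (.volumeIoiPow (Module.finrank ℝ (Euc a) - 1)) := by
      rw [← (volume : Measure (Euc a)).measurePreserving_homeomorphUnitSphereProd.integral_comp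
        (Homeomorph.measurableEmbedding _)]
      refine integral_congr_ae (Eventually.of_forall fun y => ?_)
      have hy : 0 < ‖y.1‖ := norm_pos_iff.2 y.2
      have h1 : h ((homeomorphUnitSphereProd (Euc a)) y).1 = h y.1 := by
        simp only [homeomorphUnitSphereProd_apply_fst_coe]
        exact hh _ (inv_pos.2 hy) _
      simp only [h1, homeomorphUnitSphereProd_apply_snd_coe]
      ring
    _ = (∫ x : Sph a, h x ∂(volume : Measure (Euc a)).toSphere) *
        ∫ r : Set.Ioi (0 : ℝ), w r ∂.volumeIoiPow (Module.finrank ℝ (Euc a) - 1) :=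
      integral_prod_mul (fun x : Sph a => h x) (fun r : Set.Ioi (0 : ℝ) => w r)
    _ = _ := by
      rw [mul_comm, hdim]
      congr 1
      simp only [Measure.volumeIoiPow, ENNReal.ofReal]
      rw [integral_withDensity_eq_integral_smul,
        integral_subtype_comap measurableSet_Ioi fun r : ℝ => Real.toNNReal (r ^ (a - 1)) • w r,
        setIntegral_congr_fun measurableSet_Ioi fun x hx => ?_]
      · rw [NNReal.smul_def, Real.coe_toNNReal _ (pow_nonneg hx.out.le _), smul_eq_mul]
      · exact (measurable_subtype_coe.pow_const _).real_toNNReal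

/-- The integral over the unit ball of a function that is constant on rays. -/
theorem integral_ball_eq_sphere [NeZero a] (h : Euc a → ℝ)
    (hh : ∀ t : ℝ, 0 < t → ∀ y, h (t • y) = h y) :
    ∫ y in Metric.ball (0 : Euc a) 1, h y =
      (a : ℝ)⁻¹ * ∫ x : Sph a, h x ∂(volume : Measure (Euc a)).toSphere := by
  have ha : 0 < a := Nat.pos_of_ne_zero (NeZero.ne a)
  have h1 := integral_radial_mul (Set.indicator (Set.Iio 1) 1) h hh
  have h2 : ∀ y : Euc a, (Set.indicator (Set.Iio (1 : ℝ)) 1 ‖y‖ : ℝ) * h y =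
      (Metric.ball (0 : Euc a) 1).indicator h y := by
    intro y
    by_cases hy : ‖y‖ < 1 <;> simp [hy]
  simp only [h2] at h1
  rw [integral_indicator measurableSet_ball] at h1
  rw [h1]
  congr 1
  have h3 : ∀ r : ℝ, r ^ (a - 1) * (Set.indicator (Set.Iio (1 : ℝ)) 1 r : ℝ) =
      (Set.Iio (1 : ℝ)).indicator (fun r => r ^ (a - 1)) r := by
    intro r
    by_cases hr : r < 1 <;> simp [hr]
  simp only [h3]
  rw [setIntegral_indicator measurableSet_Iio, Set.Ioi_inter_Iio,
    ← integral_Ioc_eq_integral_Ioo, ← intervalIntegral.integral_of_le zero_le_one, integral_pow]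
  have : ((a - 1 : ℕ) : ℝ) + 1 = a := by
    rw [Nat.cast_sub ha]; simp
  rw [this, Nat.sub_add_cancel ha]
  simp [ha.ne']

theorem volume_ball_pos : 0 < volume.real (Metric.ball (0 : Euc a) 1) :=
  ENNReal.toReal_pos (Metric.measure_ball_pos _ _ one_pos).ne' measure_ball_lt_top.ne

theorem integral_unifMeasure [NeZero a] (h : Sph a → ℝ) :
    ∫ x, h x ∂unifMeasure a = (a * volume.real (Metric.ball (0 : Euc a) 1))⁻¹ *
      ∫ x, h x ∂(volume : Measure (Euc a)).toSphere := by
  rw [unifMeasure, integral_smul_measure, ENNReal.toReal_ofReal (by positivity)]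
  simp

/-- The integral over the unit ball of a function that is constant on rays, in terms of its mean
over the sphere. -/
theorem integral_ball_eq_unifMeasure [NeZero a] (h : Euc a → ℝ)
    (hh : ∀ t : ℝ, 0 < t → ∀ y, h (t • y) = h y) :
    ∫ y in Metric.ball (0 : Euc a) 1, h y =
      volume.real (Metric.ball (0 : Euc a) 1) * ∫ x : Sph a, h x ∂unifMeasure a := by
  have ha : (a : ℝ) ≠ 0 := by simp [NeZero.ne a]
  rw [integral_ball_eq_sphere h hh, integral_unifMeasure]
  have := (volume_ball_pos (a := a)).ne'
  field_simp

theorem isProbabilityMeasure_unifMeasure [NeZero a] : IsProbabilityMeasure (unifMeasure a) := by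
  have ha : (a : ℝ) ≠ 0 := by simp [NeZero.ne a]
  have h := integral_unifMeasure (a := a) fun _ => 1
  have := (volume_ball_pos (a := a)).ne'
  simp only [integral_const, smul_eq_mul, mul_one, Measure.toSphere_real_apply_univ,
    finrank_euclideanSpace, Fintype.card_fin] at h
  rw [inv_mul_cancel₀ (by positivity)] at h
  exact ⟨by rwa [measureReal_def, ENNReal.toReal_eq_one_iff] at h⟩

/-- Full support lets equality in L² of continuous functions be read pointwise on the sphere. -/
instance isOpenPosMeasure_unifMeasure [NeZero a] : (unifMeasure a).IsOpenPosMeasure := by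
  have ha : (a : ℝ) ≠ 0 := by simp [NeZero.ne a]
  have h0 := volume_ball_pos (a := a)
  refine ⟨fun U hU hne => ?_⟩
  rw [unifMeasure, Measure.smul_apply, smul_eq_mul]
  refine mul_ne_zero ?_ (hU.measure_ne_zero _ hne)
  simp only [Measure.toSphere_real_apply_univ, finrank_euclideanSpace, Fintype.card_fin, ne_eq,
    ENNReal.ofReal_eq_zero, not_le]
  positivity

end Polar

/-! ### Positively homogeneous maps of degree one. -/

section Homogeneous

variable {a : ℕ} {X Y : Type*} [NormedAddCommGroup X] [NormedSpace ℝ X]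
  [NormedAddCommGroup Y] [NormedSpace ℝ Y]

/-- Functions on `ℝ^a` that are positively homogeneous of degree one, and continuously
differentiable away from the origin. -/
structure HomC1 (F : Euc a → X) : Prop where
  smul : ∀ t : ℝ, 0 < t → ∀ y, F (t • y) = t • F y
  contDiffOn : ContDiffOn ℝ 1 F {0}ᶜ

namespace HomC1

variable {F G : Euc a → X}

theorem contDiffAt (hF : HomC1 F) {y : Euc a} (hy : y ≠ 0) : ContDiffAt ℝ 1 F y :=
  hF.contDiffOn.contDiffAt (isOpen_compl_singleton.mem_nhds hy)

theorem differentiableAt (hF : HomC1 F) {y : Euc a} (hy : y ≠ 0) : DifferentiableAt ℝ F y :=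
  (hF.contDiffAt hy).differentiableAt one_ne_zero

theorem clm_comp (hF : HomC1 F) (L : X →L[ℝ] Y) : HomC1 fun y => L (F y) where
  smul t ht y := by rw [hF.smul t ht, map_smul]
  contDiffOn := L.contDiff.comp_contDiffOn hF.contDiffOn

theorem add (hF : HomC1 F) (hG : HomC1 G) : HomC1 fun y => F y + G y where
  smul t ht y := by rw [hF.smul t ht, hG.smul t ht, smul_add]
  contDiffOn := hF.contDiffOn.add hG.contDiffOn

theorem id : HomC1 fun y : Euc a => y := ⟨fun _ _ _ => rfl, contDiffOn_id⟩

/-- The derivative is homogeneous of degree 0, hence determined off the origin by its values on the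
sphere. -/
theorem fderiv_smul (hF : HomC1 F) {t : ℝ} (ht : 0 < t) (y : Euc a) :
    fderiv ℝ F (t • y) = fderiv ℝ F y := by
  have h1 : (fun y => F (t • y)) = fun y => t • F y := funext (hF.smul t ht)
  have h2 := congrArg (fun G => fderiv ℝ G y) h1
  simp only [fderiv_comp_smul] at h2
  rw [show (fun y => t • F y) = t • F from rfl, fderiv_const_smul_field] at h2
  exact smul_right_injective _ ht.ne' h2

theorem euler (hF : HomC1 F) {y : Euc a} (hy : y ≠ 0) : fderiv ℝ F y y = F y := by
  have h1 : HasDerivAt (fun t : ℝ => t • y) y 1 := by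
    simpa using (hasDerivAt_id (1 : ℝ)).smul_const y
  have h2 : HasFDerivAt F (fderiv ℝ F y) ((1 : ℝ) • y) := by
    rw [one_smul]; exact (hF.differentiableAt hy).hasFDerivAt
  have h3 := h2.comp_hasDerivAt (1 : ℝ) h1
  have h4 : HasDerivAt (fun t : ℝ => t • F y) (F y) 1 := by
    simpa using (hasDerivAt_id (1 : ℝ)).smul_const (F y)
  refine h3.unique (h4.congr_of_eventuallyEq ?_)
  filter_upwards [lt_mem_nhds (zero_lt_one (α := ℝ))] with t ht
  exact hF.smul t ht y

theorem continuousOn_fderiv (hF : HomC1 F) : ContinuousOn (fderiv ℝ F) {0}ᶜ :=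
  hF.contDiffOn.continuousOn_fderiv_of_isOpen isOpen_compl_singleton le_rfl

theorem forall_of_sphere (hF : HomC1 F) {p : (Euc a →L[ℝ] X) → Prop}
    (h : ∀ x : Euc a, ‖x‖ = 1 → p (fderiv ℝ F x)) {y : Euc a} (hy : y ≠ 0) :
    p (fderiv ℝ F y) := by
  have := h (‖y‖⁻¹ • y) (by simp [norm_smul, hy])
  rwa [hF.fderiv_smul (by positivity)] at this

/-- Compactness of the sphere and homogeneity bound the derivative off the origin; the single value
at the origin is added by the maximum. -/
theorem exists_norm_fderiv_le (hF : HomC1 F) : ∃ C : ℝ, 0 ≤ C ∧ ∀ y, ‖fderiv ℝ F y‖ ≤ C := by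
  have hs : Metric.sphere (0 : Euc a) 1 ⊆ {0}ᶜ := fun x hx => by
    rintro rfl; simp at hx
  obtain ⟨C, hC⟩ := (isCompact_sphere (0 : Euc a) 1).exists_bound_of_continuousOn
    (hF.continuousOn_fderiv.mono hs)
  refine ⟨max |C| ‖fderiv ℝ F 0‖, by positivity, fun y => ?_⟩
  by_cases hy : y = 0
  · simp [hy]
  · refine le_trans ?_ (le_max_left _ _)
    refine hF.forall_of_sphere (p := fun L => ‖L‖ ≤ |C|) (fun x hx => ?_) hy
    exact (hC x (by simpa using hx)).trans (le_abs_self C)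

theorem map_zero (hF : HomC1 F) : F 0 = 0 := by
  have h := hF.smul 2 two_pos 0
  rw [smul_zero, two_smul] at h
  simpa using h

theorem norm_le (hF : HomC1 F) {C : ℝ} (hC : ∀ y ≠ 0, ‖fderiv ℝ F y‖ ≤ C) (y : Euc a) :
    ‖F y‖ ≤ C * ‖y‖ := by
  by_cases hy : y = 0
  · simp [hy, hF.map_zero]
  · rw [← hF.euler hy]
    exact ContinuousLinearMap.le_of_opNorm_le _ (hC y hy) y

theorem continuous (hF : HomC1 F) : Continuous F := by
  refine continuous_iff_continuousAt.2 fun y => ?_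
  by_cases hy : y = 0
  · obtain ⟨C, -, hC⟩ := hF.exists_norm_fderiv_le
    rw [hy, ContinuousAt, hF.map_zero]
    refine squeeze_zero_norm (fun z => hF.norm_le (fun y _ => hC y) z) ?_
    have : Tendsto (fun z : Euc a => C * ‖z‖) (𝓝 0) (𝓝 (C * ‖(0 : Euc a)‖)) :=
      (continuous_const.mul continuous_norm).tendsto 0
    simpa using this
  · exact (hF.differentiableAt hy).continuousAt

theorem sphere_ne_zero {x : Euc a} (hx : ‖x‖ = 1) : x ≠ 0 := by
  rintro rfl; simp at hx

/-- A homogeneous function whose derivative is bounded by `C` is `C`-Lipschitz. -/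
theorem norm_sub_le (hF : HomC1 F) {C : ℝ} (hC : ∀ y ≠ 0, ‖fderiv ℝ F y‖ ≤ C) (y z : Euc a) :
    ‖F y - F z‖ ≤ C * ‖y - z‖ := by
  -- The mean value inequality needs a segment that avoids the origin. A segment through the origin
  -- has ‖y‖ + ‖z‖ = ‖y - z‖, and the bound on values suffices.
  by_cases h0 : (0 : Euc a) ∈ segment ℝ y z
  · have h1 := dist_add_dist_of_mem_segment h0
    rw [dist_zero_right, dist_zero_left, dist_eq_norm] at h1
    calc ‖F y - F z‖ ≤ ‖F y‖ + ‖F z‖ := _root_.norm_sub_le _ _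
      _ ≤ C * ‖y‖ + C * ‖z‖ := add_le_add (hF.norm_le hC y) (hF.norm_le hC z)
      _ = C * ‖y - z‖ := by rw [← mul_add, h1]
  · have hne : ∀ x ∈ segment ℝ y z, x ≠ 0 := fun x hx h => h0 (h ▸ hx)
    exact (convex_segment y z).norm_image_sub_le_of_norm_fderiv_le
      (fun x hx => hF.differentiableAt (hne x hx)) (fun x hx => hC x (hne x hx))
      (right_mem_segment ℝ y z) (left_mem_segment ℝ y z)

end HomC1

theorem homC1_cone {g : Euc a → X} (hg : ContDiff ℝ 1 g) : HomC1 (cone g) where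
  smul t ht y := by
    have : (t * ‖y‖)⁻¹ * t = ‖y‖⁻¹ := by field_simp
    simp only [cone, norm_smul, Real.norm_of_nonneg ht.le, smul_smul, this]
  contDiffOn := by
    have h1 : ContDiffOn ℝ 1 (fun y : Euc a => ‖y‖) {0}ᶜ := contDiffOn_id.norm ℝ fun y hy => hy
    exact h1.smul (hg.comp_contDiffOn ((h1.inv fun y hy => norm_ne_zero_iff.2 hy).smul contDiffOn_id))

theorem integrableOn_ball_of_bounded {h : Euc a → ℝ} (hm : Measurable h) {C : ℝ}
    (hC : ∀ y, |h y| ≤ C) : IntegrableOn h (Metric.ball (0 : Euc a) 1) :=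
  Measure.integrableOn_of_bounded measure_ball_lt_top.ne hm.aestronglyMeasurable
    (Eventually.of_forall hC)

end Homogeneous

/-! ### Jacobian determinants and perturbations of the identity. -/

section Determinants

variable {a : ℕ}

/-- The standard basis vectors of `ℝ^a`. -/
abbrev stdVec (j : Fin a) : Euc a := EuclideanSpace.single j (1 : ℝ)

/-- The matrix whose rows are the gradients of the functions `u i`. -/
def gradMat (u : Fin a → Euc a → ℝ) (y : Euc a) : Matrix (Fin a) (Fin a) ℝ :=
  Matrix.of fun i j => fderiv ℝ (u i) y (stdVec j)

theorem gradMat_apply (u : Fin a → Euc a → ℝ) (y : Euc a) (i j : Fin a) :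
    gradMat u y i j = fderiv ℝ (u i) y (stdVec j) := rfl

theorem det_clm (L : Euc a →L[ℝ] Euc a) :
    L.det = (Matrix.of fun i j => L (stdVec j) i).det := by
  rw [ContinuousLinearMap.det, ← LinearMap.det_toMatrix (EuclideanSpace.basisFun (Fin a) ℝ).toBasis]
  congr 1

theorem fderiv_coord {F : Euc a → Euc a} {y : Euc a} (hF : DifferentiableAt ℝ F y) (i : Fin a)
    (v : Euc a) : fderiv ℝ (fun y => F y i) y v = fderiv ℝ F y v i := by
  have h := ((EuclideanSpace.proj i : Euc a →L[ℝ] ℝ).hasFDerivAt (x := F y)).comp y hF.hasFDerivAt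
  have h2 : (fun y => F y i) = (EuclideanSpace.proj i : Euc a →L[ℝ] ℝ) ∘ F := rfl
  rw [h2, h.fderiv]
  simp

theorem det_gradMat_coord {F : Euc a → Euc a} {y : Euc a} (hF : DifferentiableAt ℝ F y) :
    (gradMat (fun i y => F y i) y).det = (fderiv ℝ F y).det := by
  rw [det_clm]
  congr 1
  ext i j
  simp [gradMat_apply, fderiv_coord hF]

theorem abs_det_le (M : Matrix (Fin a) (Fin a) ℝ) (b : Fin a → ℝ) (h : ∀ i j, |M i j| ≤ b i) :
    |M.det| ≤ a.factorial * ∏ i, b i := by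
  rw [← Matrix.det_transpose, Matrix.det_apply]
  refine (Finset.abs_sum_le_sum_abs _ _).trans ?_
  refine (Finset.sum_le_sum (g := fun _ => ∏ i, b i) fun σ _ => ?_).trans (by
    simp [Finset.card_univ, Fintype.card_perm])
  rw [Units.smul_def, zsmul_eq_mul, abs_mul]
  have h1 : |((Equiv.Perm.sign σ : ℤ) : ℝ)| = 1 := by
    rcases Int.units_eq_one_or (Equiv.Perm.sign σ) with h | h <;> simp [h]
  rw [h1, one_mul, Finset.abs_prod]
  exact Finset.prod_le_prod (fun _ _ => abs_nonneg _) fun i _ => h _ _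

theorem measurable_gradMat_det (u : Fin a → Euc a → ℝ) : Measurable fun y => (gradMat u y).det := by
  simp only [Matrix.det_apply]
  refine Finset.measurable_sum _ fun σ _ => Measurable.const_smul
    (Finset.measurable_prod _ fun i _ => ?_) _
  exact measurable_fderiv_apply_const ℝ _ _

theorem norm_stdVec (j : Fin a) : ‖stdVec j‖ = 1 := by simp

theorem HomC1.gradMat_smul {u : Fin a → Euc a → ℝ} (hu : ∀ i, HomC1 (u i)) {t : ℝ} (ht : 0 < t)
    (y : Euc a) : gradMat u (t • y) = gradMat u y := by
  ext i j
  rw [gradMat_apply, gradMat_apply, (hu i).fderiv_smul ht]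

theorem HomC1.exists_abs_gradMat_det_le {u : Fin a → Euc a → ℝ} (hu : ∀ i, HomC1 (u i)) :
    ∃ C : ℝ, ∀ y, |(gradMat u y).det| ≤ C := by
  choose C hC0 hC using fun i => (hu i).exists_norm_fderiv_le
  refine ⟨_, fun y => abs_det_le _ C fun i j => ?_⟩
  have := (fderiv ℝ (u i) y).le_of_opNorm_le (hC i y) (stdVec j)
  rwa [norm_stdVec, mul_one] at this

theorem HomC1.integrableOn_gradMat_det {u : Fin a → Euc a → ℝ} (hu : ∀ i, HomC1 (u i)) :
    IntegrableOn (fun y => (gradMat u y).det) (Metric.ball (0 : Euc a) 1) := by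
  obtain ⟨C, hC⟩ := HomC1.exists_abs_gradMat_det_le hu
  exact integrableOn_ball_of_bounded (measurable_gradMat_det u) hC

/-- Linear maps close to the identity have determinant close to one. -/
theorem exists_det_near_one (a : ℕ) {c : ℝ} (hc : 0 < c) :
    ∃ η : ℝ, 0 < η ∧ ∀ L : Euc a →L[ℝ] Euc a,
      ‖L - ContinuousLinearMap.id ℝ (Euc a)‖ ≤ η → |L.det - 1| ≤ c := by
  have h1 : Continuous fun L : Euc a →L[ℝ] Euc a => L.det := ContinuousLinearMap.continuous_det
  have h2 := h1.tendsto (ContinuousLinearMap.id ℝ (Euc a))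
  rw [Metric.tendsto_nhds_nhds] at h2
  obtain ⟨δ, hδ, h⟩ := h2 c hc
  refine ⟨δ / 2, by positivity, fun L hL => ?_⟩
  have h3 := (h (x := L) (by rw [dist_eq_norm]; linarith)).le
  rw [Real.dist_eq] at h3
  have h4 : (ContinuousLinearMap.id ℝ (Euc a)).det = 1 := LinearMap.det_id
  rwa [h4] at h3

/-- A perturbation of the identity by a map with Lipschitz constant less than one is bijective. -/
theorem bijective_of_norm_sub_le {E : Type*} [NormedAddCommGroup E] [NormedSpace ℝ E]
    [CompleteSpace E] {G : E → E} {c : ℝ} (hc : c < 1)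
    (h : ∀ y z, ‖(G y - y) - (G z - z)‖ ≤ c * ‖y - z‖) : Function.Bijective G := by
  have hA : ApproximatesLinearOn G ((ContinuousLinearEquiv.refl ℝ E : E ≃L[ℝ] E) : E →L[ℝ] E)
      Set.univ c.toNNReal := by
    intro y _ z _
    have h1 : G y - G z - ((ContinuousLinearEquiv.refl ℝ E : E ≃L[ℝ] E) : E →L[ℝ] E) (y - z) =
        (G y - y) - (G z - z) := by
      simp only [ContinuousLinearEquiv.coe_coe, ContinuousLinearEquiv.coe_refl', id_eq]
      abel
    rw [h1]
    refine (h y z).trans ?_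
    gcongr
    exact Real.le_coe_toNNReal c
  have hN : Subsingleton E ∨ c.toNNReal <
      ‖((ContinuousLinearEquiv.refl ℝ E).symm : E →L[ℝ] E)‖₊⁻¹ := by
    rcases subsingleton_or_nontrivial E with hE | hE
    · exact Or.inl hE
    · right
      have h1 : ((ContinuousLinearEquiv.refl ℝ E).symm : E →L[ℝ] E) =
        ContinuousLinearMap.id ℝ E := rfl
      have h2 : ‖ContinuousLinearMap.id ℝ E‖₊ = 1 := by
        ext; exact ContinuousLinearMap.norm_id
      rw [h1, h2, inv_one]
      rwa [Real.toNNReal_lt_one]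
  exact ⟨Set.injOn_univ.1 (hA.injOn hN), hA.surjective hN⟩

/-- The determinant as a linear combination of the determinants of `1 + tᵢ M`. -/
theorem exists_det_eq_sum [NeZero a] {τ : ℝ} (hτ : 0 < τ) :
    ∃ (t w : Fin (a + 1) → ℝ), (∀ k, 0 ≤ t k ∧ t k ≤ τ) ∧ ∑ k, w k = 0 ∧
      ∀ M : Matrix (Fin a) (Fin a) ℝ, M.det = ∑ k, w k * (1 + t k • M).det := by
  -- These are a + 1 distinct nodes in [0, τ], enough to recover the coefficient of degree a of a
  -- polynomial of degree at most a.
  set t : Fin (a + 1) → ℝ := fun k => τ * k / (a + 1) with ht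
  have hinj : Set.InjOn t (Finset.univ : Finset (Fin (a + 1))) := by
    intro k _ l _ hkl
    have h1 : (τ / (a + 1)) ≠ 0 := by positivity
    have h2 : (τ / (a + 1)) * (k : ℝ) = (τ / (a + 1)) * (l : ℝ) := by
      simp only [ht] at hkl
      calc _ = τ * k / (a + 1) := by ring
        _ = _ := hkl
        _ = _ := by ring
    exact Fin.ext (by exact_mod_cast mul_left_cancel₀ h1 h2)
  have ha := NeZero.ne a
  have key : ∀ P : Polynomial ℝ, P.natDegree ≤ a →
      P.coeff a = ∑ k, (∏ j ∈ Finset.univ.erase k, (t k - t j))⁻¹ * P.eval (t k) := by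
    intro P hP
    have h := Lagrange.coeff_eq_sum hinj (P := P) (by
      rw [Finset.card_univ, Fintype.card_fin]
      exact (Polynomial.degree_le_of_natDegree_le hP).trans_lt (by exact_mod_cast Nat.lt_succ_self a))
    rw [Finset.card_univ, Fintype.card_fin, Nat.add_sub_cancel] at h
    rw [h]
    exact Finset.sum_congr rfl fun k _ => by rw [div_eq_mul_inv, mul_comm]
  refine ⟨t, fun k => (∏ j ∈ Finset.univ.erase k, (t k - t j))⁻¹, fun k => ⟨by positivity, ?_⟩,
    ?_, fun M => ?_⟩
  · have : (k : ℝ) ≤ a := by exact_mod_cast Nat.lt_succ_iff.1 k.2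
    simp only [ht]
    rw [div_le_iff₀ (by positivity)]
    nlinarith
  -- The constant polynomial 1 has no term of degree a, as a ≠ 0; so the weights sum to zero.
  · have h := key 1 (by simp)
    rw [Polynomial.coeff_one, if_neg ha] at h
    simpa using h.symm
  -- The determinant of M is the coefficient of degree a of det(1 + X M).
  · have h := key (Matrix.det ((Polynomial.X : Polynomial ℝ) • M.map Polynomial.C +
      (1 : Matrix (Fin a) (Fin a) ℝ).map Polynomial.C)) (by
        simpa using Polynomial.natDegree_det_X_add_C_le M 1)
    have h2 := Polynomial.coeff_det_X_add_C_card M 1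
    rw [Fintype.card_fin] at h2
    rw [h2] at h
    rw [h]
    refine Finset.sum_congr rfl fun k _ => ?_
    congr 1
    rw [← Polynomial.coe_evalRingHom, RingHom.map_det]
    congr 1
    ext i j
    simp only [Matrix.one_apply, RingHom.mapMatrix_apply, Polynomial.coe_evalRingHom,
      Matrix.map_apply, Matrix.add_apply, Matrix.smul_apply, smul_eq_mul, Polynomial.eval_add,
      Polynomial.eval_mul, Polynomial.eval_X, Polynomial.eval_C]
    ring

end Determinants

/-! ### Jacobian determinants are null Lagrangians. -/

section NullLagrangian

variable {a : ℕ}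

/-- The integral of the Jacobian determinant of a compactly supported map vanishes. -/
theorem integral_det_gradMat_eq_zero [NeZero a] (u : Fin a → Euc a → ℝ)
    (hu : ∀ i, ContDiff ℝ 1 (u i)) (hc : ∀ i, HasCompactSupport (u i)) :
    ∫ y, (gradMat u y).det = 0 := by
  set ψ : Euc a → Euc a := fun y => WithLp.toLp 2 fun i => u i y with hψ
  have hψC : ContDiff ℝ 1 ψ := by
    rw [contDiff_euclidean]; exact hu
  obtain ⟨R, hR0, hR⟩ : ∃ R : ℝ, 0 < R ∧ ∀ y, R ≤ ‖y‖ → ∀ i, u i y = 0 := by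
    choose R hR using fun i => (hc i).isCompact.isBounded.subset_ball (0 : Euc a)
    obtain ⟨R', hR'⟩ : ∃ R', ∀ i, R i ≤ R' :=
      ⟨∑ i, |R i|, fun i => (le_abs_self _).trans
        (Finset.single_le_sum (f := fun i => |R i|) (fun _ _ => abs_nonneg _) (Finset.mem_univ i))⟩
    refine ⟨max R' 1, by positivity, fun y hy i => ?_⟩
    by_contra hne
    have h1 := hR i (subset_tsupport _ hne)
    rw [mem_ball_zero_iff] at h1
    linarith [hR' i, le_max_left R' 1]
  have hψ0 : ∀ y, R ≤ ‖y‖ → ψ y = 0 := by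
    intro y hy
    ext i
    simp [hψ, hR y hy i]
  have hψc : HasCompactSupport ψ := by
    refine HasCompactSupport.of_support_subset_isCompact (isCompact_closedBall (0 : Euc a) R) ?_
    intro y hy
    rw [mem_closedBall_zero_iff]
    by_contra h
    exact hy (hψ0 y (not_le.1 h).le)
  obtain ⟨K, hK⟩ := hψC.lipschitzWith_of_hasCompactSupport hψc one_ne_zero
  obtain ⟨η, hη, hdet⟩ := exists_det_near_one a (c := 1 / 2) (by norm_num)
  -- For 0 ≤ t ≤ τ the map y + t ψ(y) has a Jacobian within η of the identity, hence positive
  -- determinant, and its perturbation has Lipschitz constant at most 1/2.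
  set τ : ℝ := min η (1 / 2) / (K + 1) with hτ
  have hτ0 : 0 < τ := by positivity
  have hτK : τ * (K + 1) = min η (1 / 2) := by rw [hτ]; field_simp
  have hmat : ∀ (t : ℝ) y, (1 + t • gradMat u y).det =
      (ContinuousLinearMap.id ℝ (Euc a) + t • fderiv ℝ ψ y).det := by
    intro t y
    rw [det_clm]
    congr 1
    ext i j
    have h1 : fderiv ℝ (u i) y (stdVec j) = fderiv ℝ ψ y (stdVec j) i :=
      fderiv_coord (F := ψ) (hψC.differentiable one_ne_zero y) i _
    simp [gradMat_apply, h1, Matrix.one_apply]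
  have hvol : ∀ t : ℝ, 0 ≤ t → t ≤ τ →
      IntegrableOn (fun y => (1 + t • gradMat u y).det) (Metric.ball (0 : Euc a) R) ∧
      ∫ y in Metric.ball (0 : Euc a) R, (1 + t • gradMat u y).det =
        volume.real (Metric.ball (0 : Euc a) R) := by
    intro t ht0 ht
    have hDψ : ∀ y, ‖t • fderiv ℝ ψ y‖ ≤ min η (1 / 2) := by
      intro y
      rw [norm_smul, Real.norm_of_nonneg ht0, ← hτK]
      have := norm_fderiv_le_of_lipschitz ℝ hK (x₀ := y)
      gcongr
      linarith
    have hpos : ∀ y, 0 < (1 + t • gradMat u y).det := by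
      intro y
      rw [hmat]
      have := hdet (ContinuousLinearMap.id ℝ (Euc a) + t • fderiv ℝ ψ y) (by
        rw [add_sub_cancel_left]; exact (hDψ y).trans (min_le_left _ _))
      linarith [(abs_le.1 this).1]
    set Φ : Euc a → Euc a := fun y => y + t • ψ y with hΦ
    have hbij : Function.Bijective Φ := by
      refine bijective_of_norm_sub_le (c := 1 / 2) (by norm_num) fun y z => ?_
      have h1 := lipschitzWith_iff_norm_sub_le.1 hK y z
      have h2 : (Φ y - y) - (Φ z - z) = t • (ψ y - ψ z) := by
        simp only [hΦ, add_sub_cancel_left, smul_sub]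
      rw [h2, norm_smul, Real.norm_of_nonneg ht0]
      have h3 : t * (K : ℝ) ≤ 1 / 2 := by
        have : t * (K : ℝ) ≤ τ * (K + 1) := by gcongr; linarith
        exact this.trans (hτK ▸ min_le_right _ _)
      calc t * ‖ψ y - ψ z‖ ≤ t * (K * ‖y - z‖) := by gcongr
        _ = (t * K) * ‖y - z‖ := by ring
        _ ≤ _ := by gcongr
    have hfix : ∀ y, R ≤ ‖y‖ → Φ y = y := fun y hy => by simp [hΦ, hψ0 y hy]
    -- A bijection that fixes every point outside the ball permutes the ball. Hence the integral of
    -- det(1 + t ∇u) over it does not depend on t.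
    have himg : Φ '' Metric.ball 0 R = Metric.ball 0 R := by
      ext z
      simp only [Set.mem_image, mem_ball_zero_iff]
      constructor
      · rintro ⟨y, hy, rfl⟩
        by_contra h
        have h1 := hbij.1 (hfix _ (not_lt.1 h))
        rw [h1] at h
        exact h hy
      · intro hz
        obtain ⟨y, rfl⟩ := hbij.2 z
        refine ⟨y, ?_, rfl⟩
        by_contra h
        rw [hfix y (not_lt.1 h)] at hz
        exact h hz
    have hder : ∀ y ∈ Metric.ball (0 : Euc a) R, HasFDerivWithinAt Φ
        (ContinuousLinearMap.id ℝ (Euc a) + t • fderiv ℝ ψ y) (Metric.ball 0 R) y := fun y _ =>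
      ((hasFDerivAt_id y).add
        ((hψC.differentiable one_ne_zero y).hasFDerivAt.const_smul t)).hasFDerivWithinAt
    have hch := integral_image_eq_integral_abs_det_fderiv_smul volume measurableSet_ball hder
      hbij.1.injOn (fun _ => (1 : ℝ))
    have hint := (integrableOn_image_iff_integrableOn_abs_det_fderiv_smul volume measurableSet_ball
      hder hbij.1.injOn (fun _ => (1 : ℝ))).1 (by
        rw [himg]; exact integrableOn_const measure_ball_lt_top.ne)
    simp only [← hmat, abs_of_pos (hpos _), smul_eq_mul, mul_one] at hch hint
    refine ⟨hint, ?_⟩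
    rw [← hch, himg]
    simp
  -- The integral of det ∇u is a combination of integrals that all equal the volume of the ball,
  -- with weights of sum zero.
  obtain ⟨t, w, ht, hw, hsum⟩ := exists_det_eq_sum (a := a) hτ0
  have hsupp' : ∀ y, y ∉ Metric.ball (0 : Euc a) R → (gradMat u y).det = 0 ∨ ‖y‖ = R := by
    intro y hy
    rw [mem_ball_zero_iff, not_lt] at hy
    rcases hy.eq_or_lt with h | h
    · exact Or.inr h.symm
    · left
      refine Matrix.det_eq_zero_of_row_eq_zero 0 fun j => ?_
      have h1 : u 0 =ᶠ[𝓝 y] fun _ => 0 := by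
        filter_upwards [continuous_norm.continuousAt.eventually (lt_mem_nhds h)] with z hz
        exact hR z (le_of_lt hz) 0
      rw [gradMat_apply, h1.fderiv_eq]
      simp
  have hball : ∫ y, (gradMat u y).det = ∫ y in Metric.ball (0 : Euc a) R, (gradMat u y).det := by
    rw [← integral_indicator measurableSet_ball]
    refine integral_congr_ae ?_
    have hsph : ∀ᵐ y : Euc a, y ∉ Metric.sphere (0 : Euc a) R :=
      compl_mem_ae_iff.2 (Measure.addHaar_sphere _ _ _)
    filter_upwards [hsph] with y hy
    by_cases h : y ∈ Metric.ball (0 : Euc a) R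
    · rw [Set.indicator_of_mem h]
    · rw [Set.indicator_of_notMem h]
      exact (hsupp' y h).resolve_right fun h2 => hy (by simpa using h2)
  rw [hball]
  simp only [hsum (gradMat u _)]
  rw [integral_finsetSum _ fun k _ => (hvol (t k) (ht k).1 (ht k).2).1.const_mul _]
  simp only [integral_const_mul, fun k => (hvol (t k) (ht k).1 (ht k).2).2]
  rw [← Finset.sum_mul, hw, zero_mul]

end NullLagrangian

/-! ### Radial cutoff functions. -/

section RadialCutoff

variable {a : ℕ}

theorem integrable_of_bounded_of_support {h : Euc a → ℝ} (hm : Measurable h) {C R : ℝ}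
    (hC : ∀ y, |h y| ≤ C) (hR : ∀ y, R ≤ ‖y‖ → h y = 0) : Integrable h := by
  have h1 : IntegrableOn h (Metric.ball (0 : Euc a) R) :=
    Measure.integrableOn_of_bounded measure_ball_lt_top.ne hm.aestronglyMeasurable
      (Eventually.of_forall hC)
  refine (integrableOn_iff_integrable_of_support_subset fun y hy => ?_).1 h1
  rw [mem_ball_zero_iff]
  by_contra h2
  exact hy (hR y (not_lt.1 h2))

/-- A cutoff function of the radius supported in `[1, 3]`. -/
def radialBump : ContDiffBump (2 : ℝ) := ⟨1 / 2, 1, by norm_num, by norm_num⟩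

/-- A cutoff function of the radius that is one near `[1, 3]`. -/
def radialBumpOne : ContDiffBump (2 : ℝ) := ⟨5 / 4, 3 / 2, by norm_num, by norm_num⟩

theorem bump_norm_eventuallyEq_zero {χ : ContDiffBump (2 : ℝ)} {y : Euc a}
    (hy : χ.rOut < |‖y‖ - 2|) : (fun z : Euc a => χ ‖z‖) =ᶠ[𝓝 y] fun _ => 0 := by
  have h : ContinuousAt (fun z : Euc a => |‖z‖ - 2|) y := by fun_prop
  filter_upwards [h.eventually (lt_mem_nhds hy)] with z hz
  exact χ.zero_of_le_dist (by rw [Real.dist_eq]; exact hz.le)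

theorem bumpOne_norm_eventuallyEq_one {y : Euc a} (hy : |‖y‖ - 2| ≤ 1) :
    (fun z : Euc a => radialBumpOne ‖z‖) =ᶠ[𝓝 y] fun _ => 1 := by
  have h : ContinuousAt (fun z : Euc a => |‖z‖ - 2|) y := by fun_prop
  filter_upwards [h.eventually (gt_mem_nhds (by linarith : |‖y‖ - 2| < 5 / 4))] with z hz
  exact radialBumpOne.one_of_mem_closedBall (by rw [mem_closedBall_iff_norm]; exact hz.le)

/-- An outer radius below 2 makes the cutoff vanish near the origin, the only point where a
homogeneous function can fail to be C¹. -/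
theorem contDiff_bump_norm_mul {χ : ContDiffBump (2 : ℝ)} (hχ : χ.rOut < 2) {v : Euc a → ℝ}
    (hv : ContDiffOn ℝ 1 v {0}ᶜ) : ContDiff ℝ 1 fun y : Euc a => χ ‖y‖ * v y := by
  refine contDiff_iff_contDiffAt.2 fun y => ?_
  by_cases hy : y = 0
  · have h1 : (fun y : Euc a => χ ‖y‖ * v y) =ᶠ[𝓝 y] fun _ => 0 := by
      filter_upwards [bump_norm_eventuallyEq_zero (χ := χ) (y := y) (by simpa [hy] using hχ)]
        with z hz
      simp [hz]
    exact contDiffAt_const.congr_of_eventuallyEq h1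
  · exact (χ.contDiffAt.comp y (contDiffAt_norm ℝ hy)).mul
      (hv.contDiffAt (isOpen_compl_singleton.mem_nhds hy))

theorem contDiff_bump_norm {χ : ContDiffBump (2 : ℝ)} (hχ : χ.rOut < 2) :
    ContDiff ℝ 1 fun y : Euc a => χ ‖y‖ := by
  simpa using contDiff_bump_norm_mul (a := a) hχ (v := fun _ => 1) contDiffOn_const

theorem bump_norm_eq_zero {χ : ContDiffBump (2 : ℝ)} (hχ : χ.rOut < 2) {y : Euc a}
    (hy : 4 ≤ ‖y‖) : χ ‖y‖ = 0 :=
  χ.zero_of_le_dist (by rw [Real.dist_eq, abs_of_nonneg (by linarith)]; linarith)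

theorem hasCompactSupport_bump_norm_mul {χ : ContDiffBump (2 : ℝ)} (hχ : χ.rOut < 2)
    (v : Euc a → ℝ) : HasCompactSupport fun y : Euc a => χ ‖y‖ * v y := by
  refine HasCompactSupport.of_support_subset_isCompact (isCompact_closedBall (0 : Euc a) 4) ?_
  intro y hy
  rw [mem_closedBall_zero_iff]
  by_contra h
  exact hy (by simp [bump_norm_eq_zero hχ (not_le.1 h).le])

theorem exists_norm_fderiv_radialBump_le (a : ℕ) :
    ∃ C : ℝ, 0 ≤ C ∧ ∀ y : Euc a, ‖fderiv ℝ (fun y : Euc a => radialBump ‖y‖) y‖ ≤ C := by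
  have h1 : ContDiff ℝ 1 fun y : Euc a => radialBump ‖y‖ :=
    contDiff_bump_norm (by norm_num [radialBump])
  have h2 : HasCompactSupport fun y : Euc a => radialBump ‖y‖ := by
    simpa using hasCompactSupport_bump_norm_mul (a := a) (χ := radialBump)
      (by norm_num [radialBump]) fun _ => 1
  obtain ⟨K, hK⟩ := h1.lipschitzWith_of_hasCompactSupport h2 one_ne_zero
  exact ⟨K, K.2, fun y => norm_fderiv_le_of_lipschitz ℝ hK⟩

theorem fderiv_radialBump_eq_zero {y : Euc a} (hy : 1 < |‖y‖ - 2|) :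
    fderiv ℝ (fun y : Euc a => radialBump ‖y‖) y = 0 := by
  rw [(bump_norm_eventuallyEq_zero (χ := radialBump) hy).fderiv_eq]
  simp

/-- The total mass of the radial cutoff function. -/
def bumpMass (a : ℕ) : ℝ := ∫ r in Set.Ioi (0 : ℝ), r ^ (a - 1) * radialBump r

theorem integral_radialBump_mul [NeZero a] (h : Euc a → ℝ)
    (hh : ∀ t : ℝ, 0 < t → ∀ y, h (t • y) = h y) :
    ∫ y, radialBump ‖y‖ * h y =
      bumpMass a * (a * ∫ y in Metric.ball (0 : Euc a) 1, h y) := by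
  have ha : (a : ℝ) ≠ 0 := by simp [NeZero.ne a]
  rw [integral_radial_mul _ h hh, integral_ball_eq_sphere h hh, mul_inv_cancel_left₀ ha, bumpMass]

theorem bumpMass_pos [NeZero a] : 0 < bumpMass a := by
  have ha : (0 : ℝ) < a := by exact_mod_cast Nat.pos_of_ne_zero (NeZero.ne a)
  have h1 := integral_radialBump_mul (a := a) (fun _ => 1) (fun _ _ _ => rfl)
  simp only [mul_one, integral_const, smul_eq_mul, measureReal_restrict_apply_univ] at h1
  have hv := volume_ball_pos (a := a)
  have h2 : 0 < ∫ y : Euc a, radialBump ‖y‖ := by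
    have hc : ContDiff ℝ 1 fun y : Euc a => radialBump ‖y‖ :=
      contDiff_bump_norm (by norm_num [radialBump])
    obtain ⟨x, hx⟩ := exists_ne (0 : Euc a)
    refine hc.continuous.integral_pos_of_hasCompactSupport_nonneg_nonzero ?_
      (fun y => radialBump.nonneg) (x := (2 * ‖x‖⁻¹) • x) ?_
    · simpa using hasCompactSupport_bump_norm_mul (a := a) (χ := radialBump)
        (by norm_num [radialBump]) fun _ => 1
    · have : ‖(2 * ‖x‖⁻¹) • x‖ = 2 := by
        rw [norm_smul, Real.norm_of_nonneg (by positivity)]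
        field_simp
      simp only [this]
      exact (radialBump.pos_of_mem_ball (Metric.mem_ball_self radialBump.rOut_pos)).ne'
  rw [h1] at h2
  exact pos_of_mul_pos_left h2 (by positivity)

end RadialCutoff

/-! ### Mean estimates for Jacobian minors. -/

section Minors

variable {a : ℕ}

/-- Where `radialBump` lives, `radialBumpOne` is locally 1, so the cutoffs change only row i₀ and
the product rule splits that row. Elsewhere row i₀ vanishes on both sides. The second summand
contains u i₀ without derivatives. -/
theorem det_gradMat_cutoff {u : Fin a → Euc a → ℝ} (hu : ∀ i, HomC1 (u i)) (i₀ : Fin a)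
    (y : Euc a) :
    (gradMat (fun i y => (if i = i₀ then radialBump ‖y‖ else radialBumpOne ‖y‖) * u i y) y).det =
      radialBump ‖y‖ * (gradMat u y).det +
        ((gradMat u y).updateRow i₀ fun j =>
          u i₀ y * fderiv ℝ (fun y : Euc a => radialBump ‖y‖) y (stdVec j)).det := by
  by_cases hy : 1 < |‖y‖ - 2|
  · have h0 := bump_norm_eventuallyEq_zero (χ := radialBump) hy
    rw [Matrix.det_eq_zero_of_row_eq_zero i₀, Matrix.det_eq_zero_of_row_eq_zero (A :=
      (gradMat u y).updateRow i₀ _) i₀, h0.eq_of_nhds]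
    · simp
    · intro j
      simp [fderiv_radialBump_eq_zero hy]
    · intro j
      have h1 : (fun y => (if i₀ = i₀ then radialBump ‖y‖ else radialBumpOne ‖y‖) * u i₀ y)
          =ᶠ[𝓝 y] fun _ => 0 := by
        filter_upwards [h0] with z hz
        simp [hz]
      rw [gradMat_apply, h1.fderiv_eq]
      simp
  · have hy1 : |‖y‖ - 2| ≤ 1 := not_lt.1 hy
    have hy0 : y ≠ 0 := by
      rintro rfl
      norm_num at hy1
    have hb : DifferentiableAt ℝ (fun y : Euc a => radialBump ‖y‖) y :=
      (contDiff_bump_norm (a := a) (χ := radialBump) (by norm_num [radialBump])).differentiable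
        one_ne_zero y
    have h1 : gradMat (fun i y =>
        (if i = i₀ then radialBump ‖y‖ else radialBumpOne ‖y‖) * u i y) y =
        (gradMat u y).updateRow i₀ (radialBump ‖y‖ • gradMat u y i₀ + fun j =>
          u i₀ y * fderiv ℝ (fun y : Euc a => radialBump ‖y‖) y (stdVec j)) := by
      ext i j
      by_cases hi : i = i₀
      · subst hi
        rw [gradMat_apply, Matrix.updateRow_self]
        simp only [if_true]
        rw [fderiv_fun_mul hb ((hu i).differentiableAt hy0)]
        simp [gradMat_apply]
      · rw [gradMat_apply, Matrix.updateRow_ne hi, gradMat_apply]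
        have h2 : (fun y => (if i = i₀ then radialBump ‖y‖ else radialBumpOne ‖y‖) * u i y)
            =ᶠ[𝓝 y] u i := by
          filter_upwards [bumpOne_norm_eventuallyEq_one hy1] with z hz
          simp [hi, hz]
        rw [h2.fderiv_eq]
    rw [h1, Matrix.det_updateRow_add, Matrix.det_updateRow_smul, Matrix.updateRow_eq_self]

theorem measurable_det_updateRow (u : Fin a → Euc a → ℝ) (i₀ : Fin a) {w : Euc a → Fin a → ℝ}
    (hw : ∀ j, Measurable fun y => w y j) :
    Measurable fun y => ((gradMat u y).updateRow i₀ (w y)).det := by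
  simp only [Matrix.det_apply]
  refine Finset.measurable_sum _ fun σ _ => Measurable.const_smul
    (Finset.measurable_prod _ fun i _ => ?_) _
  by_cases h : σ i = i₀
  · simp only [h, Matrix.updateRow_self]
    exact hw i
  · simp only [Matrix.updateRow_ne h]
    exact measurable_fderiv_apply_const ℝ _ _

/-- A minor of the Jacobian matrix of a homogeneous map is, in the mean, controlled by the
`L¹` norm of any of the functions involved and the derivatives of the others. -/
theorem exists_abs_integral_det_gradMat_le (a : ℕ) [NeZero a] :
    ∃ C : ℝ, 0 ≤ C ∧ ∀ (u : Fin a → Euc a → ℝ) (K : Fin a → ℝ) (i₀ : Fin a),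
      (∀ i, HomC1 (u i)) → (∀ i, 0 ≤ K i) →
      (∀ i, i ≠ i₀ → ∀ y, y ≠ 0 → ‖fderiv ℝ (u i) y‖ ≤ K i) →
      |∫ y in Metric.ball (0 : Euc a) 1, (gradMat u y).det| ≤
        C * (∏ i ∈ Finset.univ.erase i₀, K i) * ∫ x : Sph a, |u i₀ x| ∂unifMeasure a := by
  obtain ⟨M, hM0, hM⟩ := exists_norm_fderiv_radialBump_le a
  have ha : (0 : ℝ) < a := by exact_mod_cast Nat.pos_of_ne_zero (NeZero.ne a)
  have hm := bumpMass_pos (a := a)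
  have hv := volume_ball_pos (a := a)
  -- This is the radial integral of r^(a-1) · r up to radius 4, beyond the support of the cutoff;
  -- the extra factor r is the homogeneity of u i₀.
  set D : ℝ := ∫ r in Set.Ioi (0 : ℝ), r ^ (a - 1) * (Set.Iio (4 : ℝ)).indicator (fun r => r) r
    with hD
  have hD0 : 0 ≤ D := by
    refine setIntegral_nonneg measurableSet_Ioi fun r hr => ?_
    have hr : 0 < r := hr
    by_cases h : r < 4
    · simp only [Set.indicator_of_mem (Set.mem_Iio.2 h)]
      positivity
    · simp [h]
  refine ⟨(bumpMass a * a)⁻¹ * (a.factorial * M * (D * (a * volume.real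
    (Metric.ball (0 : Euc a) 1)))), by positivity, fun u K i₀ hu hK hK' => ?_⟩
  set Q : ℝ := ∏ i ∈ Finset.univ.erase i₀, K i with hQ
  have hQ0 : 0 ≤ Q := Finset.prod_nonneg fun i _ => hK i
  set X : Euc a → ℝ := fun y => radialBump ‖y‖ with hX
  set v : Fin a → Euc a → ℝ :=
    fun i y => (if i = i₀ then radialBump ‖y‖ else radialBumpOne ‖y‖) * u i y with hv'
  set w : Euc a → ℝ := fun y => ((gradMat u y).updateRow i₀ fun j =>
    u i₀ y * fderiv ℝ X y (stdVec j)).det with hw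
  obtain ⟨L, hL0, hL⟩ := (hu i₀).exists_norm_fderiv_le
  have hzero : ∫ y, (gradMat v y).det = 0 := by
    refine integral_det_gradMat_eq_zero v (fun i => ?_) (fun i => ?_)
    · by_cases hi : i = i₀ <;> simp only [hv', hi, if_true, if_false]
      · exact contDiff_bump_norm_mul (by norm_num [radialBump]) (hu i₀).contDiffOn
      · exact contDiff_bump_norm_mul (by norm_num [radialBumpOne]) (hu i).contDiffOn
    · by_cases hi : i = i₀ <;> simp only [hv', hi, if_true, if_false]
      · exact hasCompactSupport_bump_norm_mul (by norm_num [radialBump]) _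
      · exact hasCompactSupport_bump_norm_mul (by norm_num [radialBumpOne]) _
  have hdetm := measurable_gradMat_det u
  obtain ⟨C₁, hC₁⟩ := HomC1.exists_abs_gradMat_det_le hu
  have hXm : Measurable X :=
    (contDiff_bump_norm (a := a) (χ := radialBump) (by norm_num [radialBump])).continuous.measurable
  have hint1 : Integrable fun y => X y * (gradMat u y).det := by
    refine integrable_of_bounded_of_support (C := C₁) (R := 4) (hXm.mul hdetm) (fun y => ?_)
      (fun y hy => ?_)
    · rw [abs_mul, abs_of_nonneg radialBump.nonneg]
      exact (mul_le_of_le_one_left (abs_nonneg _) radialBump.le_one).trans (hC₁ y)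
    · simp [hX, bump_norm_eq_zero (χ := radialBump) (by norm_num [radialBump]) hy]
  have hwm : Measurable w := by
    refine measurable_det_updateRow u i₀ fun j => ?_
    exact (hu i₀).continuous.measurable.mul (measurable_fderiv_apply_const ℝ _ _)
  have hw0 : ∀ y, 4 ≤ ‖y‖ → w y = 0 := by
    intro y hy
    refine Matrix.det_eq_zero_of_row_eq_zero i₀ fun j => ?_
    have : (1 : ℝ) < |‖y‖ - 2| := by rw [abs_of_nonneg (by linarith)]; linarith
    simp [hX, fderiv_radialBump_eq_zero this]
  have hwb : ∀ y, y ≠ 0 → |w y| ≤ a.factorial * M * Q * |u i₀ y| := by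
    intro y hy
    refine (abs_det_le _ (fun i => if i = i₀ then |u i₀ y| * M else K i) fun i j => ?_).trans ?_
    · by_cases hi : i = i₀
      · subst hi
        rw [Matrix.updateRow_self, if_pos rfl, abs_mul]
        have := (fderiv ℝ X y).le_of_opNorm_le (hM y) (stdVec j)
        rw [norm_stdVec, mul_one] at this
        gcongr
        exact this
      · rw [Matrix.updateRow_ne hi, if_neg hi]
        have := (fderiv ℝ (u i) y).le_of_opNorm_le (hK' i hi y hy) (stdVec j)
        rwa [norm_stdVec, mul_one] at this
    · rw [← Finset.mul_prod_erase _ _ (Finset.mem_univ i₀), if_pos rfl,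
        Finset.prod_congr rfl fun i hi => if_neg (Finset.ne_of_mem_erase hi), ← hQ]
      exact le_of_eq (by ring)
  have hne : ∀ᵐ y : Euc a, y ≠ 0 := Measure.ae_ne volume 0
  -- The truncation of |u i₀| to radius less than 4, written as a radial function times one that is
  -- constant on rays, so that polar coordinates apply.
  set G : Euc a → ℝ := fun y => (Set.Iio (4 : ℝ)).indicator (fun r => r) ‖y‖ * (|u i₀ y| / ‖y‖)
    with hG
  have hGdeg : ∀ t : ℝ, 0 < t → ∀ y, |u i₀ (t • y)| / ‖t • y‖ = |u i₀ y| / ‖y‖ := by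
    intro t ht y
    rw [(hu i₀).smul t ht, smul_eq_mul, abs_mul, norm_smul, Real.norm_of_nonneg ht.le,
      abs_of_pos ht, mul_div_mul_left _ _ ht.ne']
  have hwG : ∀ᵐ y : Euc a, |w y| ≤ a.factorial * M * Q * G y := by
    filter_upwards [hne] with y hy
    by_cases h4 : 4 ≤ ‖y‖
    · rw [hw0 y h4]
      simp [hG, h4]
    · have h5 : G y = |u i₀ y| := by
        simp only [hG, Set.indicator_of_mem (Set.mem_Iio.2 (not_le.1 h4))]
        have := norm_ne_zero_iff.2 hy
        field_simp
      rw [h5]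
      exact hwb y hy
  have hGm : Measurable G :=
    ((measurable_id.indicator measurableSet_Iio).comp measurable_norm).mul
      ((hu i₀).continuous.measurable.abs.div measurable_norm)
  have hGi : Integrable G := by
    refine integrable_of_bounded_of_support (C := 4 * L) (R := 4) hGm (fun y => ?_) (fun y hy => ?_)
    · rw [abs_mul]
      gcongr
      · by_cases h : ‖y‖ < 4
        · simp [h, h.le]
        · simp [h]
      · rw [abs_div, abs_abs, abs_of_nonneg (norm_nonneg y)]
        exact div_le_of_le_mul₀ (norm_nonneg _) hL0 ((hu i₀).norm_le (fun y _ => hL y) y)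
    · simp [hG, hy]
  have hwi : Integrable w :=
    (hGi.const_mul (a.factorial * M * Q)).mono' hwm.aestronglyMeasurable hwG
  -- The cut-off Jacobian integrates to zero, which replaces the minor by w, where u i₀ is no longer
  -- differentiated.
  have hsplit : ∫ y, X y * (gradMat u y).det = -∫ y, w y := by
    have h1 : ∀ y, (gradMat v y).det = X y * (gradMat u y).det + w y :=
      det_gradMat_cutoff hu i₀
    simp only [h1] at hzero
    rw [integral_add hint1 hwi] at hzero
    linarith
  have hA := integral_radialBump_mul (fun y => (gradMat u y).det)
    (fun t ht y => by rw [HomC1.gradMat_smul hu ht])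
  have hB : |∫ y, w y| ≤ a.factorial * M * Q * ∫ y, G y := by
    rw [← integral_const_mul]
    exact (abs_integral_le_integral_abs).trans
      (integral_mono_ae hwi.abs (hGi.const_mul _) hwG)
  have hGS : ∫ y, G y = D * (a * volume.real (Metric.ball (0 : Euc a) 1) *
      ∫ x : Sph a, |u i₀ x| ∂unifMeasure a) := by
    rw [integral_radial_mul _ _ hGdeg, integral_unifMeasure, mul_inv_cancel_left₀ (by positivity)]
    congr 1
    refine integral_congr_ae (Eventually.of_forall fun x => ?_)
    simp
  have hC : ∫ y in Metric.ball (0 : Euc a) 1, (gradMat u y).det =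
      (bumpMass a * a)⁻¹ * -∫ y, w y := by
    rw [← hsplit, hA]
    field_simp
  rw [hC, abs_mul, abs_neg, abs_of_nonneg (by positivity)]
  rw [hGS] at hB
  calc _ ≤ (bumpMass a * a)⁻¹ * _ := mul_le_mul_of_nonneg_left hB (by positivity)
    _ = _ := by ring

end Minors

/-! ### The divergence theorem for homogeneous functions, and moments of the sphere. -/

section SphereMoments

variable {a : ℕ}

theorem fderiv_radialBump {y : Euc a} (hy : y ≠ 0) (i : Fin a) :
    fderiv ℝ (fun y : Euc a => radialBump ‖y‖) y (stdVec i) =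
      deriv radialBump ‖y‖ * (y i / ‖y‖) := by
  have h1 : HasDerivAt radialBump (deriv radialBump ‖y‖) ‖y‖ :=
    (radialBump.contDiff (n := 1)).differentiable one_ne_zero _ |>.hasDerivAt
  have h2 : HasFDerivAt (fun y : Euc a => ‖y‖) (fderiv ℝ (fun y : Euc a => ‖y‖) y) y :=
    ((contDiffAt_norm ℝ hy (n := 1)).differentiableAt one_ne_zero).hasFDerivAt
  have h3 : fderiv ℝ (fun y : Euc a => ‖y‖) y (stdVec i) = y i / ‖y‖ := by
    have h4 := (hasStrictFDerivAt_norm_sq y).hasFDerivAt.unique (h2.pow 2)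
    have h5 := congrArg (fun L => L (stdVec i)) h4
    have hn := norm_ne_zero_iff.2 hy
    simp [EuclideanSpace.inner_single_right] at h5
    field_simp
    linarith
  have h6 := (h1.hasFDerivAt.comp y h2).fderiv
  have h7 : (fun y : Euc a => radialBump ‖y‖) = radialBump ∘ fun y : Euc a => ‖y‖ := rfl
  rw [h7, h6]
  simp [h3, mul_comm]

/-- Integration by parts against a radial cutoff gives this with a κ that depends on the cutoff and
a alone. It need not be computed: testing with coordinate functions determines it. -/
theorem exists_integral_sphere_fderiv [NeZero a] :
    ∃ κ : ℝ, ∀ {u : Euc a → ℝ}, HomC1 u → ∀ i : Fin a,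
      ∫ x : Sph a, fderiv ℝ u x (stdVec i) ∂unifMeasure a =
        κ * ∫ x : Sph a, (x : Euc a) i * u x ∂unifMeasure a := by
  have hm := (bumpMass_pos (a := a)).ne'
  have ha : (a : ℝ) ≠ 0 := by simp [NeZero.ne a]
  have hv := (volume_ball_pos (a := a)).ne'
  refine ⟨-(bumpMass a)⁻¹ * ∫ r in Set.Ioi (0 : ℝ), r ^ (a - 1) * (r * deriv radialBump r),
    fun {u} hu i => ?_⟩
  obtain ⟨L, hL0, hL⟩ := hu.exists_norm_fderiv_le
  obtain ⟨M, hM0, hM⟩ := exists_norm_fderiv_radialBump_le a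
  set X : Euc a → ℝ := fun y => radialBump ‖y‖ with hX
  have hXC : ContDiff ℝ 1 X := contDiff_bump_norm (by norm_num [radialBump])
  have hX0 : ∀ y : Euc a, 4 ≤ ‖y‖ → X y = 0 := fun y hy =>
    bump_norm_eq_zero (by norm_num [radialBump]) hy
  have hX0' : ∀ y : Euc a, 4 ≤ ‖y‖ → fderiv ℝ X y = 0 := fun y hy =>
    fderiv_radialBump_eq_zero (by rw [abs_of_nonneg (by linarith)]; linarith)
  have hXb : ∀ y, |X y| ≤ 1 := fun y => by
    rw [abs_of_nonneg radialBump.nonneg]; exact radialBump.le_one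
  have hub : ∀ y : Euc a, ‖y‖ < 4 → |u y| ≤ L * 4 := fun y hy =>
    (hu.norm_le (fun y _ => hL y) y).trans (by gcongr)
  have hvec : ∀ (T : Euc a →L[ℝ] ℝ) {C : ℝ}, ‖T‖ ≤ C → |T (stdVec i)| ≤ C := fun T C hT => by
    have := T.le_of_opNorm_le hT (stdVec i)
    rwa [norm_stdVec, mul_one] at this
  have hparts : ∫ y, X y * fderiv ℝ u y (stdVec i) = -∫ y, fderiv ℝ X y (stdVec i) * u y := by
    refine integral_mul_fderiv_eq_neg_fderiv_mul_of_integrable ?_ ?_ ?_ (fun y _ =>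
      hXC.differentiable one_ne_zero y) (fun y hy => hu.differentiableAt ?_)
    · refine integrable_of_bounded_of_support (C := M * (L * 4)) (R := 4)
        ((measurable_fderiv_apply_const ℝ _ _).mul hu.continuous.measurable) (fun y => ?_)
        fun y hy => by simp [hX0' y hy]
      by_cases hy : ‖y‖ < 4
      · rw [abs_mul]
        exact mul_le_mul (hvec _ (hM y)) (hub y hy) (abs_nonneg _) hM0
      · simp only [hX0' y (not_lt.1 hy), zero_apply, zero_mul, abs_zero]
        positivity
    · refine integrable_of_bounded_of_support (C := 1 * L) (R := 4)
        (hXC.continuous.measurable.mul (measurable_fderiv_apply_const ℝ _ _)) (fun y => ?_)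
        fun y hy => by simp [hX0 y hy]
      rw [abs_mul]
      exact mul_le_mul (hXb y) (hvec _ (hL y)) (abs_nonneg _) zero_le_one
    · refine integrable_of_bounded_of_support (C := 1 * (L * 4)) (R := 4)
        (hXC.continuous.measurable.mul hu.continuous.measurable) (fun y => ?_)
        fun y hy => by simp [hX0 y hy]
      by_cases hy : ‖y‖ < 4
      · rw [abs_mul]
        exact mul_le_mul (hXb y) (hub y hy) (abs_nonneg _) zero_le_one
      · simp only [hX0 y (not_lt.1 hy), zero_mul, abs_zero]
        positivity
    · rintro rfl
      have h1 := bump_norm_eventuallyEq_zero (a := a) (χ := radialBump) (y := 0)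
        (by norm_num [radialBump])
      exact (notMem_tsupport_iff_eventuallyEq.2 h1) hy
  have h1 := integral_radial_mul (a := a) radialBump (fun y => fderiv ℝ u y (stdVec i))
    (fun t ht y => by rw [hu.fderiv_smul ht])
  have h2 := integral_radial_mul (a := a) (fun r => r * deriv radialBump r)
    (fun y => y i * u y / ‖y‖ ^ 2) (fun t ht y => by
      rw [hu.smul t ht, norm_smul, Real.norm_of_nonneg ht.le]
      simp only [PiLp.smul_apply, smul_eq_mul]
      rw [mul_pow, show t * y i * (t * u y) = t ^ 2 * (y i * u y) by ring,
        mul_div_mul_left _ _ (by positivity)])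
  have h3 : ∫ y, fderiv ℝ X y (stdVec i) * u y =
      ∫ y : Euc a, ‖y‖ * deriv radialBump ‖y‖ * (y i * u y / ‖y‖ ^ 2) := by
    refine integral_congr_ae ?_
    filter_upwards [Measure.ae_ne volume (0 : Euc a)] with y hy
    have := norm_ne_zero_iff.2 hy
    rw [fderiv_radialBump hy]
    field_simp
  rw [h3, h2, h1] at hparts
  have h4 : ∀ x : Sph a, (x : Euc a) i * u x / ‖(x : Euc a)‖ ^ 2 = (x : Euc a) i * u x := by
    intro x; simp
  simp only [h4] at hparts
  rw [integral_unifMeasure, integral_unifMeasure]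
  change bumpMass a * _ = _ at hparts
  rw [eq_comm, ← mul_right_inj' hm, mul_left_comm (bumpMass a) _ (∫ x : Sph a, fderiv ℝ u x
    (stdVec i) ∂_), hparts]
  field_simp

/-- The divergence theorem on the ball for homogeneous functions. -/
theorem integral_ball_fderiv [NeZero a] {u : Euc a → ℝ} (hu : HomC1 u) (i : Fin a) :
    ∫ y in Metric.ball (0 : Euc a) 1, fderiv ℝ u y (stdVec i) =
      a * volume.real (Metric.ball (0 : Euc a) 1) *
        ∫ x : Sph a, (x : Euc a) i * u x ∂unifMeasure a := by
  obtain ⟨κ, hκ⟩ := exists_integral_sphere_fderiv (a := a)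
  have ha : (a : ℝ) ≠ 0 := by simp [NeZero.ne a]
  have hv := volume_ball_pos (a := a)
  have hprob := isProbabilityMeasure_unifMeasure (a := a)
  have h1 : ∀ k : Fin a, 1 = κ * ∫ x : Sph a, (x : Euc a) k * (x : Euc a) k ∂unifMeasure a := by
    intro k
    have h := hκ (HomC1.id.clm_comp (EuclideanSpace.proj k : Euc a →L[ℝ] ℝ)) k
    have h2 : ∀ y : Euc a, fderiv ℝ (fun y : Euc a =>
        (EuclideanSpace.proj k : Euc a →L[ℝ] ℝ) y) y (stdVec k) = 1 := by
      intro y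
      rw [ContinuousLinearMap.fderiv]
      simp
    simp only [h2] at h
    simpa using h
  -- Summing the test identities over the coordinates and using |x|² = 1 on the sphere gives κ = a.
  have h3 : (a : ℝ) = κ := by
    have h4 : ∑ k : Fin a, (1 : ℝ) =
        κ * ∫ x : Sph a, ∑ k, (x : Euc a) k * (x : Euc a) k ∂unifMeasure a := by
      rw [integral_finsetSum, Finset.mul_sum]
      · exact Finset.sum_congr rfl fun k _ => h1 k
      · intro k _
        refine (Continuous.integrable_of_hasCompactSupport (by fun_prop)
          (HasCompactSupport.of_compactSpace _))
    have h5 : ∀ x : Sph a, ∑ k, (x : Euc a) k * (x : Euc a) k = 1 := by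
      intro x
      have := EuclideanSpace.norm_sq_eq (x : Euc a)
      simp only [norm_eq_of_mem_sphere, Real.norm_eq_abs, sq_abs] at this
      rw [one_pow] at this
      exact (Finset.sum_congr rfl fun k _ => by ring).trans this.symm
    simp only [h5] at h4
    simpa using h4
  rw [integral_ball_eq_unifMeasure _ fun t ht y => by rw [hu.fderiv_smul ht], hκ hu i, ← h3]
  ring

theorem integral_sphere_coord_mul_coord [NeZero a] (i j : Fin a) :
    ∫ x : Sph a, (x : Euc a) i * (x : Euc a) j ∂unifMeasure a = if i = j then (a : ℝ)⁻¹ else 0 := by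
  have ha : (a : ℝ) ≠ 0 := by simp [NeZero.ne a]
  have hv := volume_ball_pos (a := a)
  have h := integral_ball_fderiv (a := a)
    (HomC1.id.clm_comp (EuclideanSpace.proj j : Euc a →L[ℝ] ℝ)) i
  have h1 : ∀ y : Euc a, fderiv ℝ (fun y : Euc a => (EuclideanSpace.proj j : Euc a →L[ℝ] ℝ) y) y
      (stdVec i) = if i = j then 1 else 0 := by
    intro y
    rw [ContinuousLinearMap.fderiv]
    simp [eq_comm]
  simp only [h1] at h
  simp only [integral_const, smul_eq_mul, measureReal_restrict_apply_univ,
    show ∀ y : Euc a, (EuclideanSpace.proj j : Euc a →L[ℝ] ℝ) y = y j from fun _ => rfl] at h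
  rw [← mul_right_inj' (mul_ne_zero ha hv.ne'), ← h]
  split_ifs
  · field_simp
  · simp

theorem integral_sphere_coord [NeZero a] (i : Fin a) :
    ∫ x : Sph a, (x : Euc a) i ∂unifMeasure a = 0 := by
  have hv := volume_ball_pos (a := a)
  have h := integral_ball_eq_unifMeasure (a := a) (fun y => y i / ‖y‖) (fun t ht y => by
    rw [norm_smul, Real.norm_of_nonneg ht.le]
    simp only [PiLp.smul_apply, smul_eq_mul]
    rw [mul_div_mul_left _ _ ht.ne'])
  -- The integrand is odd and the ball is symmetric.
  have h2 : ∫ y in Metric.ball (0 : Euc a) 1, y i / ‖y‖ = 0 := by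
    have h3 := integral_neg_eq_self
      ((Metric.ball (0 : Euc a) 1).indicator fun y => y i / ‖y‖) volume
    have h4 : ∀ y : Euc a, (Metric.ball (0 : Euc a) 1).indicator (fun y => y i / ‖y‖) (-y) =
        -(Metric.ball (0 : Euc a) 1).indicator (fun y => y i / ‖y‖) y := by
      intro y
      by_cases hy : ‖y‖ < 1 <;> simp [hy, neg_div]
    simp only [h4, integral_neg] at h3
    rw [integral_indicator measurableSet_ball] at h3
    linarith
  rw [h2] at h
  have h5 := (mul_eq_zero.1 h.symm).resolve_left hv.ne'
  simpa using h5

end SphereMoments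

/-! ### The volume enclosed by a star-shaped hypersurface. -/

section RadialBodies

variable {a : ℕ}

/-- The matrix determinant lemma gives μ^a (1 + ℓ(y)/μ). This is the Jacobian of y ↦ μ(y) y for μ
constant on rays, where dμ(y) = 0 along y. -/
theorem det_smul_id_add_smulRight {μ : ℝ} (hμ : μ ≠ 0) (ℓ : Euc a →L[ℝ] ℝ) (y : Euc a)
    (hℓ : ℓ y = 0) : (μ • ContinuousLinearMap.id ℝ (Euc a) + ℓ.smulRight y).det = μ ^ a := by
  have h1 : (Matrix.of fun i j : Fin a =>
      (μ • ContinuousLinearMap.id ℝ (Euc a) + ℓ.smulRight y) (stdVec j) i) =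
      μ • (1 + Matrix.replicateCol Unit (fun i => μ⁻¹ * y i) *
        Matrix.replicateRow Unit fun j => ℓ (stdVec j)) := by
    ext i j
    simp [Matrix.mul_apply, Matrix.one_apply, mul_add]
    field_simp
  have h2 : (fun j => ℓ (stdVec j)) ⬝ᵥ (fun i => μ⁻¹ * y i) = 0 := by
    have h3 : y = ∑ j, y j • stdVec j := by
      ext i
      simp [Finset.sum_apply, Pi.single_apply]
    have h4 : ℓ y = ∑ j, y j * ℓ (stdVec j) := by
      conv_lhs => rw [h3]
      simp
    rw [dotProduct]
    calc ∑ j, ℓ (stdVec j) * (μ⁻¹ * y j) = μ⁻¹ * ∑ j, y j * ℓ (stdVec j) := by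
          rw [Finset.mul_sum]; exact Finset.sum_congr rfl fun j _ => by ring
      _ = 0 := by rw [← h4, hℓ, mul_zero]
  rw [det_clm, h1, Matrix.det_smul, Matrix.det_one_add_replicateCol_mul_replicateRow, h2]
  simp

theorem det_comp_clm (L M : Euc a →L[ℝ] Euc a) : (L.comp M).det = L.det * M.det :=
  LinearMap.det_comp _ _

/-- An expanding linear map has determinant at least one in absolute value. -/
theorem one_le_abs_det_of_expanding {U : Euc a →L[ℝ] Euc a} (hU : ∀ x, ‖x‖ ≤ ‖U x‖) :
    1 ≤ |U.det| := by
  have hinj : Function.Injective U := by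
    refine (injective_iff_map_eq_zero U).2 fun x hx => ?_
    have := hU x
    rw [hx, norm_zero] at this
    exact norm_le_zero_iff.1 this
  have hsurj : Function.Surjective U :=
    LinearMap.surjective_of_injective (f := (U : Euc a →ₗ[ℝ] Euc a)) hinj
  have h1 := Measure.addHaar_image_continuousLinearMap volume U (Metric.ball (0 : Euc a) 1)
  -- An expanding bijection maps the ball onto a set containing it, and |det U| is the ratio of the
  -- volumes.
  have h2 : Metric.ball (0 : Euc a) 1 ⊆ U '' Metric.ball 0 1 := by
    intro z hz
    obtain ⟨x, rfl⟩ := hsurj z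
    rw [mem_ball_zero_iff] at hz
    exact ⟨x, mem_ball_zero_iff.2 ((hU x).trans_lt hz), rfl⟩
  have h3 := measure_mono (μ := volume) h2
  rw [h1] at h3
  have h4 := ENNReal.toReal_mono (ENNReal.mul_ne_top ENNReal.ofReal_ne_top measure_ball_lt_top.ne) h3
  rw [ENNReal.toReal_mul, ENNReal.toReal_ofReal (abs_nonneg _)] at h4
  have hv := volume_ball_pos (a := a)
  rw [measureReal_def] at hv
  by_contra h5
  nlinarith [not_le.1 h5]

/-- Bijective homogeneous maps with positive Jacobian sweep out the whole unit ball once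
their values are normalised. -/
theorem integral_normalized_det [NeZero a] {p : Euc a → Euc a} (hp : HomC1 p)
    (hbij : Function.Bijective p) (hdet : ∀ y ≠ 0, 0 < (fderiv ℝ p y).det) :
    ∫ y in Metric.ball (0 : Euc a) 1, (‖y‖ / ‖p y‖) ^ a * (fderiv ℝ p y).det =
      volume.real (Metric.ball (0 : Euc a) 1) := by
  have hp0 : ∀ y ≠ 0, p y ≠ 0 := fun y hy h => hy (hbij.1 (h.trans hp.map_zero.symm))
  set μ : Euc a → ℝ := fun y => ‖y‖ / ‖p y‖ with hμ
  have hμpos : ∀ y ≠ 0, 0 < μ y := fun y hy =>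
    div_pos (norm_pos_iff.2 hy) (norm_pos_iff.2 (hp0 y hy))
  have hμdeg : ∀ t : ℝ, 0 < t → ∀ y, μ (t • y) = μ y := by
    intro t ht y
    simp only [hμ, hp.smul t ht, norm_smul, Real.norm_of_nonneg ht.le]
    rw [mul_div_mul_left _ _ ht.ne']
  have hμd : ∀ y ≠ 0, DifferentiableAt ℝ μ y := by
    intro y hy
    have h1 : DifferentiableAt ℝ (fun y : Euc a => ‖y‖) y := differentiableAt_id.norm ℝ hy
    have h2 : DifferentiableAt ℝ (fun y : Euc a => ‖p y‖) y :=
      (hp.differentiableAt hy).norm ℝ (hp0 y hy)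
    simp only [hμ, div_eq_mul_inv]
    exact h1.mul (h2.inv (norm_ne_zero_iff.2 (hp0 y hy)))
  have hμ0 : ∀ y ≠ 0, fderiv ℝ μ y y = 0 := by
    intro y hy
    have h1 : HasDerivAt (fun t : ℝ => t • y) y 1 := by
      simpa using (hasDerivAt_id (1 : ℝ)).smul_const y
    have h2 : HasFDerivAt μ (fderiv ℝ μ y) ((1 : ℝ) • y) := by
      rw [one_smul]; exact (hμd y hy).hasFDerivAt
    have h3 := h2.comp_hasDerivAt (1 : ℝ) h1
    refine h3.unique ((hasDerivAt_const (1 : ℝ) (μ y)).congr_of_eventuallyEq ?_)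
    filter_upwards [lt_mem_nhds (zero_lt_one (α := ℝ))] with t ht
    exact hμdeg t ht y
  -- Rescaling p on each ray makes it preserve norms, so it becomes a bijection of the punctured
  -- ball. Its Jacobian μ^a det Dp is the integrand, by the factorisation Θ(y) = p(μ(y) y).
  set Θ : Euc a → Euc a := fun y => μ y • p y with hΘ
  have hΘn : ∀ y, ‖Θ y‖ = ‖y‖ := by
    intro y
    by_cases hy : y = 0
    · simp [hΘ, hy, hp.map_zero]
    · have := norm_ne_zero_iff.2 (hp0 y hy)
      simp only [hΘ, hμ, norm_smul, norm_div, norm_norm]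
      field_simp
  have hpμ : ∀ y ≠ 0, Θ y = p (μ y • y) := fun y hy => (hp.smul _ (hμpos y hy) y).symm
  have hinj : Set.InjOn Θ (Metric.ball (0 : Euc a) 1 \ {0}) := by
    intro y hy z hz h
    rw [hpμ y hy.2, hpμ z hz.2] at h
    have h1 := hbij.1 h
    have h2 : ‖y‖ = ‖z‖ := by rw [← hΘn y, ← hΘn z, hpμ y hy.2, hpμ z hz.2, h]
    have h3 := congrArg norm h1
    rw [norm_smul, norm_smul, h2, Real.norm_of_nonneg (hμpos y hy.2).le,
      Real.norm_of_nonneg (hμpos z hz.2).le] at h3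
    have h4 := mul_right_cancel₀ (norm_ne_zero_iff.2 hz.2) h3
    rw [h4] at h1
    exact smul_right_injective _ (hμpos z hz.2).ne' h1
  have himg : Θ '' (Metric.ball (0 : Euc a) 1 \ {0}) = Metric.ball (0 : Euc a) 1 \ {0} := by
    ext z
    simp only [Set.mem_image, Set.mem_sdiff, mem_ball_zero_iff, Set.mem_singleton_iff]
    constructor
    · rintro ⟨y, ⟨hy, hy0⟩, rfl⟩
      rw [← norm_eq_zero, hΘn, norm_eq_zero]
      exact ⟨hy, hy0⟩
    · rintro ⟨hz, hz0⟩
      obtain ⟨x, rfl⟩ := hbij.2 z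
      have hx : x ≠ 0 := by rintro rfl; exact hz0 hp.map_zero
      have hΘx : Θ ((μ x)⁻¹ • x) = p x := by
        have h1 := hμpos x hx
        have h2 : (μ x)⁻¹ • x ≠ 0 := smul_ne_zero (inv_ne_zero h1.ne') hx
        rw [hpμ _ h2, hμdeg _ (inv_pos.2 h1), smul_inv_smul₀ h1.ne']
      refine ⟨(μ x)⁻¹ • x, ⟨?_, ?_⟩, hΘx⟩
      · rwa [← hΘn, hΘx]
      · exact smul_ne_zero (inv_ne_zero (hμpos x hx).ne') hx
  set DΘ : Euc a → Euc a →L[ℝ] Euc a := fun y =>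
    (fderiv ℝ p y).comp (μ y • ContinuousLinearMap.id ℝ (Euc a) + (fderiv ℝ μ y).smulRight y)
    with hDΘ
  have hder : ∀ y ∈ Metric.ball (0 : Euc a) 1 \ {0},
      HasFDerivWithinAt Θ (DΘ y) (Metric.ball (0 : Euc a) 1 \ {0}) y := by
    intro y hy
    have h1 := (hμd y hy.2).hasFDerivAt.smul (hp.differentiableAt hy.2).hasFDerivAt
    refine HasFDerivAt.hasFDerivWithinAt ?_
    have h2 : DΘ y = μ y • fderiv ℝ p y + (fderiv ℝ μ y).smulRight (p y) := by
      refine ContinuousLinearMap.ext fun v => ?_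
      simp [hDΘ, hp.euler hy.2]
    rw [h2]
    exact h1
  have hDdet : ∀ y ≠ 0, (DΘ y).det = μ y ^ a * (fderiv ℝ p y).det := by
    intro y hy
    rw [hDΘ, det_comp_clm, det_smul_id_add_smulRight (hμpos y hy).ne' _ _ (hμ0 y hy), mul_comm]
  have hms : MeasurableSet (Metric.ball (0 : Euc a) 1 \ {0}) :=
    measurableSet_ball.diff (measurableSet_singleton 0)
  have hch := integral_image_eq_integral_abs_det_fderiv_smul volume hms hder hinj
    (fun _ => (1 : ℝ))
  rw [himg] at hch
  have hae : (Metric.ball (0 : Euc a) 1 \ {0} : Set (Euc a)) =ᵐ[volume] Metric.ball 0 1 :=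
    sdiff_null_ae_eq_self (measure_singleton _)
  rw [← setIntegral_congr_set hae]
  rw [setIntegral_congr_set hae] at hch
  simp only [integral_const, smul_eq_mul, mul_one, measureReal_restrict_apply_univ] at hch
  rw [hch]
  refine setIntegral_congr_fun hms fun y hy => ?_
  have h1 : 0 < μ y ^ a * (fderiv ℝ p y).det := mul_pos (pow_pos (hμpos y hy.2) _) (hdet y hy.2)
  simp only [hDdet y hy.2, abs_of_pos h1]
  rfl

/-- With ρ = (s/t)² ≤ 1 one has t/m = (1 + ρ)^(-1/2), and (1 - ρ/4)² (1 + ρ) ≥ 1 on [0, 1]. -/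
theorem quarter_le_one_sub_div {s t : ℝ} (ht : 0 < t) (hs : 0 ≤ s) {m : ℝ} (hm : 0 < m)
    (h : m ^ 2 = t ^ 2 + s ^ 2) (hst : s ≤ t) : (s / t) ^ 2 / 4 ≤ 1 - t / m := by
  set ρ := (s / t) ^ 2 with hρ
  have hρ0 : 0 ≤ ρ := by positivity
  have hρ1 : ρ ≤ 1 := by
    have : s / t ≤ 1 := (div_le_one ht).2 hst
    have h0 : 0 ≤ s / t := by positivity
    rw [hρ]; nlinarith
  have h1 : (t / m) ^ 2 * (1 + ρ) = 1 := by
    rw [hρ, div_pow, div_pow, h]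
    have : t ^ 2 + s ^ 2 ≠ 0 := by positivity
    field_simp
  have h2 : 0 < t / m := by positivity
  have h3 : t / m ≤ 1 - ρ / 4 := by
    by_contra h4
    have h5 : (1 - ρ / 4) ^ 2 < (t / m) ^ 2 := by
      have := not_le.1 h4
      nlinarith
    have h6 : (1 - ρ / 4) ^ 2 * (1 + ρ) < 1 := by
      exact (mul_lt_mul_of_pos_right h5 (by linarith : 0 < 1 + ρ)).trans_eq h1
    nlinarith [mul_nonneg hρ0 (sub_nonneg.2 hρ1), mul_nonneg (mul_nonneg hρ0 hρ0) hρ0]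
  linarith

/-- The volume enclosed by the projection of a neck to a spacelike plane. -/
theorem volume_add_le_integral_det [NeZero a] {Y : Type*} [NormedAddCommGroup Y] [NormedSpace ℝ Y]
    {η : ℝ} (hη1 : η < 1)
    (hη : ∀ L : Euc a →L[ℝ] Euc a, ‖L - ContinuousLinearMap.id ℝ (Euc a)‖ ≤ η →
      |L.det - 1| ≤ 1 / 2)
    {U : Euc a →L[ℝ] Euc a} (hU : ∀ x, ‖x‖ ≤ ‖U x‖) (hUdet : 0 < U.det)
    {q : Euc a → Euc a} (hq : HomC1 q)
    (hqη : ∀ y ≠ 0, ‖fderiv ℝ q y - ContinuousLinearMap.id ℝ (Euc a)‖ ≤ η)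
    {r : Euc a → Y} (hr : HomC1 r) (hqr : ∀ y, ‖U (q y)‖ ^ 2 = ‖y‖ ^ 2 + ‖r y‖ ^ 2)
    (hr1 : ∀ y, ‖r y‖ ≤ ‖y‖) :
    volume.real (Metric.ball (0 : Euc a) 1) * (1 + (∫ x : Sph a, ‖r x‖ ^ 2 ∂unifMeasure a) / 8) ≤
      ∫ y in Metric.ball (0 : Euc a) 1, (fderiv ℝ (fun y => U (q y)) y).det := by
  set p : Euc a → Euc a := fun y => U (q y) with hp'
  have hp : HomC1 p := hq.clm_comp U
  have hUinj : Function.Injective U := by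
    refine (injective_iff_map_eq_zero U).2 fun x hx => ?_
    have := hU x
    rw [hx, norm_zero] at this
    exact norm_le_zero_iff.1 this
  have hUbij : Function.Bijective U :=
    ⟨hUinj, LinearMap.surjective_of_injective (f := (U : Euc a →ₗ[ℝ] Euc a)) hUinj⟩
  have hqbij : Function.Bijective q := by
    refine bijective_of_norm_sub_le hη1 fun y z => ?_
    have h1 : HomC1 fun y => q y + (-ContinuousLinearMap.id ℝ (Euc a)) y :=
      hq.add (HomC1.id.clm_comp _)
    have h2 := h1.norm_sub_le (C := η) (fun y hy => ?_) y z
    · simpa [sub_eq_add_neg] using h2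
    · rw [fderiv_fun_add (hq.differentiableAt hy) (ContinuousLinearMap.differentiableAt _),
        ContinuousLinearMap.fderiv, ← sub_eq_add_neg]
      exact hqη y hy
  have hbij : Function.Bijective p := hUbij.comp hqbij
  have hU1 : 1 ≤ U.det := by
    have := one_le_abs_det_of_expanding hU
    rwa [abs_of_pos hUdet] at this
  -- The factor U is expanding, so det U ≥ 1; the factor q is close to the identity, so its Jacobian
  -- is at least 1/2.
  have hdet : ∀ y ≠ 0, 1 / 2 ≤ (fderiv ℝ p y).det := by
    intro y hy
    have h1 : fderiv ℝ p y = U.comp (fderiv ℝ q y) :=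
      (U.hasFDerivAt.comp y (hq.differentiableAt hy).hasFDerivAt).fderiv
    rw [h1, det_comp_clm]
    have h2 := (abs_le.1 (hη _ (hqη y hy))).1
    nlinarith
  have hvol := integral_normalized_det hp hbij fun y hy => (by norm_num : (0 : ℝ) < 1 / 2).trans_le
    (hdet y hy)
  have hpn : ∀ y, ‖y‖ ≤ ‖p y‖ := fun y => by
    refine le_of_sq_le_sq ?_ (norm_nonneg _)
    rw [hp', hqr y]
    nlinarith [sq_nonneg ‖r y‖]
  have hmeas : Measurable fun y => (fderiv ℝ p y).det :=
    (ContinuousLinearMap.continuous_det.measurable).comp (measurable_fderiv ℝ p)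
  obtain ⟨C, hC0, hC⟩ := hp.exists_norm_fderiv_le
  obtain ⟨D, hD⟩ : ∃ D : ℝ, ∀ y, |(fderiv ℝ p y).det| ≤ D := by
    refine ⟨a.factorial * ∏ _i : Fin a, C, fun y => ?_⟩
    rw [det_clm]
    refine abs_det_le _ (fun _ => C) fun i j => ?_
    have h1 := (fderiv ℝ p y).le_of_opNorm_le (hC y) (stdVec j)
    rw [norm_stdVec, mul_one] at h1
    exact (PiLp.norm_apply_le _ i).trans h1
  have hi1 : IntegrableOn (fun y => (fderiv ℝ p y).det) (Metric.ball (0 : Euc a) 1) :=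
    integrableOn_ball_of_bounded hmeas hD
  have hμ1 : ∀ y, ‖y‖ / ‖p y‖ ≤ 1 := fun y => div_le_one_of_le₀ (hpn y) (norm_nonneg _)
  have hμ0 : ∀ y, 0 ≤ ‖y‖ / ‖p y‖ := fun y => by positivity
  have hi2 : IntegrableOn (fun y => (‖y‖ / ‖p y‖) ^ a * (fderiv ℝ p y).det)
      (Metric.ball (0 : Euc a) 1) := by
    refine integrableOn_ball_of_bounded (C := 1 * D)
      (((measurable_norm.div hp.continuous.measurable.norm).pow_const a).mul hmeas) fun y => ?_
    rw [abs_mul, abs_of_nonneg (pow_nonneg (hμ0 y) _)]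
    exact mul_le_mul (pow_le_one₀ (hμ0 y) (hμ1 y)) (hD y) (abs_nonneg _) zero_le_one
  have hi3 : IntegrableOn (fun y => (‖r y‖ / ‖y‖) ^ 2 / 8) (Metric.ball (0 : Euc a) 1) := by
    refine integrableOn_ball_of_bounded (C := 1)
      (((hr.continuous.norm.measurable.div measurable_norm).pow_const 2).div_const 8) fun y => ?_
    have h1 : ‖r y‖ / ‖y‖ ≤ 1 := div_le_one_of_le₀ (hr1 y) (norm_nonneg _)
    have h2 : 0 ≤ ‖r y‖ / ‖y‖ := by positivity
    rw [abs_of_nonneg (by positivity)]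
    nlinarith
  -- The normalised Jacobian integrates to the volume of the ball, so the excess comes from 1 -
  -- (‖y‖/‖p y‖)^a ≥ 1 - ‖y‖/‖p y‖, which is at least (‖r‖/‖y‖)²/4. The lower bound 1/2 of the
  -- Jacobian turns 1/4 into 1/8.
  have hkey : ∫ y in Metric.ball (0 : Euc a) 1, (‖r y‖ / ‖y‖) ^ 2 / 8 ≤
      ∫ y in Metric.ball (0 : Euc a) 1,
        ((fderiv ℝ p y).det - (‖y‖ / ‖p y‖) ^ a * (fderiv ℝ p y).det) := by
    refine integral_mono_ae hi3 (hi1.sub hi2) ?_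
    filter_upwards [ae_restrict_of_ae (Measure.ae_ne volume (0 : Euc a))] with y hy
    have h1 := norm_pos_iff.2 hy
    have h2 := quarter_le_one_sub_div h1 (norm_nonneg (r y)) (h1.trans_le (hpn y)) (hqr y) (hr1 y)
    have h3 : (‖y‖ / ‖p y‖) ^ a ≤ ‖y‖ / ‖p y‖ := pow_le_of_le_one (hμ0 y) (hμ1 y) (NeZero.ne a)
    have h4 := hdet y hy
    have h5 : 0 ≤ 1 - ‖y‖ / ‖p y‖ := sub_nonneg.2 (hμ1 y)
    nlinarith
  rw [integral_sub hi1 hi2, hvol] at hkey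
  have hpol := integral_ball_eq_unifMeasure (a := a) (fun y => (‖r y‖ / ‖y‖) ^ 2 / 8)
    (fun t ht y => by
      rw [hr.smul t ht, norm_smul, norm_smul, Real.norm_of_nonneg ht.le,
        mul_div_mul_left _ _ ht.ne'])
  have hpol2 : ∀ x : Sph a, (‖r x‖ / ‖(x : Euc a)‖) ^ 2 / 8 = ‖r x‖ ^ 2 / 8 := fun x => by simp
  simp only [hpol2] at hpol
  rw [integral_div _ fun x : Sph a => ‖r x‖ ^ 2] at hpol
  rw [hpol] at hkey
  linarith

end RadialBodies

/-! ### The Cauchy–Binet formula. -/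

section CauchyBinet

/-- A weighted Cauchy–Binet formula, summed over all maps instead of all subsets. -/
theorem det_sum_mul_mul {κ : Type*} [Fintype κ] [DecidableEq κ] {a : ℕ} (w : κ → ℝ)
    (X Y : κ → Fin a → ℝ) :
    (Matrix.of fun i j => ∑ k, w k * X k i * Y k j).det =
      (a.factorial : ℝ)⁻¹ * ∑ φ : Fin a → κ, (∏ i, w (φ i)) *
        (Matrix.of fun i j => X (φ i) j).det * (Matrix.of fun i j => Y (φ i) j).det := by
  set d : (Fin a → κ) → ℝ := fun φ => (Matrix.of fun i j => Y (φ i) j).det with hd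
  have h1 : (Matrix.of fun i j => ∑ k, w k * X k i * Y k j).det =
      ∑ φ : Fin a → κ, (∏ i, (w (φ i) * X (φ i) i)) * d φ := by
    have h2 : (Matrix.of fun i j => ∑ k, w k * X k i * Y k j) =
        fun i => ∑ k, (w k * X k i) • Y k := by
      ext i j
      simp [Finset.sum_apply]
    change Matrix.detRowAlternating.toMultilinearMap _ = _
    rw [h2, MultilinearMap.map_sum]
    refine Finset.sum_congr rfl fun φ _ => ?_
    rw [MultilinearMap.map_smul_univ]
    rfl
  -- Relabelling φ by σ leaves the weights alone and puts the sign of σ on the determinant of Y.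
  -- Averaging over all σ assembles the determinant of X, which explains the factor 1/a!.
  have h3 : ∀ σ : Equiv.Perm (Fin a), (Matrix.of fun i j => ∑ k, w k * X k i * Y k j).det =
      ∑ φ : Fin a → κ, (∏ i, w (φ i)) *
        (((Equiv.Perm.sign σ : ℤ) : ℝ) * ∏ i, X (φ (σ i)) i) * d φ := by
    intro σ
    rw [h1, ← (Equiv.arrowCongr σ (Equiv.refl κ)).symm.sum_comp]
    refine Finset.sum_congr rfl fun φ _ => ?_
    have h4 : d ((Equiv.arrowCongr σ (Equiv.refl κ)).symm φ) =
        ((Equiv.Perm.sign σ : ℤ) : ℝ) * d φ := by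
      rw [hd]
      exact Matrix.det_permute σ (Matrix.of fun i j => Y (φ i) j)
    have h5 : ∏ i, w (φ (σ i)) = ∏ i, w (φ i) := Equiv.prod_comp σ fun i => w (φ i)
    rw [h4, ← h5]
    simp only [Equiv.arrowCongr_symm, Equiv.arrowCongr_apply, Equiv.symm_symm, Equiv.refl_symm,
      Equiv.coe_refl, Function.comp_apply, id_eq, Finset.prod_mul_distrib]
    ring
  have h6 : (a.factorial : ℝ) * (Matrix.of fun i j => ∑ k, w k * X k i * Y k j).det =
      ∑ φ : Fin a → κ, (∏ i, w (φ i)) * (Matrix.of fun i j => X (φ i) j).det * d φ := by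
    have h7 : ∑ _σ : Equiv.Perm (Fin a), (Matrix.of fun i j => ∑ k, w k * X k i * Y k j).det =
        (a.factorial : ℝ) * (Matrix.of fun i j => ∑ k, w k * X k i * Y k j).det := by
      simp [Finset.card_univ, Fintype.card_perm]
    rw [← h7, Finset.sum_congr rfl fun σ _ => h3 σ, Finset.sum_comm]
    refine Finset.sum_congr rfl fun φ _ => ?_
    rw [← Finset.sum_mul, ← Finset.mul_sum, Matrix.det_apply']
    rfl
  rw [← h6, inv_mul_cancel_left₀ (by positivity)]

end CauchyBinet

/-! ### Coordinates on ℝ^a × ℝ^b. -/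

section Coordinates

variable {a b : ℕ}

/-- The coordinates on `ℝ^a × ℝ^b`. -/
def coord : Fin a ⊕ Fin b → (Euc a × Euc b →L[ℝ] ℝ) :=
  Sum.elim (fun i => (EuclideanSpace.proj i : Euc a →L[ℝ] ℝ).comp (ContinuousLinearMap.fst ℝ _ _))
    fun j => (EuclideanSpace.proj j : Euc b →L[ℝ] ℝ).comp (ContinuousLinearMap.snd ℝ _ _)

@[simp] theorem coord_inl (i : Fin a) (w : Euc a × Euc b) :
    coord (b := b) (Sum.inl i) w = w.1 i := rfl

@[simp] theorem coord_inr (j : Fin b) (w : Euc a × Euc b) :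
    coord (a := a) (Sum.inr j) w = w.2 j := rfl

/-- The standard basis of `ℝ^a × ℝ^b`. -/
def stdPair : Fin a ⊕ Fin b → Euc a × Euc b :=
  Sum.elim (fun i => (stdVec i, 0)) fun j => (0, stdVec j)

theorem euc_eq_sum (y : Euc a) : y = ∑ j, y j • stdVec j := by
  ext i
  simp [Finset.sum_apply, Pi.single_apply]

theorem eq_sum_coord (w : Euc a × Euc b) : w = ∑ k, coord k w • stdPair k := by
  rw [Fintype.sum_sum_type]
  refine Prod.ext ?_ ?_
  · simpa [stdPair, Prod.fst_sum] using euc_eq_sum w.1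
  · simpa [stdPair, Prod.snd_sum] using euc_eq_sum w.2

/-- The signs of the standard inner product in the standard basis. -/
def coordSign : Fin a ⊕ Fin b → ℝ := Sum.elim (fun _ => 1) fun _ => -1

theorem stdForm_eq_sum (u v : Euc a × Euc b) :
    stdForm a b u v = ∑ k, coordSign k * coord k u * coord k v := by
  rw [stdForm_apply, Fintype.sum_sum_type, PiLp.inner_apply, PiLp.inner_apply]
  simp [coordSign, mul_comm, sub_eq_add_neg]

theorem multilinear_eq_sum (m : MultilinearMap ℝ (fun _ : Fin a => Euc a × Euc b) ℝ)
    (v : Fin a → Euc a × Euc b) :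
    m v = ∑ φ : Fin a → Fin a ⊕ Fin b, (∏ i, coord (φ i) (v i)) * m fun i => stdPair (φ i) := by
  conv_lhs => rw [show v = fun i => ∑ k, coord k (v i) • stdPair k from
    funext fun i => eq_sum_coord (v i)]
  rw [MultilinearMap.map_sum]
  exact Finset.sum_congr rfl fun φ _ => by rw [MultilinearMap.map_smul_univ, smul_eq_mul]

end Coordinates

/-! ### The energy as a double integral and in Plücker coordinates. -/

section Energy

variable {a b : ℕ}

/-- The determinant whose double integral is the energy. -/
def pairDet (F : Euc a → Euc a × Euc b) (y z : Euc a) : ℝ :=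
  (Matrix.of fun i j : Fin a =>
    stdForm a b (fderiv ℝ F y (stdVec i)) (fderiv ℝ F z (stdVec j))).det

/-- The energy of the directed volume of a body, as a double integral. -/
def pairEnergy (F : Euc a → Euc a × Euc b) : ℝ :=
  ∫ y in Metric.ball (0 : Euc a) 1, ∫ z in Metric.ball (0 : Euc a) 1, pairDet F y z

/-- The rows `φ` of a body in coordinates. -/
def rows (F : Euc a → Euc a × Euc b) (φ : Fin a → Fin a ⊕ Fin b) (i : Fin a) (y : Euc a) : ℝ :=
  coord (φ i) (F y)

/-- The coordinate `φ` of the directed volume. -/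
def minorInt (F : Euc a → Euc a × Euc b) (φ : Fin a → Fin a ⊕ Fin b) : ℝ :=
  ∫ y in Metric.ball (0 : Euc a) 1, (gradMat (rows F φ) y).det

theorem fderiv_clm_comp {X Y : Type*} [NormedAddCommGroup X] [NormedSpace ℝ X]
    [NormedAddCommGroup Y] [NormedSpace ℝ Y] (L : X →L[ℝ] Y) {F : Euc a → X} {y : Euc a}
    (hF : DifferentiableAt ℝ F y) : fderiv ℝ (fun y => L (F y)) y = L.comp (fderiv ℝ F y) :=
  (L.hasFDerivAt.comp y hF.hasFDerivAt).fderiv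

theorem HomC1.rows {F : Euc a → Euc a × Euc b} (hF : HomC1 F) (φ : Fin a → Fin a ⊕ Fin b)
    (i : Fin a) : HomC1 (Neck.rows F φ i) :=
  hF.clm_comp (coord (φ i))

theorem gradMat_rows {F : Euc a → Euc a × Euc b} (hF : HomC1 F) (φ : Fin a → Fin a ⊕ Fin b)
    {y : Euc a} (hy : y ≠ 0) :
    gradMat (rows F φ) y = Matrix.of fun i j => coord (φ i) (fderiv ℝ F y (stdVec j)) := by
  ext i j
  rw [gradMat_apply]
  exact congrArg (fun L => L (stdVec j)) (fderiv_clm_comp (coord (φ i)) (hF.differentiableAt hy))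

theorem ae_ball_ne_zero [NeZero a] :
    ∀ᵐ y ∂(volume.restrict (Metric.ball (0 : Euc a) 1)), y ≠ 0 :=
  ae_restrict_of_ae (Measure.ae_ne volume (0 : Euc a))

theorem pairDet_eq_sum {F : Euc a → Euc a × Euc b} (hF : HomC1 F) {y z : Euc a} (hy : y ≠ 0)
    (hz : z ≠ 0) : pairDet F y z = (a.factorial : ℝ)⁻¹ * ∑ φ : Fin a → Fin a ⊕ Fin b,
      (∏ i, coordSign (φ i)) * (gradMat (rows F φ) y).det * (gradMat (rows F φ) z).det := by
  have h := det_sum_mul_mul (coordSign (a := a) (b := b))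
    (fun k i => coord k (fderiv ℝ F y (stdVec i))) (fun k i => coord k (fderiv ℝ F z (stdVec i)))
  simp only [← stdForm_eq_sum] at h
  simp only [gradMat_rows hF _ hy, gradMat_rows hF _ hz]
  exact h

/-- The energy in the Plücker coordinates of the directed volume. -/
theorem pairEnergy_eq_sum [NeZero a] {F : Euc a → Euc a × Euc b} (hF : HomC1 F) :
    pairEnergy F = (a.factorial : ℝ)⁻¹ * ∑ φ : Fin a → Fin a ⊕ Fin b,
      (∏ i, coordSign (φ i)) * minorInt F φ ^ 2 := by
  have hint : ∀ φ, IntegrableOn (fun y => (gradMat (rows F φ) y).det) (Metric.ball (0 : Euc a) 1) :=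
    fun φ => HomC1.integrableOn_gradMat_det (hF.rows φ)
  have h1 : ∀ y ≠ 0, ∫ z in Metric.ball (0 : Euc a) 1, pairDet F y z =
      (a.factorial : ℝ)⁻¹ * ∑ φ : Fin a → Fin a ⊕ Fin b,
        (∏ i, coordSign (φ i)) * (gradMat (rows F φ) y).det * minorInt F φ := by
    intro y hy
    rw [integral_congr_ae (ae_ball_ne_zero.mono fun z hz => pairDet_eq_sum hF hy hz),
      integral_const_mul, integral_finsetSum _ fun φ _ => (hint φ).const_mul _]
    simp only [integral_const_mul]
    rfl
  rw [pairEnergy, integral_congr_ae (ae_ball_ne_zero.mono fun y hy => h1 y hy), integral_const_mul,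
    integral_finsetSum _ fun φ _ => ((hint φ).const_mul _).mul_const _]
  simp only [integral_mul_const, integral_const_mul]
  congr 1
  exact Finset.sum_congr rfl fun φ _ => by rw [sq, mul_assoc]; rfl

/-- The integrand is already invariant pointwise; this allows the neck to be replaced by a rotated
one. -/
theorem pairEnergy_isometry [NeZero a] {F : Euc a → Euc a × Euc b} (hF : HomC1 F)
    {A : Euc a × Euc b →L[ℝ] Euc a × Euc b}
    (hA : ∀ u v, stdForm a b (A u) (A v) = stdForm a b u v) :
    pairEnergy (fun y => A (F y)) = pairEnergy F := by
  refine integral_congr_ae (ae_ball_ne_zero.mono fun y hy =>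
    integral_congr_ae (ae_ball_ne_zero.mono fun z hz => ?_))
  simp only [pairDet, fderiv_clm_comp A (hF.differentiableAt hy),
    fderiv_clm_comp A (hF.differentiableAt hz), ContinuousLinearMap.comp_apply, hA]

theorem contDiff_graphMap {f : Euc a → Euc b} (hf : ContDiff ℝ 1 f) :
    ContDiff ℝ 1 (graphMap f) := by
  have h1 : ContDiff ℝ 1 fun x => 1 + ‖f x‖ ^ 2 := contDiff_const.add (hf.norm_sq ℝ)
  exact ((h1.sqrt fun x => by positivity).smul contDiff_id).prodMk hf

theorem homC1_neck {f : Euc a → Euc b} (hf : ContDiff ℝ 1 f) : HomC1 (cone (graphMap f)) :=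
  homC1_cone (contDiff_graphMap hf)

variable {V : Type*} [NormedAddCommGroup V] [NormedSpace ℝ V] [FiniteDimensional ℝ V]

/-- The form is bilinear, so each of its two arguments can be pulled through the integral as a
linear functional. -/
theorem energy_directedVolume (B : LinearMap.BilinForm ℝ V) (G : Euc a → V)
    (hint : ∀ ℓ : Module.Dual ℝ (⋀[ℝ]^a V), IntegrableOn (fun y => ℓ (exteriorPower.ιMulti ℝ a
      fun i : Fin a => fderiv ℝ G y (stdVec i))) (Metric.ball (0 : Euc a) 1)) :
    energy B (directedVolume G) =
      ∫ y in Metric.ball (0 : Euc a) 1, ∫ z in Metric.ball (0 : Euc a) 1,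
        (Matrix.of fun i j : Fin a =>
          B (fderiv ℝ G y (stdVec i)) (fderiv ℝ G z (stdVec j))).det := by
  have h1 := map_vecIntegral _ _ hint ((extForm B a).flip (directedVolume G))
  have h2 := fun y => map_vecIntegral _ _ hint
    (extForm B a (exteriorPower.ιMulti ℝ a fun i : Fin a => fderiv ℝ G y (stdVec i)))
  simp only [extForm_ιMulti] at h2
  rw [energy]
  refine h1.trans (integral_congr_ae (Eventually.of_forall fun y => ?_))
  exact h2 y

/-- Reduces the problem to the standard space. Integrability holds because each functional of the
integrand is a polynomial in the bounded partial derivatives. -/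
theorem neckEnergy_eq_pairEnergy {B : LinearMap.BilinForm ℝ V} {T : (Euc a × Euc b) ≃ₗ[ℝ] V}
    (hT : ∀ u v, B (T u) (T v) = stdForm a b u v) {f : Euc a → Euc b} (hf : ContDiff ℝ 1 f) :
    neckEnergy B T f = pairEnergy (cone (graphMap f)) := by
  have hF := homC1_neck hf
  set F := cone (graphMap f) with hFdef
  have h1 : (cone fun x => T (graphMap f x)) = fun y => T.toContinuousLinearEquiv (F y) := by
    funext y
    simp [hFdef, cone]
  have h2 : ∀ y v, fderiv ℝ (fun y => T.toContinuousLinearEquiv (F y)) y v = T (fderiv ℝ F y v) := by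
    intro y v
    have := T.toContinuousLinearEquiv.comp_fderiv (f := F) (x := y)
    exact congrArg (fun L => L v) this
  rw [neckEnergy, enclosedVolume, h1, energy_directedVolume]
  · simp only [h2, hT]
    rfl
  · intro ℓ
    obtain ⟨C, hC0, hC⟩ := hF.exists_norm_fderiv_le
    set m : MultilinearMap ℝ (fun _ : Fin a => Euc a × Euc b) ℝ :=
      (ℓ.compMultilinearMap (exteriorPower.ιMulti ℝ a).toMultilinearMap).compLinearMap
        fun _ => T.toLinearMap with hm
    have h3 : ∀ y, ℓ (exteriorPower.ιMulti ℝ a fun i : Fin a =>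
        fderiv ℝ (fun y => T.toContinuousLinearEquiv (F y)) y (stdVec i)) =
        ∑ φ : Fin a → Fin a ⊕ Fin b,
          (∏ i, coord (φ i) (fderiv ℝ F y (stdVec i))) * m fun i => stdPair (φ i) := by
      intro y
      rw [← multilinear_eq_sum m]
      simp only [h2]
      rfl
    simp only [h3]
    refine integrable_finsetSum _ fun φ _ => Integrable.mul_const ?_ _
    refine integrableOn_ball_of_bounded (C := ∏ i, ‖(coord (φ i) : Euc a × Euc b →L[ℝ] ℝ)‖ * C)
      (Finset.measurable_prod _ fun i _ => (coord (φ i)).continuous.measurable.comp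
        (measurable_fderiv_apply_const ℝ _ _)) fun y => ?_
    rw [Finset.abs_prod]
    refine Finset.prod_le_prod (fun _ _ => abs_nonneg _) fun i _ => ?_
    refine ((coord (φ i)).le_opNorm _).trans ?_
    have := (fderiv ℝ F y).le_of_opNorm_le (hC y) (stdVec i)
    rw [norm_stdVec, mul_one] at this
    gcongr

end Energy

/-! ### Derivative bounds for nearly flat necks. -/

section NeckBounds

variable {a b : ℕ} {X : Type*} [NormedAddCommGroup X] [NormedSpace ℝ X]

theorem hasFDerivAt_norm_of_sphere {x : Euc a} (hx : ‖x‖ = 1) :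
    HasFDerivAt (fun y : Euc a => ‖y‖) (innerSL ℝ x) x := by
  have hy : x ≠ 0 := HomC1.sphere_ne_zero hx
  have h2 : HasFDerivAt (fun y : Euc a => ‖y‖) (fderiv ℝ (fun y : Euc a => ‖y‖) x) x :=
    ((contDiffAt_norm ℝ hy (n := 1)).differentiableAt one_ne_zero).hasFDerivAt
  have h4 := (hasStrictFDerivAt_norm_sq x).hasFDerivAt.unique (h2.pow 2)
  have h5 : fderiv ℝ (fun y : Euc a => ‖y‖) x = innerSL ℝ x := by
    refine ContinuousLinearMap.ext fun v => ?_
    have h6 := congrArg (fun L => L v) h4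
    simp [hx] at h6
    simp [h6]
  rwa [h5] at h2

/-- Radially the cone is linear with slope g(x), tangentially it moves like g; hence bounds on g
along the sphere control the whole derivative. -/
theorem fderiv_cone {g : Euc a → X} {x : Euc a} (hx : ‖x‖ = 1) (hg : DifferentiableAt ℝ g x)
    (v : Euc a) : fderiv ℝ (cone g) x v =
      inner ℝ x v • g x + fderiv ℝ g x (v - inner ℝ x v • x) := by
  have h1 := hasFDerivAt_norm_of_sphere hx
  have h2 : HasFDerivAt (fun y : Euc a => ‖y‖⁻¹) (-innerSL ℝ x) x := by
    have := (hasDerivAt_inv (norm_ne_zero_iff.2 (HomC1.sphere_ne_zero hx))).comp_hasFDerivAt x h1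
    have h7 : -((‖x‖ ^ 2)⁻¹) • innerSL ℝ x = -innerSL ℝ x := by simp [hx]
    rw [h7] at this
    exact this
  have h3 := h2.smul (hasFDerivAt_id x)
  have hgx : HasFDerivAt g (fderiv ℝ g x) (((fun y : Euc a => ‖y‖⁻¹) • _root_.id) x) := by
    have h0 : ((fun y : Euc a => ‖y‖⁻¹) • _root_.id) x = x := by simp [hx]
    rw [h0]
    exact hg.hasFDerivAt
  have h4 := h1.smul (hgx.comp x h3)
  have h5 : cone g = (fun y : Euc a => ‖y‖) • (g ∘ ((fun y : Euc a => ‖y‖⁻¹) • _root_.id)) := rfl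
  rw [h5, h4.fderiv]
  simp [hx, add_comm, sub_eq_add_neg]

theorem norm_tangential_le {x : Euc a} (hx : ‖x‖ = 1) (v : Euc a) :
    inner ℝ x (v - inner ℝ x v • x) = 0 ∧ ‖v - inner ℝ x v • x‖ ≤ ‖v‖ := by
  have h1 : inner ℝ x (v - inner ℝ x v • x) = 0 := by
    rw [inner_sub_right, inner_smul_right, real_inner_self_eq_norm_sq, hx]
    ring
  refine ⟨h1, ?_⟩
  have h2 := norm_add_sq_eq_norm_sq_add_norm_sq_real
    (x := v - inner ℝ x v • x) (y := inner ℝ x v • x) (by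
      rw [inner_smul_right, real_inner_comm _ (v - inner ℝ x v • x), h1, mul_zero])
  rw [sub_add_cancel] at h2
  nlinarith [norm_nonneg v, norm_nonneg (v - inner ℝ x v • x),
    mul_self_nonneg ‖inner ℝ x v • x‖]

theorem snd_cone_graphMap (f : Euc a → Euc b) : (fun y => (cone (graphMap f) y).2) = cone f := rfl

/-- The radial factor of a neck. -/
def radius (f : Euc a → Euc b) (x : Euc a) : ℝ := Real.sqrt (1 + ‖f x‖ ^ 2)

theorem fst_cone_graphMap (f : Euc a → Euc b) :
    (fun y => (cone (graphMap f) y).1) = cone fun x => radius f x • x := rfl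

theorem norm_fderiv_cone_le {f : Euc a → Euc b} (hf : ContDiff ℝ 1 f) {ε : ℝ} (hε : 0 ≤ ε)
    (hs : C1Small ε f) {y : Euc a} (hy : y ≠ 0) :
    ‖fderiv ℝ (fun y => (cone (graphMap f) y).2) y‖ ≤ 2 * ε := by
  rw [snd_cone_graphMap]
  refine (homC1_cone hf).forall_of_sphere (p := fun L => ‖L‖ ≤ 2 * ε) (fun x hx => ?_) hy
  refine ContinuousLinearMap.opNorm_le_bound _ (by positivity) fun v => ?_
  obtain ⟨h1, h2⟩ := norm_tangential_le hx v
  rw [fderiv_cone hx (hf.differentiable one_ne_zero x)]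
  have h3 : ‖inner ℝ x v • f x‖ ≤ ε * ‖v‖ := by
    rw [norm_smul]
    have h4 := norm_inner_le_norm (𝕜 := ℝ) x v
    rw [hx, one_mul] at h4
    calc _ ≤ ‖v‖ * ε := mul_le_mul h4 (hs x hx).1 (norm_nonneg _) (norm_nonneg _)
      _ = _ := mul_comm _ _
  have h5 := (hs x hx).2 _ h1
  calc _ ≤ ε * ‖v‖ + ε * ‖v‖ := (norm_add_le _ _).trans (add_le_add h3 (h5.trans (by gcongr)))
    _ = _ := by ring

theorem radius_bounds (f : Euc a → Euc b) (x : Euc a) :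
    1 ≤ radius f x ∧ radius f x - 1 ≤ ‖f x‖ ^ 2 := by
  have h0 : 0 ≤ ‖f x‖ ^ 2 := by positivity
  refine ⟨Real.one_le_sqrt.2 (by linarith), ?_⟩
  have : radius f x ≤ 1 + ‖f x‖ ^ 2 := by
    rw [radius, Real.sqrt_le_left (by positivity)]
    nlinarith
  linarith

theorem hasFDerivAt_radius {f : Euc a → Euc b} (hf : ContDiff ℝ 1 f) (x : Euc a) :
    HasFDerivAt (radius f) ((radius f x)⁻¹ • (innerSL ℝ (f x)).comp (fderiv ℝ f x)) x := by
  have h1 : HasFDerivAt (fun x => 1 + ‖f x‖ ^ 2) (2 • (innerSL ℝ (f x)).comp (fderiv ℝ f x)) x :=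
    ((hf.differentiable one_ne_zero x).hasFDerivAt.norm_sq).const_add 1
  have h2 := h1.sqrt (by positivity)
  have h3 : (radius f x)⁻¹ • (innerSL ℝ (f x)).comp (fderiv ℝ f x) =
      (1 / (2 * Real.sqrt (1 + ‖f x‖ ^ 2))) • (2 • (innerSL ℝ (f x)).comp (fderiv ℝ f x)) := by
    refine ContinuousLinearMap.ext fun v => ?_
    simp [radius]
    ring
  rw [h3]
  exact h2

/-- The difference from the identity is the change of radius plus its tangential derivative in the
direction x. Each contributes at most ε. -/
theorem norm_fderiv_cone_sub_id_le {f : Euc a → Euc b} (hf : ContDiff ℝ 1 f) {ε : ℝ} (hε : 0 ≤ ε)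
    (hε1 : ε ≤ 1) (hs : C1Small ε f) {y : Euc a} (hy : y ≠ 0) :
    ‖fderiv ℝ (fun y => (cone (graphMap f) y).1) y - ContinuousLinearMap.id ℝ (Euc a)‖ ≤
      2 * ε := by
  rw [fst_cone_graphMap]
  have hrad := hasFDerivAt_radius hf
  have hC : ContDiff ℝ 1 fun x : Euc a => radius f x • x := (contDiff_graphMap hf).fst
  refine (homC1_cone hC).forall_of_sphere
    (p := fun L => ‖L - ContinuousLinearMap.id ℝ (Euc a)‖ ≤ 2 * ε) (fun x hx => ?_) hy
  refine ContinuousLinearMap.opNorm_le_bound _ (by positivity) fun v => ?_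
  obtain ⟨h1, h2⟩ := norm_tangential_le hx v
  set w := v - inner ℝ x v • x with hw
  have hd : fderiv ℝ (fun x : Euc a => radius f x • x) x w =
      radius f x • w + ((radius f x)⁻¹ * inner ℝ (f x) (fderiv ℝ f x w)) • x := by
    have := ((hrad x).smul (hasFDerivAt_id x)).fderiv
    rw [show (fun x : Euc a => radius f x • x) = radius f • _root_.id from rfl, this]
    simp
  have hv : v = inner ℝ x v • x + w := by rw [hw]; abel
  obtain ⟨hr1, hr2⟩ := radius_bounds f x
  obtain ⟨hs1, hs2⟩ := hs x hx
  have h3 : (fderiv ℝ (cone fun x : Euc a => radius f x • x) x -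
      ContinuousLinearMap.id ℝ (Euc a)) v =
      (radius f x - 1) • v + ((radius f x)⁻¹ * inner ℝ (f x) (fderiv ℝ f x w)) • x := by
    rw [sub_apply, ContinuousLinearMap.id_apply,
      fderiv_cone hx (hC.differentiable one_ne_zero x), ← hw, hd]
    nth_rewrite 2 [hv]
    nth_rewrite 3 [hv]
    module
  have h4 : ‖(radius f x - 1) • v‖ ≤ ε * ‖v‖ := by
    rw [norm_smul, Real.norm_of_nonneg (by linarith)]
    gcongr
    nlinarith [norm_nonneg (f x)]
  have h5 : ‖((radius f x)⁻¹ * inner ℝ (f x) (fderiv ℝ f x w)) • x‖ ≤ ε * ‖v‖ := by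
    rw [norm_smul, hx, mul_one, norm_mul, norm_inv, Real.norm_of_nonneg (by linarith)]
    have h6 : (radius f x)⁻¹ ≤ 1 := inv_le_one_of_one_le₀ hr1
    have h7 : ‖(inner ℝ (f x) (fderiv ℝ f x w) : ℝ)‖ ≤ 1 * (ε * ‖v‖) :=
      (norm_inner_le_norm _ _).trans (mul_le_mul (hs1.trans hε1)
        ((hs2 w h1).trans (by gcongr)) (norm_nonneg _) zero_le_one)
    rw [one_mul] at h7
    calc _ ≤ 1 * (ε * ‖v‖) := mul_le_mul h6 h7 (norm_nonneg _) zero_le_one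
      _ = _ := one_mul _
  rw [h3]
  calc _ ≤ ε * ‖v‖ + ε * ‖v‖ := (norm_add_le _ _).trans (add_le_add h4 h5)
    _ = _ := by ring

/-- The neck lies on Q = 1 and the cone is homogeneous. Isometries preserve this identity, so it
relates the two parts of every rotated neck. -/
theorem stdForm_cone_graphMap (f : Euc a → Euc b) (y : Euc a) :
    stdForm a b (cone (graphMap f) y) (cone (graphMap f) y) = ‖y‖ ^ 2 := by
  by_cases hy : y = 0
  · simp [hy, cone]
  · have h1 : 0 ≤ 1 + ‖f (‖y‖⁻¹ • y)‖ ^ 2 := by positivity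
    have hn := norm_ne_zero_iff.2 hy
    simp only [stdForm_apply, cone, graphMap, Prod.smul_fst, Prod.smul_snd,
      real_inner_self_eq_norm_sq, norm_smul, norm_norm, norm_inv, mul_pow,
      Real.norm_of_nonneg (Real.sqrt_nonneg _), Real.sq_sqrt h1]
    field_simp
    ring

end NeckBounds

/-! ### Linear isometries of small slope. -/

section Isometries

variable {a b : ℕ}

/-- The linear isometries of the standard inner product. -/
def IsStdIsometry (A : Euc a × Euc b →L[ℝ] Euc a × Euc b) : Prop :=
  ∀ u v, stdForm a b (A u) (A v) = stdForm a b u v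

/-- The diagonal block of a linear map on `ℝ^a`. -/
def blockFst (A : Euc a × Euc b →L[ℝ] Euc a × Euc b) : Euc a →L[ℝ] Euc a :=
  (ContinuousLinearMap.fst ℝ _ _).comp (A.comp (ContinuousLinearMap.inl ℝ _ _))

/-- The slope of a linear map: the block from `ℝ^a` to `ℝ^b`. -/
def blockSlope (A : Euc a × Euc b →L[ℝ] Euc a × Euc b) : Euc a →L[ℝ] Euc b :=
  (ContinuousLinearMap.snd ℝ _ _).comp (A.comp (ContinuousLinearMap.inl ℝ _ _))

/-- The square of the Hilbert–Schmidt norm of the slope. -/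
def slopeSq (A : Euc a × Euc b →L[ℝ] Euc a × Euc b) : ℝ := ∑ i, ‖blockSlope A (stdVec i)‖ ^ 2

theorem blockFst_apply (A : Euc a × Euc b →L[ℝ] Euc a × Euc b) (x : Euc a) :
    blockFst A x = (A (x, 0)).1 := rfl

theorem blockSlope_apply (A : Euc a × Euc b →L[ℝ] Euc a × Euc b) (x : Euc a) :
    blockSlope A x = (A (x, 0)).2 := rfl

theorem norm_apply_sq_le {Y : Type*} [NormedAddCommGroup Y] [NormedSpace ℝ Y] (L : Euc a →L[ℝ] Y)
    (x : Euc a) : ‖L x‖ ^ 2 ≤ (∑ i, ‖L (stdVec i)‖ ^ 2) * ‖x‖ ^ 2 := by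
  have h1 : L x = ∑ i, x i • L (stdVec i) := by
    conv_lhs => rw [euc_eq_sum x]
    simp
  have h2 : ‖L x‖ ≤ ∑ i, ‖L (stdVec i)‖ * |x i| := by
    rw [h1]
    refine (norm_sum_le _ _).trans (Finset.sum_le_sum fun i _ => ?_)
    rw [norm_smul, mul_comm, Real.norm_eq_abs]
  have h3 := Finset.sum_mul_sq_le_sq_mul_sq Finset.univ (fun i => ‖L (stdVec i)‖) fun i => |x i|
  have h4 : ∑ i, |x i| ^ 2 = ‖x‖ ^ 2 := by
    rw [EuclideanSpace.norm_sq_eq]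
    simp
  rw [h4] at h3
  exact (pow_le_pow_left₀ (norm_nonneg _) h2 2).trans h3

variable {A : Euc a × Euc b →L[ℝ] Euc a × Euc b} {δ : ℝ}

theorem norm_blockSlope_le (hδ0 : 0 ≤ δ) (hs : slopeSq A ≤ δ ^ 2) (x : Euc a) :
    ‖(A (x, 0)).2‖ ≤ δ * ‖x‖ := by
  refine abs_le_of_sq_le_sq' ?_ (by positivity) |>.2
  refine (norm_apply_sq_le (blockSlope A) x).trans ?_
  rw [mul_pow]
  exact mul_le_mul_of_nonneg_right hs (by positivity)

namespace IsStdIsometry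

theorem norm_fst_sq (hA : IsStdIsometry A) (x : Euc a) :
    ‖(A (x, 0)).1‖ ^ 2 = ‖x‖ ^ 2 + ‖(A (x, 0)).2‖ ^ 2 := by
  have h := hA (x, 0) (x, 0)
  simp only [stdForm_apply, real_inner_self_eq_norm_sq, norm_zero] at h
  linarith

theorem norm_snd_sq (hA : IsStdIsometry A) (y : Euc b) :
    ‖(A (0, y)).2‖ ^ 2 = ‖y‖ ^ 2 + ‖(A (0, y)).1‖ ^ 2 := by
  have h := hA (0, y) (0, y)
  simp only [stdForm_apply, real_inner_self_eq_norm_sq, norm_zero] at h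
  linarith

theorem le_norm_blockFst (hA : IsStdIsometry A) (x : Euc a) : ‖x‖ ≤ ‖blockFst A x‖ := by
  refine abs_le_of_sq_le_sq' ?_ (norm_nonneg _) |>.2
  rw [blockFst_apply, hA.norm_fst_sq]
  nlinarith [sq_nonneg ‖(A (x, 0)).2‖]

theorem norm_blockFst_le (hA : IsStdIsometry A) (hδ0 : 0 ≤ δ) (hδ : δ ≤ 1 / 2)
    (hs : slopeSq A ≤ δ ^ 2) (x : Euc a) : ‖(A (x, 0)).1‖ ≤ 2 * ‖x‖ := by
  refine abs_le_of_sq_le_sq' ?_ (by positivity) |>.2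
  have h1 := norm_blockSlope_le hδ0 hs x
  have h2 : ‖(A (x, 0)).2‖ ≤ ‖x‖ := h1.trans (mul_le_of_le_one_left (norm_nonneg _) (by linarith))
  rw [hA.norm_fst_sq]
  nlinarith [norm_nonneg (A (x, 0)).2]

theorem bijective_blockFst (hA : IsStdIsometry A) : Function.Bijective (blockFst A) := by
  have hinj : Function.Injective (blockFst A) := by
    refine (injective_iff_map_eq_zero (blockFst A)).2 fun x hx => ?_
    have := hA.le_norm_blockFst x
    rw [hx, norm_zero] at this
    exact norm_le_zero_iff.1 this
  exact ⟨hinj, LinearMap.surjective_of_injective (f := (blockFst A : Euc a →ₗ[ℝ] Euc a)) hinj⟩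

/-- Write the horizontal part of A(0, y) as that of some A(x, 0). Since these vectors are
orthogonal, u² ≤ δ u w for the horizontal and vertical lengths u and w, so u ≤ w/2. Then w² = ‖y‖² +
u² gives both bounds. -/
theorem norm_snd_block (hA : IsStdIsometry A) (hδ0 : 0 ≤ δ) (hδ : δ ≤ 1 / 2)
    (hs : slopeSq A ≤ δ ^ 2) (y : Euc b) :
    ‖(A (0, y)).1‖ ≤ ‖y‖ ∧ ‖(A (0, y)).2‖ ≤ 2 * ‖y‖ := by
  obtain ⟨x, hx⟩ := hA.bijective_blockFst.2 (A (0, y)).1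
  rw [blockFst_apply] at hx
  have h1 : inner ℝ (A (x, 0)).1 (A (0, y)).1 = inner ℝ (A (x, 0)).2 (A (0, y)).2 := by
    have h := hA (x, 0) (0, y)
    simp only [stdForm_apply, inner_zero_left, inner_zero_right] at h
    linarith
  have h2 : ‖x‖ ≤ ‖(A (0, y)).1‖ := by
    rw [← hx]; exact hA.le_norm_blockFst x
  rw [hx, real_inner_self_eq_norm_sq] at h1
  have h3 := (real_inner_le_norm (A (x, 0)).2 (A (0, y)).2).trans
    (mul_le_mul_of_nonneg_right (norm_blockSlope_le hδ0 hs x) (norm_nonneg _))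
  rw [← h1] at h3
  set u := ‖(A (0, y)).1‖ with hu
  set w := ‖(A (0, y)).2‖ with hw
  have hu0 : 0 ≤ u := norm_nonneg _
  have hw0 : 0 ≤ w := norm_nonneg _
  have h4 : u ^ 2 ≤ 1 / 2 * u * w := h3.trans (by gcongr)
  have h5 : u ≤ 1 / 2 * w := by
    by_contra h
    have h6 := not_le.1 h
    have h7 : 0 < u := lt_of_le_of_lt (by positivity) h6
    nlinarith
  have h8 := hA.norm_snd_sq y
  rw [← hu, ← hw] at h8
  have hy := norm_nonneg y
  constructor
  · refine abs_le_of_sq_le_sq' ?_ hy |>.2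
    nlinarith
  · refine abs_le_of_sq_le_sq' ?_ (by positivity) |>.2
    nlinarith

/-- The horizontal part of A(x, y) factors as U(x + N y) with U = `blockFst A` and ‖N‖ ≤ 1. Although
U may be far from the identity, the inner map stays close to it on a nearly flat neck. -/
theorem exists_graph (hA : IsStdIsometry A) (hδ0 : 0 ≤ δ) (hδ : δ ≤ 1 / 2)
    (hs : slopeSq A ≤ δ ^ 2) :
    ∃ N : Euc b →L[ℝ] Euc a, (∀ y, blockFst A (N y) = (A (0, y)).1) ∧ ∀ y, ‖N y‖ ≤ ‖y‖ := by
  set e := LinearEquiv.ofBijective (blockFst A : Euc a →ₗ[ℝ] Euc a) hA.bijective_blockFst with he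
  set N : Euc b →ₗ[ℝ] Euc a := e.symm.toLinearMap ∘ₗ (LinearMap.fst ℝ _ _) ∘ₗ
    (A : Euc a × Euc b →ₗ[ℝ] Euc a × Euc b) ∘ₗ LinearMap.inr ℝ _ _ with hN
  have h1 : ∀ y, blockFst A (N y) = (A (0, y)).1 := fun y => e.apply_symm_apply _
  refine ⟨LinearMap.toContinuousLinearMap N, h1, fun y => ?_⟩
  refine (hA.le_norm_blockFst (N y)).trans ?_
  rw [h1]
  exact (hA.norm_snd_block hδ0 hδ hs y).1

theorem norm_le_three (hA : IsStdIsometry A) (hδ0 : 0 ≤ δ) (hδ : δ ≤ 1 / 2)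
    (hs : slopeSq A ≤ δ ^ 2) : ‖A‖ ≤ 3 := by
  refine ContinuousLinearMap.opNorm_le_bound _ (by norm_num) fun w => ?_
  have h1 : A w = A (w.1, 0) + A (0, w.2) := by rw [← map_add]; simp
  have h2 := norm_fst_le w
  have h3 := norm_snd_le w
  obtain ⟨h4, h5⟩ := hA.norm_snd_block hδ0 hδ hs w.2
  have h6 := hA.norm_blockFst_le hδ0 hδ hs w.1
  have h7 := norm_blockSlope_le hδ0 hs w.1
  have h8 : δ * ‖w.1‖ ≤ ‖w.1‖ := mul_le_of_le_one_left (norm_nonneg _) (by linarith)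
  rw [h1, Prod.norm_def, Prod.fst_add, Prod.snd_add]
  refine max_le ((norm_add_le _ _).trans ?_) ((norm_add_le _ _).trans ?_) <;> linarith

theorem comp {A' : Euc a × Euc b →L[ℝ] Euc a × Euc b} (hA' : IsStdIsometry A')
    (hA : IsStdIsometry A) : IsStdIsometry (A'.comp A) := fun u v => by
  simp only [ContinuousLinearMap.comp_apply, hA' _ _, hA u v]

end IsStdIsometry

/-- The hyperbolic rotation in the plane of the `i`-th positive and the `j`-th negative axis. -/
def boost (i : Fin a) (j : Fin b) (t : ℝ) : Euc a × Euc b →L[ℝ] Euc a × Euc b :=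
  ContinuousLinearMap.id ℝ _ +
    ((Real.cosh t - 1) • coord (Sum.inl i) + Real.sinh t • coord (Sum.inr j)).smulRight
      ((stdVec i, 0) : Euc a × Euc b) +
    ((Real.cosh t - 1) • coord (Sum.inr j) + Real.sinh t • coord (Sum.inl i)).smulRight
      ((0, stdVec j) : Euc a × Euc b)

theorem boost_apply (i : Fin a) (j : Fin b) (t : ℝ) (w : Euc a × Euc b) :
    boost i j t w =
      (w.1 + ((Real.cosh t - 1) * w.1 i + Real.sinh t * w.2 j) • stdVec i,
        w.2 + ((Real.cosh t - 1) * w.2 j + Real.sinh t * w.1 i) • stdVec j) := by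
  refine Prod.ext ?_ ?_ <;> simp [boost]

theorem isStdIsometry_boost (i : Fin a) (j : Fin b) (t : ℝ) : IsStdIsometry (boost i j t) := by
  intro u v
  have h := Real.cosh_sq t
  simp only [boost_apply, stdForm_apply, inner_add_left, inner_add_right, inner_smul_left,
    inner_smul_right, EuclideanSpace.inner_single_left, EuclideanSpace.inner_single_right]
  simp
  linear_combination (u.1 i * v.1 i - u.2 j * v.2 j) * h

theorem boost_zero (i : Fin a) (j : Fin b) : boost i j 0 = ContinuousLinearMap.id ℝ _ := by
  refine ContinuousLinearMap.ext fun w => ?_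
  rw [boost_apply]
  simp

end Isometries

/-! ### Quadratic integrals on the sphere. -/

section SphereIntegrals

variable {a : ℕ}

theorem integrable_sphere {h : Sph a → ℝ} (hh : Continuous h) : Integrable h (unifMeasure a) :=
  hh.integrable_of_hasCompactSupport (HasCompactSupport.of_compactSpace _)

theorem sq_integral_sphere_le [NeZero a] {g : Sph a → ℝ} (hg : Continuous g) :
    (∫ x, g x ∂unifMeasure a) ^ 2 ≤ ∫ x, g x ^ 2 ∂unifMeasure a := by
  have hprob := isProbabilityMeasure_unifMeasure (a := a)
  set m := ∫ x, g x ∂unifMeasure a with hm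
  have h1 : 0 ≤ ∫ x, (g x - m) ^ 2 ∂unifMeasure a := integral_nonneg fun x => sq_nonneg _
  have h2 : ∀ x, (g x - m) ^ 2 = g x ^ 2 - (2 * m * g x - m ^ 2) := fun x => by ring
  have i1 : Integrable (fun x => g x ^ 2) (unifMeasure a) := integrable_sphere (by fun_prop)
  have i2 : Integrable (fun x => 2 * m * g x) (unifMeasure a) := integrable_sphere (by fun_prop)
  have i3 : Integrable (fun _ : Sph a => m ^ 2) (unifMeasure a) := integrable_const _
  simp only [h2] at h1
  have i4 : Integrable (fun x => 2 * m * g x - m ^ 2) (unifMeasure a) := i2.sub i3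
  rw [integral_sub i1 i4, integral_sub i2 i3, integral_const_mul, ← hm] at h1
  simp only [integral_const, probReal_univ, one_smul] at h1
  nlinarith

theorem integral_sphere_norm_clm_sq [NeZero a] {b : ℕ} (L : Euc a →L[ℝ] Euc b) :
    ∫ x : Sph a, ‖L x‖ ^ 2 ∂unifMeasure a = (a : ℝ)⁻¹ * ∑ i, ‖L (stdVec i)‖ ^ 2 := by
  have h1 : ∀ x : Sph a, ‖L x‖ ^ 2 = ∑ i, ∑ j,
      ((x : Euc a) i * (x : Euc a) j) * inner ℝ (L (stdVec i)) (L (stdVec j)) := by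
    intro x
    have h2 : L x = ∑ i, (x : Euc a) i • L (stdVec i) := by
      conv_lhs => rw [euc_eq_sum (x : Euc a)]
      simp
    rw [← real_inner_self_eq_norm_sq, h2, sum_inner]
    refine Finset.sum_congr rfl fun i _ => ?_
    rw [inner_sum]
    refine Finset.sum_congr rfl fun j _ => ?_
    rw [inner_smul_left, inner_smul_right]
    simp only [conj_trivial]
    ring
  simp only [h1]
  rw [integral_finsetSum _ fun i _ => integrable_sphere (by fun_prop)]
  simp only [fun i => integral_finsetSum (μ := unifMeasure a) Finset.univ
    (f := fun (j : Fin a) (x : Sph a) => ((x : Euc a) i * (x : Euc a) j) *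
      (inner ℝ (L (stdVec i)) (L (stdVec j)) : ℝ))
    fun j _ => integrable_sphere (by fun_prop), integral_mul_const,
    integral_sphere_coord_mul_coord]
  simp [Finset.mul_sum]

end SphereIntegrals

/-! ### The sign pattern of the Plücker coordinates. -/

section Pluecker

variable {a b : ℕ}

theorem minorInt_comp_perm (F : Euc a → Euc a × Euc b) (φ : Fin a → Fin a ⊕ Fin b)
    (σ : Equiv.Perm (Fin a)) :
    minorInt F (φ ∘ σ) = ((Equiv.Perm.sign σ : ℤ) : ℝ) * minorInt F φ := by
  have h : ∀ y, (gradMat (rows F (φ ∘ σ)) y).det =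
      ((Equiv.Perm.sign σ : ℤ) : ℝ) * (gradMat (rows F φ) y).det := fun y =>
    Matrix.det_permute σ (gradMat (rows F φ) y)
  simp only [minorInt, h, integral_const_mul]

theorem sign_sq (σ : Equiv.Perm (Fin a)) : ((Equiv.Perm.sign σ : ℤ) : ℝ) ^ 2 = 1 := by
  rcases Int.units_eq_one_or (Equiv.Perm.sign σ) with h | h <;> simp [h]

theorem minorInt_eq_zero_of_not_injective (F : Euc a → Euc a × Euc b)
    {φ : Fin a → Fin a ⊕ Fin b} (hφ : ¬Function.Injective φ) : minorInt F φ = 0 := by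
  rw [Function.not_injective_iff] at hφ
  obtain ⟨k, l, h, hne⟩ := hφ
  have h1 : ∀ y, (gradMat (rows F φ) y).det = 0 := by
    intro y
    refine Matrix.det_zero_of_row_eq hne ?_
    ext j
    simp only [gradMat_apply]
    rw [show rows F φ k = rows F φ l from by funext y; simp [rows, h]]
  simp [minorInt, h1]

/-- If the mixed coordinates vanish for the standard bases, then all coordinates with exactly
one negative direction vanish. -/
theorem minorInt_eq_zero_of_single {F : Euc a → Euc a × Euc b}
    (h0 : ∀ i j, minorInt F (Function.update Sum.inl i (Sum.inr j)) = 0)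
    {φ : Fin a → Fin a ⊕ Fin b} {i₀ : Fin a} {j : Fin b} (h1 : φ i₀ = Sum.inr j)
    (h2 : ∀ i, i ≠ i₀ → (φ i).isLeft) : minorInt F φ = 0 := by
  by_cases hφ : Function.Injective φ
  swap
  · exact minorInt_eq_zero_of_not_injective F hφ
  -- One row is negative, so the positive rows miss some index m. Putting m in place of the negative
  -- row gives a permutation that brings φ to the standard form.
  have hm : ∃ m, ∀ k, φ k ≠ Sum.inl m := by
    by_contra! hall
    choose g hg using hall
    have hginj : Function.Injective g := fun x y hxy => by
      have := (hg x).symm.trans ((congrArg φ hxy).trans (hg y))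
      exact Sum.inl_injective this
    obtain ⟨m, hm⟩ := (Finite.injective_iff_surjective.1 hginj) i₀
    have := hg m
    rw [hm, h1] at this
    exact absurd this (by simp)
  obtain ⟨m, hm⟩ := hm
  set s : Fin a → Fin a := fun k => Sum.elim _root_.id (fun _ => m) (φ k) with hs
  have hr : ∀ k j', φ k = Sum.inr j' → k = i₀ := by
    intro k j' hk
    by_contra hne
    have := h2 k hne
    rw [hk] at this
    simp at this
  have hsinj : Function.Injective s := by
    intro k l hkl
    simp only [hs] at hkl
    rcases hk : φ k with x | x <;> rcases hl : φ l with y | y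
    · rw [hk, hl] at hkl
      simp only [Sum.elim_inl, id_eq] at hkl
      exact hφ (by rw [hk, hl, hkl])
    · rw [hk, hl] at hkl
      simp only [Sum.elim_inl, Sum.elim_inr, id_eq] at hkl
      exact absurd (hkl ▸ hk) (hm k)
    · rw [hk, hl] at hkl
      simp only [Sum.elim_inl, Sum.elim_inr, id_eq] at hkl
      exact absurd (hkl ▸ hl) (hm l)
    · rw [hr k x hk, hr l y hl]
  set σ : Equiv.Perm (Fin a) := Equiv.ofBijective s
    ⟨hsinj, Finite.injective_iff_surjective.1 hsinj⟩ with hσ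
  have hφσ : φ = Function.update Sum.inl m (Sum.inr j) ∘ σ := by
    funext k
    have hk : σ k = Sum.elim _root_.id (fun _ => m) (φ k) := rfl
    rw [Function.comp_apply, hk]
    rcases hk : φ k with x | x
    · have hx : x ≠ m := fun h => hm k (h ▸ hk)
      simp [Function.update_of_ne hx]
    · have := hr k x hk
      rw [this, h1] at hk
      simp [hk]
  rw [hφσ, minorInt_comp_perm, h0, mul_zero]

theorem prod_coordSign (φ : Fin a → Fin a ⊕ Fin b) :
    ∏ i, coordSign (φ i) = (-1 : ℝ) ^ (Finset.univ.filter fun i => (φ i).isRight).card := by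
  have h : ∀ i, (coordSign (φ i) : ℝ) = if (φ i).isRight then -1 else 1 := by
    intro i
    rcases φ i with x | x <;> simp [coordSign]
  simp only [h]
  rw [Finset.prod_ite]
  simp

/-- The energy dominates the square of the leading coordinate up to a higher order error, provided
that the mixed coordinates vanish. -/
theorem exists_pairEnergy_ge (a b : ℕ) [NeZero a] :
    ∃ C : ℝ, 0 ≤ C ∧ ∀ (F : Euc a → Euc a × Euc b) (κ : ℝ), HomC1 F → 0 ≤ κ → κ ≤ 1 →
      (∀ y ≠ 0, ‖fderiv ℝ (fun y => (F y).1) y‖ ≤ 4) →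
      (∀ y ≠ 0, ‖fderiv ℝ (fun y => (F y).2) y‖ ≤ κ) →
      (∀ i j, minorInt F (Function.update Sum.inl i (Sum.inr j)) = 0) →
      minorInt F Sum.inl ^ 2 - C * κ ^ 4 * ∫ x : Sph a, ‖(F x).2‖ ^ 2 ∂unifMeasure a ≤
        pairEnergy F := by
  obtain ⟨C, hC0, hC⟩ := exists_abs_integral_det_gradMat_le a
  refine ⟨(a.factorial : ℝ)⁻¹ * ((Fintype.card (Fin a → Fin a ⊕ Fin b) : ℝ) * (C * 4 ^ a) ^ 2),
    by positivity, fun F κ hF hκ0 hκ1 h4 hκ h0 => ?_⟩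
  set I := ∫ x : Sph a, ‖(F x).2‖ ^ 2 ∂unifMeasure a with hI
  have hI0 : 0 ≤ I := integral_nonneg fun x => by positivity
  have hcont : Continuous fun x : Sph a => ‖(F x).2‖ :=
    (hF.continuous.snd.norm).comp continuous_subtype_val
  set M : ℝ := (C * 4 ^ a) ^ 2 * κ ^ 4 * I with hM
  have hM0 : 0 ≤ M := by positivity
  -- Of three negative rows, one is measured in L¹ and the other two contribute κ each. Squaring and
  -- Cauchy–Schwarz give κ⁴ times the integral.
  have hbound : ∀ φ : Fin a → Fin a ⊕ Fin b,
      3 ≤ (Finset.univ.filter fun i => (φ i).isRight).card → minorInt F φ ^ 2 ≤ M := by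
    intro φ hφ
    set K : Fin a → ℝ := fun i => if (φ i).isRight then κ else 4 with hK
    obtain ⟨i₀, i₁, i₂, hi₀, hi₁, hi₂, h01, h02, h12⟩ := Finset.two_lt_card_iff.1 hφ
    simp only [Finset.mem_filter, Finset.mem_univ, true_and] at hi₀ hi₁ hi₂
    obtain ⟨j, hj⟩ := Sum.isRight_iff.1 hi₀
    have hK0 : ∀ i, 0 ≤ K i := fun i => by
      simp only [hK]; split_ifs <;> linarith
    have hK4 : ∀ i, K i ≤ 4 := fun i => by
      simp only [hK]; split_ifs <;> linarith
    have hKprod : ∏ i ∈ Finset.univ.erase i₀, K i ≤ κ ^ 2 * 4 ^ a := by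
      rw [← Finset.mul_prod_erase _ _ (Finset.mem_erase.2 ⟨h01.symm, Finset.mem_univ i₁⟩),
        ← Finset.mul_prod_erase _ _ (Finset.mem_erase.2 ⟨h12.symm,
          Finset.mem_erase.2 ⟨h02.symm, Finset.mem_univ i₂⟩⟩)]
      have e1 : K i₁ = κ := by simp [hK, hi₁]
      have e2 : K i₂ = κ := by simp [hK, hi₂]
      rw [e1, e2, ← mul_assoc, ← sq]
      refine mul_le_mul_of_nonneg_left ?_ (by positivity)
      refine (Finset.prod_le_prod (fun i _ => hK0 i) fun i _ => hK4 i).trans ?_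
      rw [Finset.prod_const]
      refine pow_le_pow_right₀ (by norm_num) ?_
      exact (Finset.card_le_univ _).trans (by simp)
    have h := hC (rows F φ) K i₀ (hF.rows φ) hK0 (fun i _ y hy => by
      have hd : ∀ v, fderiv ℝ (rows F φ i) y v = coord (φ i) (fderiv ℝ F y v) := fun v =>
        congrArg (fun L => L v) (fderiv_clm_comp (coord (φ i)) (hF.differentiableAt hy))
      refine ContinuousLinearMap.opNorm_le_bound _ (hK0 i) fun v => ?_
      rw [hd]
      have e1 := fderiv_clm_comp (ContinuousLinearMap.fst ℝ (Euc a) (Euc b))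
        (hF.differentiableAt hy)
      have e2 := fderiv_clm_comp (ContinuousLinearMap.snd ℝ (Euc a) (Euc b))
        (hF.differentiableAt hy)
      rcases hφi : φ i with x | x
      · have : K i = 4 := by simp [hK, hφi]
        rw [this, coord_inl]
        refine (PiLp.norm_apply_le _ x).trans ?_
        have := (fderiv ℝ (fun y => (F y).1) y).le_of_opNorm_le (h4 y hy) v
        rwa [show (fun y => (F y).1) = fun y => ContinuousLinearMap.fst ℝ (Euc a) (Euc b) (F y)
          from rfl, e1] at this
      · have : K i = κ := by simp [hK, hφi]
        rw [this, coord_inr]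
        refine (PiLp.norm_apply_le _ x).trans ?_
        have := (fderiv ℝ (fun y => (F y).2) y).le_of_opNorm_le (hκ y hy) v
        rwa [show (fun y => (F y).2) = fun y => ContinuousLinearMap.snd ℝ (Euc a) (Euc b) (F y)
          from rfl, e2] at this)
    have hrow : ∫ x : Sph a, |rows F φ i₀ x| ∂unifMeasure a ≤
        ∫ x : Sph a, ‖(F x).2‖ ∂unifMeasure a := by
      refine integral_mono_of_nonneg (Eventually.of_forall fun x => abs_nonneg _)
        (integrable_sphere hcont) (Eventually.of_forall fun x => ?_)
      simp only [rows, hj, coord_inr]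
      exact PiLp.norm_apply_le (F x).2 j
    have hint0 : 0 ≤ ∫ x : Sph a, |rows F φ i₀ x| ∂unifMeasure a :=
      integral_nonneg fun x => abs_nonneg _
    have hle : |minorInt F φ| ≤ C * (κ ^ 2 * 4 ^ a) * ∫ x : Sph a, ‖(F x).2‖ ∂unifMeasure a :=
      h.trans (mul_le_mul (mul_le_mul_of_nonneg_left hKprod hC0) hrow hint0 (by positivity))
    have hsq := sq_integral_sphere_le hcont
    rw [← hI] at hsq
    rw [← sq_abs]
    calc |minorInt F φ| ^ 2
        ≤ (C * (κ ^ 2 * 4 ^ a) * ∫ x : Sph a, ‖(F x).2‖ ∂unifMeasure a) ^ 2 :=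
          pow_le_pow_left₀ (abs_nonneg _) hle 2
      _ = (C * 4 ^ a) ^ 2 * κ ^ 4 * (∫ x : Sph a, ‖(F x).2‖ ∂unifMeasure a) ^ 2 := by ring
      _ ≤ M := mul_le_mul_of_nonneg_left hsq (by positivity)
  -- The a! reorderings of the all-positive rows contribute equally and cancel the factor 1/a!. For
  -- simplicity the error M is charged to every φ.
  set e : Equiv.Perm (Fin a) → (Fin a → Fin a ⊕ Fin b) := fun σ => Sum.inl ∘ σ with he
  have heinj : Function.Injective e := fun σ τ h => by
    refine Equiv.ext fun i => ?_
    exact Sum.inl_injective (congrFun h i)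
  classical
  set S := Finset.univ.image e with hS
  have hterm : ∀ φ, (if φ ∈ S then minorInt F Sum.inl ^ 2 else 0) - M ≤
      (∏ i, coordSign (φ i)) * minorInt F φ ^ 2 := by
    intro φ
    by_cases hφS : φ ∈ S
    · obtain ⟨σ, -, rfl⟩ := Finset.mem_image.1 hφS
      rw [if_pos hφS, he, minorInt_comp_perm, mul_pow, sign_sq]
      simp only [Function.comp_apply, coordSign, Sum.elim_inl, Finset.prod_const_one]
      linarith
    · rw [if_neg hφS, prod_coordSign]
      have hsq := sq_nonneg (minorInt F φ)
      rcases Nat.lt_or_ge (Finset.univ.filter fun i => (φ i).isRight).card 3 with h3 | h3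
      · interval_cases hc : (Finset.univ.filter fun i => (φ i).isRight).card
        · linarith
        · obtain ⟨i₀, hi₀⟩ := Finset.card_eq_one.1 hc
          have hmem : ∀ i, (φ i).isRight ↔ i = i₀ := fun i => by
            have := Finset.ext_iff.1 hi₀ i
            simpa using this
          obtain ⟨j, hj⟩ := Sum.isRight_iff.1 ((hmem i₀).2 rfl)
          rw [minorInt_eq_zero_of_single h0 hj fun i hi => ?_]
          · simp [hM0]
          · have := mt (hmem i).1 hi
            simpa using this
        -- With two negative rows the sign is positive, so the term can be dropped.
        · nlinarith
      · have := hbound φ h3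
        rcases neg_one_pow_eq_or ℝ (Finset.univ.filter fun i => (φ i).isRight).card with h | h <;>
          rw [h] <;> linarith
  rw [pairEnergy_eq_sum hF]
  have hsum := Finset.sum_le_sum fun φ (_ : φ ∈ Finset.univ) => hterm φ
  rw [Finset.sum_sub_distrib, Finset.sum_ite_mem, Finset.univ_inter, Finset.sum_const,
    Finset.sum_const, hS, Finset.card_image_of_injective _ heinj, Finset.card_univ,
    Finset.card_univ, Fintype.card_perm, Fintype.card_fin, nsmul_eq_mul, nsmul_eq_mul] at hsum
  have hfac : (0 : ℝ) < a.factorial := by positivity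
  have := mul_le_mul_of_nonneg_left hsum (inv_pos.2 hfac).le
  refine le_trans (le_of_eq ?_) this
  rw [hM]
  field_simp

end Pluecker

/-! ### The frame that minimises the leading coordinate. -/

section Minimiser

variable {a b : ℕ}

/-- The linear isometries with slope at most `δ` preserving the orientation of `ℝ^a`. -/
def isoSet (a b : ℕ) (δ : ℝ) : Set (Euc a × Euc b →L[ℝ] Euc a × Euc b) :=
  {A | IsStdIsometry A ∧ slopeSq A ≤ δ ^ 2 ∧ 0 ≤ (blockFst A).det}

theorem continuous_slopeSq :
    Continuous (slopeSq : (Euc a × Euc b →L[ℝ] Euc a × Euc b) → ℝ) := by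
  unfold slopeSq
  simp only [blockSlope_apply]
  fun_prop

theorem continuous_det_blockFst :
    Continuous fun A : Euc a × Euc b →L[ℝ] Euc a × Euc b => (blockFst A).det := by
  refine ContinuousLinearMap.continuous_det.comp ?_
  unfold blockFst
  fun_prop

theorem isCompact_isoSet {δ : ℝ} (hδ0 : 0 ≤ δ) (hδ : δ ≤ 1 / 2) : IsCompact (isoSet a b δ) := by
  have hp : ProperSpace (Euc a × Euc b →L[ℝ] Euc a × Euc b) := FiniteDimensional.proper ℝ _
  refine Metric.isCompact_of_isClosed_isBounded ?_ ?_
  · refine IsClosed.inter ?_ (IsClosed.inter (isClosed_le continuous_slopeSq continuous_const)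
      (isClosed_le continuous_const continuous_det_blockFst))
    change IsClosed {A : Euc a × Euc b →L[ℝ] Euc a × Euc b |
      ∀ u v, stdForm a b (A u) (A v) = stdForm a b u v}
    simp only [Set.ofPred_forall]
    refine isClosed_iInter fun u => isClosed_iInter fun v => isClosed_eq ?_ continuous_const
    simp only [stdForm_apply]
    fun_prop
  · refine (Metric.isBounded_closedBall (x := (0 : Euc a × Euc b →L[ℝ] Euc a × Euc b))
      (r := 3)).subset fun A hA => ?_
    rw [mem_closedBall_zero_iff]
    exact hA.1.norm_le_three hδ0 hδ hA.2.1

theorem continuousOn_minorInt {δ : ℝ} (hδ0 : 0 ≤ δ) (hδ : δ ≤ 1 / 2) [NeZero a]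
    {F : Euc a → Euc a × Euc b} (hF : HomC1 F) :
    ContinuousOn (fun A : Euc a × Euc b →L[ℝ] Euc a × Euc b =>
      minorInt (fun y => A (F y)) Sum.inl) (isoSet a b δ) := by
  obtain ⟨C, hC0, hC⟩ := hF.exists_norm_fderiv_le
  have hmat : ∀ (A : Euc a × Euc b →L[ℝ] Euc a × Euc b), ∀ y ≠ 0,
      gradMat (rows (fun y => A (F y)) Sum.inl) y =
        Matrix.of fun i j => (A (fderiv ℝ F y (stdVec j))).1 i := by
    intro A y hy
    rw [gradMat_rows (hF.clm_comp A) _ hy, fderiv_clm_comp A (hF.differentiableAt hy)]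
    rfl
  refine continuousOn_of_dominated (bound := fun _ => a.factorial * ∏ _i : Fin a, (3 * C))
    (fun A _ => (measurable_gradMat_det _).aestronglyMeasurable) (fun A hA => ?_)
    (integrableOn_const measure_ball_lt_top.ne) ?_
  · filter_upwards [ae_ball_ne_zero] with y hy
    rw [hmat A y hy, Real.norm_eq_abs]
    refine abs_det_le _ _ fun i j => ?_
    refine (PiLp.norm_apply_le (A (fderiv ℝ F y (stdVec j))).1 i).trans ?_
    refine (norm_fst_le _).trans ?_
    refine (A.le_of_opNorm_le (hA.1.norm_le_three hδ0 hδ hA.2.1) _).trans ?_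
    have := (fderiv ℝ F y).le_of_opNorm_le (hC y) (stdVec j)
    rw [norm_stdVec, mul_one] at this
    gcongr
  · filter_upwards [ae_ball_ne_zero] with y hy
    simp only [fun A => hmat A y hy]
    refine Continuous.continuousOn (Continuous.matrix_det ?_)
    refine continuous_matrix fun i j => ?_
    simp only [Matrix.of_apply]
    fun_prop

/-- A boost mixes row i with the vertical row j only, and the determinant is linear in that row. The
derivative at t = 0 is the mixed coordinate. -/
theorem minorInt_boost [NeZero a] {G : Euc a → Euc a × Euc b} (hG : HomC1 G) (i : Fin a)
    (j : Fin b) (t : ℝ) :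
    minorInt (fun y => boost i j t (G y)) Sum.inl = Real.cosh t * minorInt G Sum.inl +
      Real.sinh t * minorInt G (Function.update Sum.inl i (Sum.inr j)) := by
  have h1 : ∀ y ≠ 0, (gradMat (rows (fun y => boost i j t (G y)) Sum.inl) y).det =
      Real.cosh t * (gradMat (rows G Sum.inl) y).det +
      Real.sinh t * (gradMat (rows G (Function.update Sum.inl i (Sum.inr j))) y).det := by
    intro y hy
    have hr : gradMat (rows G (Function.update Sum.inl i (Sum.inr j))) y =
        (gradMat (rows G Sum.inl) y).updateRow i
          fun l => (fderiv ℝ G y (stdVec l)).2 j := by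
      ext k l
      rw [gradMat_rows hG _ hy, gradMat_rows hG _ hy]
      by_cases hk : k = i
      · subst hk; simp
      · simp [hk]
    have hb : gradMat (rows (fun y => boost i j t (G y)) Sum.inl) y =
        (gradMat (rows G Sum.inl) y).updateRow i (Real.cosh t • gradMat (rows G Sum.inl) y i +
          Real.sinh t • fun l => (fderiv ℝ G y (stdVec l)).2 j) := by
      ext k l
      rw [gradMat_rows (hG.clm_comp _) _ hy, gradMat_rows hG _ hy,
        fderiv_clm_comp _ (hG.differentiableAt hy)]
      simp only [Matrix.of_apply, ContinuousLinearMap.comp_apply, boost_apply, coord_inl]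
      by_cases hk : k = i
      · subst hk
        rw [Matrix.updateRow_self]
        simp
        ring
      · rw [Matrix.updateRow_ne hk]
        simp [hk]
    rw [hb, hr, Matrix.det_updateRow_add, Matrix.det_updateRow_smul, Matrix.det_updateRow_smul,
      Matrix.updateRow_eq_self]
  have h2 := HomC1.integrableOn_gradMat_det (hG.rows Sum.inl)
  have h3 := HomC1.integrableOn_gradMat_det (hG.rows (Function.update Sum.inl i (Sum.inr j)))
  rw [minorInt, integral_congr_ae (ae_ball_ne_zero.mono fun y hy => h1 y hy),
    integral_add (h2.const_mul _) (h3.const_mul _), integral_const_mul, integral_const_mul]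
  rfl

/-- The closed condition det ≥ 0 improves itself to det ≥ 1, so `isoSet` is compact and yet the
orientation constraint is never active at a minimiser. -/
theorem one_le_det_blockFst {A : Euc a × Euc b →L[ℝ] Euc a × Euc b} (hA : IsStdIsometry A)
    (h0 : 0 ≤ (blockFst A).det) : 1 ≤ (blockFst A).det := by
  have := one_le_abs_det_of_expanding hA.le_norm_blockFst
  rwa [abs_of_nonneg h0] at this

theorem id_mem_isoSet (δ : ℝ) : ContinuousLinearMap.id ℝ (Euc a × Euc b) ∈ isoSet a b δ := by
  refine ⟨fun u v => rfl, ?_, ?_⟩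
  · simp [slopeSq, blockSlope_apply]
    positivity
  · have : blockFst (ContinuousLinearMap.id ℝ (Euc a × Euc b)) = ContinuousLinearMap.id ℝ _ := rfl
    rw [this]
    change 0 ≤ LinearMap.det (LinearMap.id : Euc a →ₗ[ℝ] Euc a)
    rw [LinearMap.det_id]
    exact zero_le_one

/-- Coordinates in which the mixed components of the directed volume vanish. -/
theorem exists_isometry_minorInt_eq_zero [NeZero a] {δ : ℝ} (hδ0 : 0 ≤ δ) (hδ : δ ≤ 1 / 2)
    {F : Euc a → Euc a × Euc b} (hF : HomC1 F)
    (hbd : ∀ A ∈ isoSet a b δ, minorInt (fun y => A (F y)) Sum.inl ≤ minorInt F Sum.inl →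
      slopeSq A < δ ^ 2) :
    ∃ A ∈ isoSet a b δ, ∀ i j,
      minorInt (fun y => A (F y)) (Function.update Sum.inl i (Sum.inr j)) = 0 := by
  obtain ⟨A, hA, hmin⟩ := (isCompact_isoSet hδ0 hδ).exists_isMinOn ⟨_, id_mem_isoSet δ⟩
    (continuousOn_minorInt hδ0 hδ hF)
  refine ⟨A, hA, fun i j => ?_⟩
  have hlt : slopeSq A < δ ^ 2 := hbd A hA (hmin (id_mem_isoSet δ))
  have hG : HomC1 fun y => A (F y) := hF.clm_comp A
  have hB : Continuous fun t => (boost i j t).comp A := by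
    unfold boost
    have h1 := Real.continuous_cosh
    have h2 := Real.continuous_sinh
    simp only [ContinuousLinearMap.add_comp]
    refine (continuous_const.add ?_).add ?_
    · have h3 : Continuous fun t : ℝ => (Real.cosh t - 1) • (coord (Sum.inl i) :
          Euc a × Euc b →L[ℝ] ℝ) + Real.sinh t • coord (Sum.inr j) := by fun_prop
      exact (((ContinuousLinearMap.smulRightL ℝ (Euc a × Euc b) (Euc a × Euc b)).flip
        ((stdVec i, 0) : Euc a × Euc b)).continuous.comp h3).clm_comp continuous_const
    · have h3 : Continuous fun t : ℝ => (Real.cosh t - 1) • (coord (Sum.inr j) :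
          Euc a × Euc b →L[ℝ] ℝ) + Real.sinh t • coord (Sum.inl i) := by fun_prop
      exact (((ContinuousLinearMap.smulRightL ℝ (Euc a × Euc b) (Euc a × Euc b)).flip
        ((0, stdVec j) : Euc a × Euc b)).continuous.comp h3).clm_comp continuous_const
  have hB0 : (boost i j 0).comp A = A := by
    rw [boost_zero]; rfl
  -- The slope bound is strict at A and the determinant is positive, so small boosts of A remain
  -- admissible.
  have hloc : IsLocalMin (fun t => Real.cosh t * minorInt (fun y => A (F y)) Sum.inl +
      Real.sinh t * minorInt (fun y => A (F y)) (Function.update Sum.inl i (Sum.inr j))) 0 := by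
    have e1 := (continuous_slopeSq.comp hB).continuousAt (x := 0)
    have e2 := (continuous_det_blockFst.comp hB).continuousAt (x := 0)
    have l1 : ∀ᶠ t in 𝓝 (0 : ℝ), slopeSq ((boost i j t).comp A) < δ ^ 2 :=
      e1.eventually (gt_mem_nhds (by simpa [hB0] using hlt))
    have l2 : ∀ᶠ t in 𝓝 (0 : ℝ), 0 < (blockFst ((boost i j t).comp A)).det :=
      e2.eventually (lt_mem_nhds (by
        have := one_le_det_blockFst hA.1 hA.2.2
        simp only [Function.comp_apply, hB0]
        linarith))
    filter_upwards [l1, l2] with t h1 h2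
    have hmem : (boost i j t).comp A ∈ isoSet a b δ :=
      ⟨(isStdIsometry_boost i j t).comp hA.1, h1.le, h2.le⟩
    have h3 := hmin hmem
    simp only [Set.mem_ofPred_eq, ContinuousLinearMap.comp_apply] at h3
    rw [minorInt_boost hG] at h3
    simpa using h3
  have hder := ((Real.hasDerivAt_cosh 0).mul_const (minorInt (fun y => A (F y)) Sum.inl)).add
    ((Real.hasDerivAt_sinh 0).mul_const
      (minorInt (fun y => A (F y)) (Function.update Sum.inl i (Sum.inr j))))
  simpa using hloc.hasDerivAt_eq_zero hder

end Minimiser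

/-! ### Local minimality of the flat neck. -/

section LocalMinimum

variable {a b : ℕ}

theorem minorInt_inl_eq [NeZero a] {F : Euc a → Euc a × Euc b} (hF : HomC1 F) :
    minorInt F Sum.inl =
      ∫ y in Metric.ball (0 : Euc a) 1, (fderiv ℝ (fun y => (F y).1) y).det := by
  refine integral_congr_ae (ae_ball_ne_zero.mono fun y hy => ?_)
  have h : DifferentiableAt ℝ (fun y => (F y).1) y := (hF.differentiableAt hy).fst
  exact det_gradMat_coord h

theorem apply_eq_blocks (A : Euc a × Euc b →L[ℝ] Euc a × Euc b) (w : Euc a × Euc b) :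
    A w = A (w.1, 0) + A (0, w.2) := by rw [← map_add]; simp

/-- Bounds on a neck that is `C¹`-close to the flat one, seen in rotated coordinates. -/
theorem rotated_neck_bounds [NeZero a] {f : Euc a → Euc b} (hf : ContDiff ℝ 1 f) {ε δ η : ℝ}
    (hε0 : 0 ≤ ε) (hε : ε ≤ 1 / 4) (hs : C1Small ε f) (hδ0 : 0 ≤ δ) (hδ : δ ≤ 1 / 2)
    (hη1 : η < 1) (hεη : 4 * ε ≤ η) (hκ : 2 * δ + 4 * ε ≤ 1)
    (hη : ∀ L : Euc a →L[ℝ] Euc a, ‖L - ContinuousLinearMap.id ℝ (Euc a)‖ ≤ η →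
      |L.det - 1| ≤ 1 / 2)
    {A : Euc a × Euc b →L[ℝ] Euc a × Euc b} (hA : A ∈ isoSet a b δ) :
    (∀ y ≠ 0, ‖fderiv ℝ (fun y => (A (cone (graphMap f) y)).1) y‖ ≤ 4) ∧
    (∀ y ≠ 0, ‖fderiv ℝ (fun y => (A (cone (graphMap f) y)).2) y‖ ≤ 2 * δ + 4 * ε) ∧
    volume.real (Metric.ball (0 : Euc a) 1) *
      (1 + (∫ x : Sph a, ‖(A (cone (graphMap f) x)).2‖ ^ 2 ∂unifMeasure a) / 8) ≤
      minorInt (fun y => A (cone (graphMap f) y)) Sum.inl := by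
  obtain ⟨hiso, hslope, hdet⟩ := hA
  set F := cone (graphMap f) with hFdef
  have hF : HomC1 F := homC1_neck hf
  obtain ⟨N, hN, hN1⟩ := hiso.exists_graph hδ0 hδ hslope
  have hP : HomC1 fun y => (F y).1 := hF.clm_comp (ContinuousLinearMap.fst ℝ _ _)
  have hR : HomC1 fun y => (F y).2 := hF.clm_comp (ContinuousLinearMap.snd ℝ _ _)
  have hq : HomC1 fun y => (F y).1 + N (F y).2 := hP.add (hR.clm_comp N)
  have hr : HomC1 fun y => (A (F y)).2 := (hF.clm_comp A).clm_comp (ContinuousLinearMap.snd ℝ _ _)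
  have hDR : ∀ y ≠ 0, ‖fderiv ℝ (fun y => (F y).2) y‖ ≤ 2 * ε := fun y hy =>
    norm_fderiv_cone_le hf hε0 hs hy
  have hDP : ∀ y ≠ 0, ‖fderiv ℝ (fun y => (F y).1) y - ContinuousLinearMap.id ℝ (Euc a)‖ ≤ 2 * ε :=
    fun y hy => norm_fderiv_cone_sub_id_le hf hε0 (by linarith) hs hy
  have hqη : ∀ y ≠ 0, ‖fderiv ℝ (fun y => (F y).1 + N (F y).2) y -
      ContinuousLinearMap.id ℝ (Euc a)‖ ≤ 4 * ε := by
    intro y hy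
    rw [fderiv_fun_add (hP.differentiableAt hy) ((hR.clm_comp N).differentiableAt hy),
      fderiv_clm_comp N (hR.differentiableAt hy), add_sub_right_comm]
    have hNn : ‖N‖ ≤ 1 := ContinuousLinearMap.opNorm_le_bound _ zero_le_one fun y => by
      rw [one_mul]; exact hN1 y
    have h1 := (ContinuousLinearMap.opNorm_comp_le N (fderiv ℝ (fun y => (F y).2) y)).trans
      (mul_le_mul hNn (hDR y hy) (norm_nonneg _) zero_le_one)
    refine (norm_add_le _ _).trans ?_
    linarith [hDP y hy]
  have hpq : (fun y => (A (F y)).1) = fun y => blockFst A ((F y).1 + N (F y).2) := by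
    funext y
    rw [map_add, hN, blockFst_apply, apply_eq_blocks A (F y)]
    rfl
  -- The slope δ acts on a horizontal derivative of norm at most 2; the vertical block, of norm at
  -- most 2, acts on one of norm at most 2ε.
  have hDrv : ∀ y ≠ 0, ‖fderiv ℝ (fun y => (A (F y)).2) y‖ ≤ 2 * δ + 4 * ε := by
    intro y hy
    refine ContinuousLinearMap.opNorm_le_bound _ (by positivity) fun v => ?_
    have e0 := fderiv_clm_comp ((ContinuousLinearMap.snd ℝ (Euc a) (Euc b)).comp A)
      (hF.differentiableAt hy)
    have e1 := fderiv_clm_comp (ContinuousLinearMap.fst ℝ (Euc a) (Euc b))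
      (hF.differentiableAt hy)
    have e2 := fderiv_clm_comp (ContinuousLinearMap.snd ℝ (Euc a) (Euc b))
      (hF.differentiableAt hy)
    have d0 : fderiv ℝ (fun y => (A (F y)).2) y v = (A (fderiv ℝ F y v)).2 :=
      congrArg (fun L => L v) e0
    have d1 : fderiv ℝ (fun y => (F y).1) y v = (fderiv ℝ F y v).1 := congrArg (fun L => L v) e1
    have d2 : fderiv ℝ (fun y => (F y).2) y v = (fderiv ℝ F y v).2 := congrArg (fun L => L v) e2
    have h1 := (fderiv ℝ (fun y => (F y).2) y).le_of_opNorm_le (hDR y hy) v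
    have h2 : ‖fderiv ℝ (fun y => (F y).1) y v‖ ≤ 2 * ‖v‖ := by
      have h3 := ContinuousLinearMap.le_of_opNorm_le _ (hDP y hy) v
      have h4 : fderiv ℝ (fun y => (F y).1) y v = (fderiv ℝ (fun y => (F y).1) y -
          ContinuousLinearMap.id ℝ (Euc a)) v + v := by simp
      rw [h4]
      refine (norm_add_le _ _).trans ?_
      nlinarith [norm_nonneg v]
    rw [d1] at h2
    rw [d2] at h1
    rw [d0, apply_eq_blocks A]
    refine (norm_add_le _ _).trans ?_
    have h5 := norm_blockSlope_le hδ0 hslope (fderiv ℝ F y v).1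
    have h6 := (hiso.norm_snd_block hδ0 hδ hslope (fderiv ℝ F y v).2).2
    have h7 := mul_le_mul_of_nonneg_left h2 hδ0
    linarith
  refine ⟨fun y hy => ?_, hDrv, ?_⟩
  · rw [hpq, fderiv_clm_comp _ (hq.differentiableAt hy)]
    have h1 : ‖blockFst A‖ ≤ 2 := ContinuousLinearMap.opNorm_le_bound _ (by norm_num) fun x =>
      hiso.norm_blockFst_le hδ0 hδ hslope x
    have h2 : ‖fderiv ℝ (fun y => (F y).1 + N (F y).2) y‖ ≤ 2 := by
      have h3 := norm_le_norm_sub_add (fderiv ℝ (fun y => (F y).1 + N (F y).2) y)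
        (ContinuousLinearMap.id ℝ (Euc a))
      have h4 := hqη y hy
      have h5 : ‖ContinuousLinearMap.id ℝ (Euc a)‖ ≤ 1 := ContinuousLinearMap.norm_id_le
      linarith
    exact (ContinuousLinearMap.opNorm_comp_le _ _).trans
      ((mul_le_mul h1 h2 (norm_nonneg _) (by norm_num)).trans (by norm_num))
  · rw [minorInt_inl_eq (hF.clm_comp A), hpq]
    refine volume_add_le_integral_det hη1 hη hiso.le_norm_blockFst
      (zero_lt_one.trans_le (one_le_det_blockFst hiso hdet)) hq
      (fun y hy => (hqη y hy).trans hεη) hr (fun y => ?_) fun y => ?_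
    · rw [← congrFun hpq y]
      have h1 := hiso (F y) (F y)
      rw [hFdef, stdForm_cone_graphMap, stdForm_apply, real_inner_self_eq_norm_sq,
        real_inner_self_eq_norm_sq] at h1
      linarith
    · refine (hr.norm_le hDrv y).trans ?_
      exact mul_le_of_le_one_left (norm_nonneg _) hκ

/-- Tilting a nearly flat neck by a slope makes its part normal to the flat neck large. -/
theorem le_integral_norm_snd_sq [NeZero a] {f : Euc a → Euc b} (hf : ContDiff ℝ 1 f) {ε δ : ℝ}
    (hε0 : 0 ≤ ε) (hε : ε ≤ 1) (hs : C1Small ε f) (hδ0 : 0 ≤ δ) (hδ : δ ≤ 1 / 2)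
    {A : Euc a × Euc b →L[ℝ] Euc a × Euc b} (hA : IsStdIsometry A) (hslope : slopeSq A = δ ^ 2) :
    δ ^ 2 / (2 * a) - 9 * ε ^ 2 ≤
      ∫ x : Sph a, ‖(A (cone (graphMap f) x)).2‖ ^ 2 ∂unifMeasure a := by
  have hF : HomC1 (cone (graphMap f)) := homC1_neck hf
  have hprob := isProbabilityMeasure_unifMeasure (a := a)
  have h1 : ∀ x : Sph a, ‖blockSlope A x‖ ^ 2 / 2 - 9 * ε ^ 2 ≤
      ‖(A (cone (graphMap f) x)).2‖ ^ 2 := by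
    intro x
    have hx : ‖(x : Euc a)‖ = 1 := norm_eq_of_mem_sphere x
    obtain ⟨hs1, -⟩ := hs x hx
    obtain ⟨hr1, hr2⟩ := radius_bounds f x
    have hc : cone (graphMap f) (x : Euc a) = graphMap f x := by simp [cone]
    have hsplit : A (graphMap f x) =
        A ((x : Euc a), 0) + A ((radius f x - 1) • (x : Euc a), 0) + A (0, f x) := by
      rw [← map_add, ← map_add]
      congr 1
      refine Prod.ext ?_ ?_
      · simp only [graphMap, Prod.fst_add, radius]
        module
      · simp [graphMap]
    have e1 : ‖(A ((radius f x - 1) • (x : Euc a), 0)).2‖ ≤ ε := by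
      refine (norm_blockSlope_le hδ0 hslope.le _).trans ?_
      rw [norm_smul, hx, mul_one, Real.norm_of_nonneg (by linarith)]
      have : ‖f x‖ ^ 2 ≤ ε := by nlinarith [norm_nonneg (f x)]
      nlinarith
    have e2 := (hA.norm_snd_block hδ0 hδ hslope.le (f x)).2
    have e3 : ‖blockSlope A x‖ ≤ ‖(A (graphMap f x)).2‖ + 3 * ε := by
      have e4 : blockSlope A x = (A (graphMap f x)).2 -
          ((A ((radius f x - 1) • (x : Euc a), 0)).2 + (A (0, f x)).2) := by
        rw [hsplit]
        simp only [Prod.snd_add, blockSlope_apply]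
        abel
      rw [e4]
      refine (norm_sub_le _ _).trans ?_
      linarith [norm_add_le (A ((radius f x - 1) • (x : Euc a), 0)).2 (A (0, f x)).2]
    rw [hc]
    have := norm_nonneg (blockSlope A x)
    nlinarith [sq_nonneg (‖(A (graphMap f x)).2‖ - 3 * ε)]
  have i1 : Integrable (fun x : Sph a => ‖blockSlope A x‖ ^ 2 / 2) (unifMeasure a) :=
    integrable_sphere (by fun_prop)
  have i2 : Integrable (fun x : Sph a => ‖(A (cone (graphMap f) x)).2‖ ^ 2) (unifMeasure a) :=
    integrable_sphere (((A.continuous.comp hF.continuous).snd.norm.pow 2).comp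
      continuous_subtype_val)
  have i3 : Integrable (fun x : Sph a => ‖blockSlope A x‖ ^ 2 / 2 - 9 * ε ^ 2) (unifMeasure a) :=
    i1.sub (integrable_const _)
  have h2 := integral_mono i3 i2 h1
  have h3 : ∫ x : Sph a, ‖blockSlope A x‖ ^ 2 / 2 ∂unifMeasure a = δ ^ 2 / (2 * a) := by
    rw [integral_div (μ := unifMeasure a) 2 fun x : Sph a => ‖blockSlope A x‖ ^ 2,
      integral_sphere_norm_clm_sq]
    change (a : ℝ)⁻¹ * slopeSq A / 2 = _
    rw [hslope]
    field_simp
  rw [integral_sub i1 (integrable_const _), h3] at h2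
  simpa using h2

/-- The flat neck is a local minimum of the energy in the `C¹` topology. -/
theorem exists_sq_volume_le_pairEnergy (a b : ℕ) [NeZero a] :
    ∃ ε : ℝ, 0 < ε ∧ ∀ f : Euc a → Euc b, ContDiff ℝ 1 f → C1Small ε f →
      volume.real (Metric.ball (0 : Euc a) 1) ^ 2 ≤ pairEnergy (cone (graphMap f)) := by
  have ha : (1 : ℝ) ≤ a := by exact_mod_cast Nat.one_le_iff_ne_zero.2 (NeZero.ne a)
  set v := volume.real (Metric.ball (0 : Euc a) 1) with hv
  have hv0 : 0 < v := volume_ball_pos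
  obtain ⟨C, hC0, hC⟩ := exists_pairEnergy_ge a b
  obtain ⟨η₀, hη₀, hη⟩ := exists_det_near_one a (c := 1 / 2) (by norm_num)
  set η := min η₀ (1 / 2) with hηdef
  have hη0 : 0 < η := by positivity
  -- Chosen so that the error C κ⁴ is at most v²/4, the gain of the leading square. Then δ = κ/4 and
  -- ε ≤ κ/8 give 2δ + 4ε ≤ κ.
  set κ := min 1 (v ^ 2 / (4 * (C + 1))) with hκdef
  have hκ0 : 0 < κ := by positivity
  have hκ1 : κ ≤ 1 := min_le_left _ _
  have hCκ : C * κ ^ 4 ≤ v ^ 2 / 4 := by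
    have h1 : κ ^ 4 ≤ κ := pow_le_of_le_one hκ0.le hκ1 (by norm_num)
    have h2 : κ ≤ v ^ 2 / (4 * (C + 1)) := min_le_right _ _
    calc C * κ ^ 4 ≤ (C + 1) * (v ^ 2 / (4 * (C + 1))) :=
          mul_le_mul (by linarith) (h1.trans h2) (by positivity) (by positivity)
      _ = v ^ 2 / 4 := by field_simp
  set δ := κ / 4 with hδdef
  have hδ0 : 0 < δ := by positivity
  have hδ : δ ≤ 1 / 2 := by linarith
  obtain ⟨ηc, hηc, hdetc⟩ := exists_det_near_one a (c := δ ^ 2 / (64 * a)) (by positivity)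
  -- The bound ηc/2 keeps the untilted leading coordinate below v(1 + δ²/(64a)). The bound δ/(6a)
  -- makes 9ε² at most half of δ²/(2a).
  set ε := min (min (η / 4) (κ / 8)) (min (ηc / 2) (δ / (6 * a))) with hεdef
  have hε0 : 0 < ε := by positivity
  have hε1 : ε ≤ η / 4 := (min_le_left _ _).trans (min_le_left _ _)
  have hε2 : ε ≤ κ / 8 := (min_le_left _ _).trans (min_le_right _ _)
  have hε3 : ε ≤ ηc / 2 := (min_le_right _ _).trans (min_le_left _ _)
  have hε4 : ε ≤ δ / (6 * a) := (min_le_right _ _).trans (min_le_right _ _)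
  refine ⟨ε, hε0, fun f hf hs => ?_⟩
  have hF : HomC1 (cone (graphMap f)) := homC1_neck hf
  have hbounds := fun {A : Euc a × Euc b →L[ℝ] Euc a × Euc b} (hA : A ∈ isoSet a b δ) =>
    rotated_neck_bounds hf hε0.le (by linarith) hs hδ0.le hδ
      (lt_of_le_of_lt (min_le_right _ _) (by norm_num) : η < 1) (by linarith)
      (by linarith) (fun L hL => hη L (hL.trans (min_le_left _ _))) hA
  have hbase : minorInt (cone (graphMap f)) Sum.inl ≤ v * (1 + δ ^ 2 / (64 * a)) := by
    rw [minorInt_inl_eq hF]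
    have hb : ∀ y ≠ 0, (fderiv ℝ (fun y => (cone (graphMap f) y).1) y).det ≤
        1 + δ ^ 2 / (64 * a) := by
      intro y hy
      have h1 := hdetc _ ((norm_fderiv_cone_sub_id_le hf hε0.le (by linarith) hs hy).trans
        (by linarith))
      linarith [(abs_le.1 h1).2]
    -- Without integrability the integral is 0 by convention, and the bound holds trivially.
    by_cases hint : IntegrableOn (fun y => (fderiv ℝ (fun y => (cone (graphMap f) y).1) y).det)
        (Metric.ball (0 : Euc a) 1)
    · have h2 := integral_mono_ae hint (integrableOn_const measure_ball_lt_top.ne)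
        (ae_ball_ne_zero.mono fun y hy => hb y hy)
      refine h2.trans (le_of_eq ?_)
      simp [hv]
    · rw [integral_undef hint]
      positivity
  -- At slope exactly δ the vertical part has mean square at least δ²/(4a), so the leading
  -- coordinate is at least v(1 + δ²/(32a)). This exceeds its value for A = 1, and the minimum is
  -- interior.
  obtain ⟨A, hA, hzero⟩ := exists_isometry_minorInt_eq_zero hδ0.le hδ hF fun A hA hle => by
    refine lt_of_le_of_ne hA.2.1 fun heq => ?_
    have h1 := le_integral_norm_snd_sq hf hε0.le (by linarith) hs hδ0.le hδ hA.1 heq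
    have h2 := (hbounds hA).2.2
    have h3 : 9 * ε ^ 2 ≤ δ ^ 2 / (4 * a) := by
      have h4 : ε ^ 2 ≤ (δ / (6 * a)) ^ 2 := pow_le_pow_left₀ hε0.le hε4 2
      have h5 : (δ / (6 * a)) ^ 2 = δ ^ 2 / (36 * a) / a := by field_simp; norm_num
      have h6 : δ ^ 2 / (36 * a) / a ≤ δ ^ 2 / (36 * a) := div_le_self (by positivity) ha
      have h7 : 9 * (δ ^ 2 / (36 * a)) = δ ^ 2 / (4 * a) := by field_simp; norm_num
      linarith
    have h8 : δ ^ 2 / (2 * a) - δ ^ 2 / (4 * a) = δ ^ 2 / (4 * a) := by field_simp; norm_num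
    have h9 : δ ^ 2 / (4 * a) = 16 * (δ ^ 2 / (64 * a)) := by field_simp; norm_num
    have h10 : 0 < δ ^ 2 / (64 * a) := by positivity
    have h11 := h2.trans (hle.trans hbase)
    rw [← hv] at h11
    have h12 := le_of_mul_le_mul_left h11 hv0
    linarith
  obtain ⟨b1, b2, b3⟩ := hbounds hA
  have hG : HomC1 fun y => A (cone (graphMap f) y) := hF.clm_comp A
  have hE := hC _ κ hG hκ0.le hκ1 b1 (fun y hy => (b2 y hy).trans (by linarith)) hzero
  rw [pairEnergy_isometry hF hA.1] at hE
  set I := ∫ x : Sph a, ‖(A (cone (graphMap f) x)).2‖ ^ 2 ∂unifMeasure a with hI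
  have hI0 : 0 ≤ I := integral_nonneg fun x => by positivity
  refine le_trans ?_ hE
  rw [← hv] at b3
  have h1 : (v * (1 + I / 8)) ^ 2 ≤ minorInt (fun y => A (cone (graphMap f) y)) Sum.inl ^ 2 :=
    pow_le_pow_left₀ (by positivity) b3 2
  have h2 := mul_le_mul_of_nonneg_right hCκ hI0
  nlinarith [mul_nonneg (sq_nonneg v) (sq_nonneg I)]

end LocalMinimum

/-! ### Differentiation of parametric integrals and of determinants. -/

section ParametricIntegrals

/-- Differentiation under the integral sign for a `C¹` function of the variable and of parameters
that take their values in a compact set. -/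
theorem exists_hasDerivAt_integral {X : Type*} [MeasurableSpace X] {μ : Measure X}
    [IsFiniteMeasure μ] {W : Type*} [NormedAddCommGroup W] [NormedSpace ℝ W] [MeasurableSpace W]
    [BorelSpace W] {H : ℝ × W → ℝ} {U : Set (ℝ × W)} (hU : IsOpen U) (hH : ContDiffOn ℝ 1 H U)
    {K : Set W} (hK : IsCompact K) {δ : ℝ} (hδ : 0 < δ) (hKU : Set.Icc (-δ) δ ×ˢ K ⊆ U)
    {w : X → W} (hw : Measurable w) (hwK : ∀ᵐ x ∂μ, w x ∈ K) :
    (∀ t ∈ Set.Icc (-δ) δ, Integrable (fun x => H (t, w x)) μ) ∧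
    ∃ g' : ℝ → ℝ, (∀ᶠ t in 𝓝 (0 : ℝ), HasDerivAt (fun t => ∫ x, H (t, w x) ∂μ) (g' t) t) ∧
      ContinuousAt g' 0 ∧ g' 0 = ∫ x, fderiv ℝ H (0, w x) (1, 0) ∂μ := by
  set D : ℝ × W → ℝ := fun p => fderiv ℝ H p (1, 0) with hD
  have hDc : ContinuousOn D U := (hH.continuousOn_fderiv_of_isOpen hU le_rfl).clm_apply
    continuousOn_const
  have hcomp : IsCompact (Set.Icc (-δ) δ ×ˢ K) := isCompact_Icc.prod hK
  have hmeas : ∀ (G : ℝ × W → ℝ), ContinuousOn G U → ∀ t ∈ Set.Icc (-δ) δ,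
      AEStronglyMeasurable (fun x => G (t, w x)) μ := by
    classical
    intro G hG t ht
    have h1 : ContinuousOn (fun v => G (t, v)) K :=
      hG.comp (by fun_prop) fun v hv => hKU ⟨ht, hv⟩
    -- G is continuous only on U, so it is cut off outside K before composing with the measurable
    -- map w.
    have h2 : Measurable (K.piecewise (fun v => G (t, v)) 0) :=
      h1.measurable_piecewise continuousOn_const hK.measurableSet
    refine (h2.comp hw).aestronglyMeasurable.congr (hwK.mono fun x hx => ?_)
    simp [hx]
  obtain ⟨C, hC⟩ := hcomp.exists_bound_of_continuousOn (hH.continuousOn.mono hKU)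
  obtain ⟨C', hC'⟩ := hcomp.exists_bound_of_continuousOn (hDc.mono hKU)
  have hint : ∀ t ∈ Set.Icc (-δ) δ, Integrable (fun x => H (t, w x)) μ := fun t ht =>
    Integrable.of_bound (hmeas H hH.continuousOn t ht) C (hwK.mono fun x hx => hC _ ⟨ht, hx⟩)
  have hnear : ∀ᶠ t in 𝓝 (0 : ℝ), t ∈ Set.Ioo (-δ) δ := Ioo_mem_nhds (by linarith) hδ
  refine ⟨hint, fun t => ∫ x, D (t, w x) ∂μ, hnear.mono fun t ht => ?_, ?_, rfl⟩
  · have hs : Set.Ioo (-δ) δ ∈ 𝓝 t := Ioo_mem_nhds ht.1 ht.2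
    refine (hasDerivAt_integral_of_dominated_loc_of_deriv_le (bound := fun _ => C') hs
      (Filter.mem_of_superset hs fun τ hτ => ?_) (hint t (Set.Ioo_subset_Icc_self ht))
      (hmeas D hDc t (Set.Ioo_subset_Icc_self ht))
      (hwK.mono fun x hx τ hτ => hC' (τ, w x) ⟨Set.Ioo_subset_Icc_self hτ, hx⟩) (integrable_const _)
      (hwK.mono fun x hx τ hτ => ?_)).2
    · exact hmeas H hH.continuousOn τ (Set.Ioo_subset_Icc_self hτ)
    · have hmem : (τ, w x) ∈ U := hKU ⟨Set.Ioo_subset_Icc_self hτ, hx⟩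
      have h1 : HasFDerivAt H (fderiv ℝ H (τ, w x)) (τ, w x) :=
        ((hH.contDiffAt (hU.mem_nhds hmem)).differentiableAt one_ne_zero).hasFDerivAt
      have h2 : HasDerivAt (fun τ : ℝ => (τ, w x)) (1, 0) τ :=
        (hasDerivAt_id τ).prodMk (hasDerivAt_const τ (w x))
      exact h1.comp_hasDerivAt τ h2
  · refine continuousAt_of_dominated (bound := fun _ => C')
      (hnear.mono fun t ht => hmeas D hDc t (Set.Ioo_subset_Icc_self ht))
      (hnear.mono fun t ht => hwK.mono fun x hx => hC' _ ⟨Set.Ioo_subset_Icc_self ht, hx⟩)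
      (integrable_const _) (hwK.mono fun x hx => ?_)
    have hmem : ((0 : ℝ), w x) ∈ U := hKU ⟨⟨by linarith, hδ.le⟩, hx⟩
    exact ContinuousAt.comp (f := fun t : ℝ => (t, w x)) (hDc.continuousAt (hU.mem_nhds hmem))
      (by fun_prop)

/-- The first two derivatives at `0` of a differentiable function of `t²`. -/
theorem hasSecondDerivAt_comp_sq {q g g' : ℝ → ℝ} (hq : ∀ᶠ t in 𝓝 (0 : ℝ), q t = g (t ^ 2))
    (hg : ∀ᶠ t in 𝓝 (0 : ℝ), HasDerivAt g (g' t) t) (hg' : ContinuousAt g' 0) :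
    HasDerivAt q 0 0 ∧ HasSecondDerivAt q (2 * g' 0) 0 := by
  have hsq : Tendsto (fun t : ℝ => t ^ 2) (𝓝 0) (𝓝 0) := by
    have : ContinuousAt (fun t : ℝ => t ^ 2) 0 := by fun_prop
    simpa [ContinuousAt] using this
  have h1 : ∀ᶠ t in 𝓝 (0 : ℝ), HasDerivAt q (g' (t ^ 2) * (2 * t)) t := by
    filter_upwards [hq.eventually_nhds, hsq.eventually hg] with t ht1 ht2
    have h2 : HasDerivAt (fun t : ℝ => t ^ 2) (2 * t) t := by simpa using hasDerivAt_pow 2 t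
    exact (HasDerivAt.comp (h := fun t : ℝ => t ^ 2) t ht2 h2).congr_of_eventuallyEq ht1
  refine ⟨by simpa using h1.self_of_nhds, _, h1, ?_⟩
  -- As q'(t) = 2t g'(t²), the difference quotient of q' at 0 is 2g'(t²); continuity of g' at 0
  -- suffices.
  rw [hasDerivAt_iff_tendsto_slope]
  have h3 : Tendsto (fun t : ℝ => 2 * g' (t ^ 2)) (𝓝[≠] 0) (𝓝 (2 * g' 0)) :=
    ((hg'.tendsto.comp hsq).const_mul 2).mono_left nhdsWithin_le_nhds
  refine h3.congr' (eventually_mem_nhdsWithin.mono fun t ht => ?_)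
  have ht' : t ≠ 0 := ht
  simp only [slope_def_field]
  field_simp
  ring

/-- A permutation other than the identity moves at least two points, so an off-diagonal zero
survives the removal of one factor. -/
theorem hasDerivAt_det_one {n : ℕ} {M : ℝ → Matrix (Fin n) (Fin n) ℝ}
    {M' : Matrix (Fin n) (Fin n) ℝ} {t₀ : ℝ} (h0 : M t₀ = 1)
    (hM : ∀ i j, HasDerivAt (fun t => M t i j) (M' i j) t₀) :
    HasDerivAt (fun t => (M t).det) M'.trace t₀ := by
  have h1 : HasDerivAt (fun t => (M t).det) (∑ σ : Equiv.Perm (Fin n),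
      ((Equiv.Perm.sign σ : ℤ) : ℝ) * ∑ i, (∏ j ∈ Finset.univ.erase i, M t₀ (σ j) j) *
        M' (σ i) i) t₀ := by
    simp only [Matrix.det_apply']
    refine HasDerivAt.fun_sum fun σ _ => HasDerivAt.const_mul _ ?_
    simpa using HasDerivAt.fun_finsetProd fun i (_ : i ∈ Finset.univ) => hM (σ i) i
  convert h1 using 1
  rw [h0, Finset.sum_eq_single 1]
  · simp only [Equiv.Perm.sign_one, Units.val_one, Int.cast_one, one_mul, Equiv.Perm.one_apply]
    refine Finset.sum_congr rfl fun i _ => ?_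
    change M' i i = (∏ j ∈ Finset.univ.erase i, (1 : Matrix (Fin n) (Fin n) ℝ) j j) * M' i i
    rw [Finset.prod_eq_one fun j _ => Matrix.one_apply_eq j, one_mul]
  · intro σ _ hσ
    refine mul_eq_zero_of_right _ (Finset.sum_eq_zero fun i _ => mul_eq_zero_of_left ?_ _)
    obtain ⟨j, hj, hji⟩ : ∃ j, σ j ≠ j ∧ j ≠ i := by
      by_contra! hcon
      refine hσ (Equiv.ext fun k => ?_)
      by_contra hk
      have hk' : σ k ≠ k := hk
      have h2 := hcon k hk'
      have h3 := hcon (σ k) fun h => hk' (σ.injective h)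
      exact hk' (h3.trans h2.symm)
    exact Finset.prod_eq_zero (Finset.mem_erase.2 ⟨hji, Finset.mem_univ j⟩)
      (by simp [hj])
  · simp

end ParametricIntegrals

/-! ### The first and second variations at the flat neck. -/

section SecondVariation

variable {a b : ℕ}

/-- The squared length of `f` at the radial projection to the unit sphere. -/
def radialSq (f : Euc a → Euc b) (y : Euc a) : ℝ := ‖f (‖y‖⁻¹ • y)‖ ^ 2

theorem cone_graphMap_smul (f : Euc a → Euc b) (t : ℝ) (y : Euc a) :
    cone (graphMap (t • f)) y = (√(1 + t ^ 2 * radialSq f y) • y, t • cone f y) := by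
  rcases eq_or_ne y 0 with rfl | hy
  · simp [cone, Prod.zero_eq_mk]
  · have h : ‖y‖ ≠ 0 := norm_ne_zero_iff.2 hy
    refine Prod.ext ?_ ?_
    · simp only [cone, graphMap, radialSq, Pi.smul_apply, norm_smul, Prod.smul_fst, mul_pow,
        Real.norm_eq_abs, sq_abs, smul_smul]
      congr 1
      field_simp
    · simp only [cone, graphMap, Pi.smul_apply, Prod.smul_snd]
      rw [smul_comm]

theorem radialSq_smul (f : Euc a → Euc b) {c : ℝ} (hc : 0 < c) (y : Euc a) :
    radialSq f (c • y) = radialSq f y := by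
  simp only [radialSq, norm_smul, Real.norm_of_nonneg hc.le, smul_smul]
  congr 4
  field_simp

theorem radialSq_nonneg (f : Euc a → Euc b) (y : Euc a) : 0 ≤ radialSq f y := sq_nonneg _

theorem differentiableAt_radialSq {f : Euc a → Euc b} (hf : ContDiff ℝ 1 f) {y : Euc a}
    (hy : y ≠ 0) : DifferentiableAt ℝ (radialSq f) y := by
  have h1 : DifferentiableAt ℝ (fun y : Euc a => ‖y‖⁻¹ • y) y :=
    ((differentiableAt_id.norm ℝ hy).inv (norm_ne_zero_iff.2 hy)).smul differentiableAt_id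
  exact (DifferentiableAt.comp y ((hf.differentiable one_ne_zero) _) h1).norm_sq ℝ

theorem fderiv_radialSq_self {f : Euc a → Euc b} (hf : ContDiff ℝ 1 f) {y : Euc a}
    (hy : y ≠ 0) : fderiv ℝ (radialSq f) y y = 0 := by
  have h1 : HasDerivAt (fun c : ℝ => c • y) y 1 := by
    simpa using (hasDerivAt_id (1 : ℝ)).smul_const y
  have hd : HasFDerivAt (radialSq f) (fderiv ℝ (radialSq f) y) ((1 : ℝ) • y) := by
    simpa using (differentiableAt_radialSq hf hy).hasFDerivAt
  have h2 := hd.comp_hasDerivAt (1 : ℝ) h1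
  have h3 : HasDerivAt (radialSq f ∘ fun c : ℝ => c • y) 0 1 :=
    (hasDerivAt_const (1 : ℝ) (radialSq f y)).congr_of_eventuallyEq
      ((lt_mem_nhds one_pos).mono fun c hc => radialSq_smul f hc y)
  exact h2.unique h3

/-- The pointwise data of the first order expansion of the necks `t • f`. -/
def neckData (f : Euc a → Euc b) (y : Euc a) : ℝ × (Fin a → Euc a) × (Fin a → Euc b) :=
  (radialSq f y, fun i => fderiv ℝ (radialSq f) y (stdVec i) • y,
    fun i => fderiv ℝ (cone f) y (stdVec i))

/-- The horizontal part of a partial derivative of a neck. -/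
def horizontalPart (τ : ℝ) (w : ℝ × (Fin a → Euc a) × (Fin a → Euc b)) (i : Fin a) : Euc a :=
  √(1 + τ * w.1) • stdVec i + (τ / (2 * √(1 + τ * w.1))) • w.2.1 i

theorem fderiv_cone_graphMap_smul {f : Euc a → Euc b} (hf : ContDiff ℝ 1 f) (t : ℝ) {y : Euc a}
    (hy : y ≠ 0) (i : Fin a) : fderiv ℝ (cone (graphMap (t • f))) y (stdVec i) =
      (horizontalPart (t ^ 2) (neckData f y) i, t • fderiv ℝ (cone f) y (stdVec i)) := by
  have h0 : (1 + t ^ 2 * radialSq f y) ≠ 0 := by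
    have := radialSq_nonneg f y
    positivity
  have h1 : HasFDerivAt (fun y => √(1 + t ^ 2 * radialSq f y))
      ((1 / (2 * √(1 + t ^ 2 * radialSq f y))) • (t ^ 2 • fderiv ℝ (radialSq f) y)) y :=
    (((differentiableAt_radialSq hf hy).hasFDerivAt.const_mul (t ^ 2)).const_add 1).sqrt h0
  have h2 : HasFDerivAt (fun y => (√(1 + t ^ 2 * radialSq f y) • id y, t • cone f y)) _ y :=
    (h1.smul (hasFDerivAt_id y)).prodMk
      (((homC1_cone hf).differentiableAt hy).hasFDerivAt.const_smul t)
  have h3 : cone (graphMap (t • f)) =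
      fun y => (√(1 + t ^ 2 * radialSq f y) • id y, t • cone f y) :=
    funext (cone_graphMap_smul f t)
  rw [h3, h2.fderiv]
  refine Prod.ext ?_ rfl
  simp [horizontalPart, neckData, smul_smul]
  congr 1
  ring

/-- The integrand of the energy of a neck as a function of `τ = t²` and the pointwise data. -/
def neckIntegrand (p : ℝ × (ℝ × (Fin a → Euc a) × (Fin a → Euc b)) ×
    (ℝ × (Fin a → Euc a) × (Fin a → Euc b))) : ℝ :=
  (Matrix.of fun i j : Fin a => inner ℝ (horizontalPart p.1 p.2.1 i) (horizontalPart p.1 p.2.2 j) -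
    p.1 * inner ℝ (p.2.1.2.2 i) (p.2.2.2.2 j)).det

/-- The horizontal parts depend on t² only, and the vertical parts enter through products of two
factors t. -/
theorem pairDet_neck {f : Euc a → Euc b} (hf : ContDiff ℝ 1 f) (t : ℝ) {y z : Euc a} (hy : y ≠ 0)
    (hz : z ≠ 0) : pairDet (cone (graphMap (t • f))) y z =
      neckIntegrand (t ^ 2, neckData f y, neckData f z) := by
  simp only [pairDet, neckIntegrand, fderiv_cone_graphMap_smul hf t hy,
    fderiv_cone_graphMap_smul hf t hz, stdForm_apply, inner_smul_left, inner_smul_right]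
  congr 1
  ext i j
  simp [neckData, pow_two, mul_assoc]

/-- Negative τ correspond to no neck, but they make 0 an interior point, so that two-sided
derivatives in τ exist there. -/
theorem isOpen_neckDomain : IsOpen {p : ℝ × (ℝ × (Fin a → Euc a) × (Fin a → Euc b)) ×
    (ℝ × (Fin a → Euc a) × (Fin a → Euc b)) | 0 < 1 + p.1 * p.2.1.1 ∧ 0 < 1 + p.1 * p.2.2.1} :=
  IsOpen.and (isOpen_lt continuous_const (by fun_prop)) (isOpen_lt continuous_const (by fun_prop))

theorem contDiffOn_neckIntegrand : ContDiffOn ℝ 1 (neckIntegrand (a := a) (b := b))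
    {p | 0 < 1 + p.1 * p.2.1.1 ∧ 0 < 1 + p.1 * p.2.2.1} := by
  have h : ∀ (φ : ℝ × (ℝ × (Fin a → Euc a) × (Fin a → Euc b)) ×
      (ℝ × (Fin a → Euc a) × (Fin a → Euc b)) → ℝ × (Fin a → Euc a) × (Fin a → Euc b)),
      ContDiff ℝ 1 φ → ∀ s : Set _, (∀ p ∈ s, 0 < 1 + p.1 * (φ p).1) → ∀ i,
      ContDiffOn ℝ 1 (fun p => horizontalPart p.1 (φ p) i) s := by
    intro φ hφ s hs i
    have h1 : ContDiffOn ℝ 1 (fun p => √(1 + p.1 * (φ p).1)) s :=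
      (contDiff_const.add (contDiff_fst.mul hφ.fst)).contDiffOn.sqrt fun p hp => (hs p hp).ne'
    refine (h1.smul contDiffOn_const).add (ContDiffOn.smul (contDiff_fst.contDiffOn.div
      (contDiffOn_const.mul h1) fun p hp => ?_) ?_)
    · have := Real.sqrt_pos.2 (hs p hp)
      positivity
    · exact ((contDiff_pi.1 hφ.snd.fst) i).contDiffOn
  unfold neckIntegrand
  simp only [Matrix.det_apply', Matrix.of_apply]
  refine ContDiffOn.sum fun σ _ => contDiffOn_const.mul (contDiffOn_prod fun i _ => ?_)
  refine ((h _ contDiff_snd.fst _ (fun p hp => hp.1) _).inner ℝ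
    (h _ contDiff_snd.snd _ (fun p hp => hp.2) _)).sub ?_
  refine (contDiff_fst.mul (ContDiff.inner ℝ ?_ ?_)).contDiffOn
  · exact (contDiff_pi.1 (contDiff_snd.fst.snd.snd)) _
  · exact (contDiff_pi.1 (contDiff_snd.snd.snd.snd)) _

theorem neckIntegrand_zero (w w' : ℝ × (Fin a → Euc a) × (Fin a → Euc b)) :
    neckIntegrand (0, w, w') = 1 := by
  have : (Matrix.of fun i j : Fin a => inner ℝ (horizontalPart (0 : ℝ) w i)
      (horizontalPart (0 : ℝ) w' j) - 0 * inner ℝ (w.2.2 i) (w'.2.2 j)) = 1 := by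
    ext i j
    simp [horizontalPart, stdVec, Matrix.one_apply, EuclideanSpace.inner_single_left]
  simp only [neckIntegrand]
  rw [this, Matrix.det_one]

theorem hasDerivAt_neckIntegrand (w w' : ℝ × (Fin a → Euc a) × (Fin a → Euc b)) :
    HasDerivAt (fun τ => neckIntegrand (τ, w, w')) (a * ((w.1 + w'.1) / 2) +
      (∑ i, w.2.1 i i + ∑ i, w'.2.1 i i) / 2 - ∑ i, inner ℝ (w.2.2 i) (w'.2.2 i)) 0 := by
  have hs : ∀ w : ℝ × (Fin a → Euc a) × (Fin a → Euc b),
      HasDerivAt (fun τ : ℝ => √(1 + τ * w.1)) (w.1 / 2) 0 := by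
    intro w
    have h1 : HasDerivAt (fun τ : ℝ => 1 + τ * w.1) w.1 0 := by
      simpa using ((hasDerivAt_id (0 : ℝ)).mul_const w.1).const_add 1
    simpa using h1.sqrt (by simp)
  have hp : ∀ (w : ℝ × (Fin a → Euc a) × (Fin a → Euc b)) i,
      HasDerivAt (fun τ : ℝ => horizontalPart τ w i)
        ((w.1 / 2) • stdVec i + (1 / 2 : ℝ) • w.2.1 i) 0 := by
    intro w i
    refine ((hs w).smul_const _).add (HasDerivAt.smul_const ?_ _)
    have h1 : HasDerivAt (fun τ : ℝ => τ / (2 * √(1 + τ * w.1))) _ 0 :=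
      (hasDerivAt_id (0 : ℝ)).div ((hs w).const_mul 2) (by simp)
    refine h1.congr_deriv ?_
    norm_num
  have h0 : ∀ (w : ℝ × (Fin a → Euc a) × (Fin a → Euc b)) i,
      horizontalPart (0 : ℝ) w i = stdVec i := fun w i => by simp [horizontalPart]
  refine (hasDerivAt_det_one (M := fun τ => Matrix.of fun i j : Fin a =>
    inner ℝ (horizontalPart τ w i) (horizontalPart τ w' j) - τ * inner ℝ (w.2.2 i) (w'.2.2 j))
    (M' := Matrix.of fun i j => inner ℝ (stdVec i) ((w'.1 / 2) • stdVec j + (1 / 2 : ℝ) • w'.2.1 j) +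
      inner ℝ ((w.1 / 2) • stdVec i + (1 / 2 : ℝ) • w.2.1 i) (stdVec j) -
        inner ℝ (w.2.2 i) (w'.2.2 j)) ?_ fun i j => ?_).congr_deriv ?_
  · ext i j
    simp [h0, stdVec, Matrix.one_apply, EuclideanSpace.inner_single_left]
  · have h1 : HasDerivAt (fun τ => inner ℝ (horizontalPart τ w i) (horizontalPart τ w' j) -
        τ * inner ℝ (w.2.2 i) (w'.2.2 j)) _ 0 := ((hp w i).inner ℝ (hp w' j)).sub
      ((hasDerivAt_id (0 : ℝ)).mul_const (inner ℝ (w.2.2 i) (w'.2.2 j)))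
    simp only [h0, one_mul] at h1
    exact h1
  · simp only [Matrix.trace, Matrix.diag_apply, Matrix.of_apply, Finset.sum_sub_distrib,
      inner_add_left, inner_add_right, inner_smul_left, inner_smul_right, Finset.sum_add_distrib]
    simp [stdVec, EuclideanSpace.inner_single_left, EuclideanSpace.inner_single_right,
      ← Finset.mul_sum]
    ring

theorem measurable_neckData {f : Euc a → Euc b} (hf : Continuous f) : Measurable (neckData f) := by
  have h1 : Measurable (radialSq f) := by
    unfold radialSq
    exact (hf.measurable.comp (measurable_norm.inv.smul measurable_id)).norm.pow_const 2
  refine h1.prodMk (Measurable.prodMk ?_ ?_)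
  · exact measurable_pi_lambda _ fun i =>
      (measurable_fderiv_apply_const ℝ (radialSq f) (stdVec i)).smul measurable_id
  · exact measurable_pi_lambda _ fun i => measurable_fderiv_apply_const ℝ (cone f) (stdVec i)

/-- Near the origin the gradient of `radialSq f` can grow like 1/‖y‖; its product with y, which
`neckData` records, is bounded because `radialSq f y • y` is homogeneous of degree one. -/
theorem exists_norm_neckData_le {f : Euc a → Euc b} (hf : ContDiff ℝ 1 f) :
    ∃ C, 0 ≤ C ∧ ∀ y ≠ 0, ‖neckData f y‖ ≤ C := by
  obtain ⟨C₀, hC₀⟩ := (isCompact_closedBall (0 : Euc a) 1).exists_bound_of_continuousOn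
    ((hf.continuous.norm.pow 2).continuousOn)
  obtain ⟨C₁, hC₁0, hC₁⟩ := (homC1_cone hf).exists_norm_fderiv_le
  have hS : HomC1 (cone fun x => ‖f x‖ ^ 2 • x) := homC1_cone ((hf.norm_sq ℝ).smul contDiff_id)
  obtain ⟨C₂, hC₂0, hC₂⟩ := hS.exists_norm_fderiv_le
  have hρ : ∀ y, ‖radialSq f y‖ ≤ C₀ := by
    intro y
    refine hC₀ (‖y‖⁻¹ • y) ?_
    rw [mem_closedBall_zero_iff, norm_smul, norm_inv, norm_norm]
    exact inv_mul_le_one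
  have hC₀0 : 0 ≤ C₀ := (norm_nonneg _).trans (hρ 0)
  refine ⟨C₀ + C₁ + C₂, by positivity, fun y hy => ?_⟩
  have hcone : (cone fun x => ‖f x‖ ^ 2 • x) = fun y => radialSq f y • id y := by
    funext y
    rcases eq_or_ne y 0 with rfl | hy
    · simp [cone]
    · have h : ‖y‖ ≠ 0 := norm_ne_zero_iff.2 hy
      simp only [cone, radialSq, smul_smul, id]
      congr 1
      field_simp
  refine (norm_prod_le_iff).2 ⟨(hρ y).trans (by linarith), (norm_prod_le_iff).2 ⟨?_, ?_⟩⟩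
  · refine (pi_norm_le_iff_of_nonneg (by positivity)).2 fun i => ?_
    have h1 : fderiv ℝ (cone fun x => ‖f x‖ ^ 2 • x) y (stdVec i) =
        radialSq f y • stdVec i + fderiv ℝ (radialSq f) y (stdVec i) • y := by
      have h2 : HasFDerivAt (fun y => radialSq f y • id y) _ y :=
        (differentiableAt_radialSq hf hy).hasFDerivAt.smul (hasFDerivAt_id y)
      rw [hcone, h2.fderiv]
      simp
    have h3 : (neckData f y).2.1 i =
        fderiv ℝ (cone fun x => ‖f x‖ ^ 2 • x) y (stdVec i) - radialSq f y • stdVec i := by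
      rw [h1]
      simp [neckData]
    have h4 := (fderiv ℝ (cone fun x => ‖f x‖ ^ 2 • x) y).le_opNorm (stdVec i)
    have h5 := hC₂ y
    rw [h3]
    refine (norm_sub_le _ _).trans ?_
    rw [norm_smul]
    rw [norm_stdVec, mul_one] at *
    linarith [hρ y]
  · refine (pi_norm_le_iff_of_nonneg (by positivity)).2 fun i => ?_
    have h4 := (fderiv ℝ (cone f) y).le_opNorm (stdVec i)
    rw [norm_stdVec, mul_one] at h4
    exact h4.trans (by linarith [hC₁ y])

theorem pairEnergy_flat (a b : ℕ) [NeZero a] : pairEnergy (cone (graphMap (0 : Euc a → Euc b))) =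
    volume.real (Metric.ball (0 : Euc a) 1) ^ 2 := by
  have h1 : ∫ y in Metric.ball (0 : Euc a) 1, ∫ z in Metric.ball (0 : Euc a) 1,
      pairDet (cone (graphMap (0 : Euc a → Euc b))) y z =
      ∫ _ in Metric.ball (0 : Euc a) 1, ∫ _ in Metric.ball (0 : Euc a) 1, (1 : ℝ) := by
    refine integral_congr_ae (ae_ball_ne_zero.mono fun y hy =>
      integral_congr_ae (ae_ball_ne_zero.mono fun z hz => ?_))
    have h2 := pairDet_neck (contDiff_zero_fun (𝕜 := ℝ) (E := Euc a) (F := Euc b) (n := 1)) 0 hy hz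
    rw [zero_smul, zero_pow two_ne_zero, neckIntegrand_zero] at h2
    exact h2
  rw [pairEnergy, h1]
  simp [pow_two]

theorem integral_prod_variation {X κ : Type*} [MeasurableSpace X] {μ : Measure X}
    [IsFiniteMeasure μ] [Fintype κ] (c : ℝ) {ρ : X → ℝ} {r : κ → X → ℝ} (hρ : Integrable ρ μ)
    (hr : ∀ k, Integrable (r k) μ) :
    ∫ p, (c * ((ρ p.1 + ρ p.2) / 2) - ∑ k, r k p.1 * r k p.2) ∂μ.prod μ =
      c * (μ.real Set.univ * ∫ x, ρ x ∂μ) - ∑ k, (∫ x, r k x ∂μ) ^ 2 := by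
  have i1 : Integrable (fun p : X × X => ρ p.1) (μ.prod μ) := hρ.comp_fst μ
  have i2 : Integrable (fun p : X × X => ρ p.2) (μ.prod μ) := hρ.comp_snd μ
  have i3 : ∀ k, Integrable (fun p : X × X => r k p.1 * r k p.2) (μ.prod μ) :=
    fun k => (hr k).mul_prod (hr k)
  have i4 : Integrable (fun p : X × X => c * ((ρ p.1 + ρ p.2) / 2)) (μ.prod μ) :=
    ((i1.add i2).div_const 2).const_mul c
  rw [integral_sub i4 (integrable_finsetSum _ fun k _ => i3 k),
    integral_finsetSum _ fun k _ => i3 k, integral_const_mul, integral_div, integral_add i1 i2]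
  have h1 : ∫ p, ρ p.1 ∂μ.prod μ = μ.real Set.univ * ∫ x, ρ x ∂μ := by
    rw [integral_fun_fst, smul_eq_mul]
  have h2 : ∫ p, ρ p.2 ∂μ.prod μ = μ.real Set.univ * ∫ x, ρ x ∂μ := by
    rw [integral_fun_snd, smul_eq_mul]
  rw [h1, h2]
  congr 1
  · ring
  · exact Finset.sum_congr rfl fun k _ => by rw [integral_prod_mul, pow_two]

/-- The gradient of `radialSq f` enters the trace only as the derivative in the direction y, which
vanishes because the function is constant on rays. -/
theorem fderiv_neckIntegrand {f : Euc a → Euc b} (hf : ContDiff ℝ 1 f) {y z : Euc a} (hy : y ≠ 0)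
    (hz : z ≠ 0) : fderiv ℝ neckIntegrand (0, neckData f y, neckData f z) (1, 0) =
      a * ((radialSq f y + radialSq f z) / 2) - ∑ k : Fin a × Fin b,
        (fderiv ℝ (cone f) y (stdVec k.1)) k.2 * (fderiv ℝ (cone f) z (stdVec k.1)) k.2 := by
  have hmem : ∀ᶠ p in 𝓝 ((0 : ℝ), neckData f y, neckData f z),
      p ∈ {p : ℝ × (ℝ × (Fin a → Euc a) × (Fin a → Euc b)) ×
        (ℝ × (Fin a → Euc a) × (Fin a → Euc b)) |
          0 < 1 + p.1 * p.2.1.1 ∧ 0 < 1 + p.1 * p.2.2.1} :=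
    isOpen_neckDomain.mem_nhds (by simp)
  have h1 : HasFDerivAt neckIntegrand _ ((0 : ℝ), neckData f y, neckData f z) :=
    ((contDiffOn_neckIntegrand.contDiffAt hmem).differentiableAt one_ne_zero).hasFDerivAt
  have h2 : HasDerivAt (fun τ : ℝ => (τ, neckData f y, neckData f z)) (1, 0) 0 :=
    (hasDerivAt_id (0 : ℝ)).prodMk (hasDerivAt_const 0 _)
  have h3 : ∀ y ≠ 0, ∑ i, (neckData f y).2.1 i i = 0 := by
    intro y hy
    have h4 := fderiv_radialSq_self hf hy
    conv at h4 => lhs; arg 2; rw [euc_eq_sum y]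
    rw [map_sum] at h4
    rw [← h4]
    exact Finset.sum_congr rfl fun i _ => by simp [neckData, mul_comm]
  have h5 : HasDerivAt (fun τ => neckIntegrand (τ, neckData f y, neckData f z)) _ 0 :=
    HasFDerivAt.comp_hasDerivAt (f := fun τ : ℝ => (τ, neckData f y, neckData f z)) 0 h1 h2
  rw [h5.unique (hasDerivAt_neckIntegrand _ _), h3 y hy, h3 z hz,
    Fintype.sum_prod_type]
  simp [neckData, PiLp.inner_apply, mul_comm]

/-- The first two variations of the energy at the flat neck. -/
theorem hasSecondDerivAt_pairEnergy [NeZero a] {f : Euc a → Euc b} (hf : ContDiff ℝ 1 f) :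
    HasDerivAt (fun t : ℝ => pairEnergy (cone (graphMap (t • f)))) 0 0 ∧
    HasSecondDerivAt (fun t : ℝ => pairEnergy (cone (graphMap (t • f))))
      (2 * volume.real (Metric.ball (0 : Euc a) 1) ^ 2 * (a * (∫ x : Sph a, ‖f x‖ ^ 2 ∂unifMeasure a -
        a * ∑ i : Fin a, ∑ j : Fin b,
          (∫ x : Sph a, (x : Euc a) i * f x j ∂unifMeasure a) ^ 2))) 0 := by
  set v := volume.real (Metric.ball (0 : Euc a) 1) with hv
  set μ : Measure (Euc a) := volume.restrict (Metric.ball (0 : Euc a) 1) with hμ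
  obtain ⟨C, hC0, hC⟩ := exists_norm_neckData_le hf
  have hw := measurable_neckData (a := a) hf.continuous
  set K : Set ((ℝ × (Fin a → Euc a) × (Fin a → Euc b)) × (ℝ × (Fin a → Euc a) × (Fin a → Euc b))) :=
    Metric.closedBall 0 C with hK
  have : IsFiniteMeasure μ :=
    ⟨by rw [hμ, Measure.restrict_apply_univ]; exact measure_ball_lt_top⟩
  -- For |τ| up to this bound, |τ ρ| < 1 whenever |ρ| ≤ C, so the square roots stay smooth.
  have hδ : 0 < 1 / (2 * (C + 1)) := by positivity
  have hne : ∀ᵐ p ∂μ.prod μ, p.1 ≠ 0 ∧ p.2 ≠ 0 :=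
    (Measure.quasiMeasurePreserving_fst.ae ae_ball_ne_zero).and
      (Measure.quasiMeasurePreserving_snd.ae ae_ball_ne_zero)
  have hKU : Set.Icc (-(1 / (2 * (C + 1)))) (1 / (2 * (C + 1))) ×ˢ K ⊆
      {p : ℝ × (ℝ × (Fin a → Euc a) × (Fin a → Euc b)) × (ℝ × (Fin a → Euc a) × (Fin a → Euc b)) |
        0 < 1 + p.1 * p.2.1.1 ∧ 0 < 1 + p.1 * p.2.2.1} := by
    rintro ⟨τ, w, w'⟩ ⟨hτ, hww⟩
    have hτ' : |τ| ≤ 1 / (2 * (C + 1)) := abs_le.2 hτ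
    have h1 : ∀ r : ℝ, |r| ≤ C → 0 < 1 + τ * r := by
      intro r hr
      have h2 : |τ * r| ≤ 1 / (2 * (C + 1)) * C := by
        rw [abs_mul]
        gcongr
      have h3 : 1 / (2 * (C + 1)) * C < 1 := by
        rw [div_mul_eq_mul_div, div_lt_one (by positivity)]
        linarith
      linarith [neg_abs_le (τ * r)]
    have h4 := norm_prod_le_iff.1 (mem_closedBall_zero_iff.1 hww)
    exact ⟨h1 _ (norm_prod_le_iff.1 h4.1).1, h1 _ (norm_prod_le_iff.1 h4.2).1⟩
  obtain ⟨hint, g', hg, hg'c, hg'0⟩ := exists_hasDerivAt_integral (μ := μ.prod μ) isOpen_neckDomain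
    (contDiffOn_neckIntegrand (a := a) (b := b)) (isCompact_closedBall 0 C) hδ hKU
    (w := fun p : Euc a × Euc a => (neckData f p.1, neckData f p.2))
    ((hw.comp measurable_fst).prodMk (hw.comp measurable_snd))
    (hne.mono fun p hp => mem_closedBall_zero_iff.2 (norm_prod_le_iff.2 ⟨hC _ hp.1, hC _ hp.2⟩))
  have hq : ∀ᶠ t in 𝓝 (0 : ℝ), pairEnergy (cone (graphMap (t • f))) =
      ∫ p, neckIntegrand (t ^ 2, neckData f p.1, neckData f p.2) ∂μ.prod μ := by
    have hc : ContinuousAt (fun t : ℝ => t ^ 2) 0 := by fun_prop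
    have hlt : ∀ᶠ t : ℝ in 𝓝 0, t ^ 2 < 1 / (2 * (C + 1)) :=
      hc.eventually (gt_mem_nhds (by simpa using hδ))
    filter_upwards [hlt] with t ht
    have hi := hint (t ^ 2) ⟨by nlinarith [sq_nonneg t], ht.le⟩
    rw [← integral_integral (f := fun y z => neckIntegrand (t ^ 2, neckData f y, neckData f z)) hi]
    exact integral_congr_ae (ae_ball_ne_zero.mono fun y hy =>
      integral_congr_ae (ae_ball_ne_zero.mono fun z hz => pairDet_neck hf t hy hz))
  have hmain := hasSecondDerivAt_comp_sq hq hg hg'c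
  refine ⟨hmain.1, ?_⟩
  convert hmain.2 using 1
  rw [hg'0, mul_assoc]
  congr 1
  have hρi : Integrable (radialSq f) μ := by
    refine Integrable.of_bound hw.fst.aestronglyMeasurable C (ae_ball_ne_zero.mono fun y hy => ?_)
    exact (norm_prod_le_iff.1 (hC y hy)).1
  have hri : ∀ k : Fin a × Fin b,
      Integrable (fun y => (fderiv ℝ (cone f) y (stdVec k.1)) k.2) μ := by
    intro k
    have hm : Measurable fun y => (fderiv ℝ (cone f) y (stdVec k.1)) k.2 :=
      (EuclideanSpace.proj (𝕜 := ℝ) k.2).measurable.comp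
        (measurable_fderiv_apply_const ℝ (cone f) (stdVec k.1))
    refine Integrable.of_bound hm.aestronglyMeasurable C (ae_ball_ne_zero.mono fun y hy => ?_)
    exact (PiLp.norm_apply_le _ _).trans ((norm_le_pi_norm _ k.1).trans
      (norm_prod_le_iff.1 (norm_prod_le_iff.1 (hC y hy)).2).2)
  have hD : ∫ p, fderiv ℝ neckIntegrand (0, neckData f p.1, neckData f p.2) (1, 0) ∂μ.prod μ =
      ∫ p, (a * ((radialSq f p.1 + radialSq f p.2) / 2) - ∑ k : Fin a × Fin b,
        (fderiv ℝ (cone f) p.1 (stdVec k.1)) k.2 * (fderiv ℝ (cone f) p.2 (stdVec k.1)) k.2)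
          ∂μ.prod μ :=
    integral_congr_ae (hne.mono fun p hp => fderiv_neckIntegrand hf hp.1 hp.2)
  have hρv : ∫ y, radialSq f y ∂μ = v * ∫ x : Sph a, ‖f x‖ ^ 2 ∂unifMeasure a := by
    rw [hμ, integral_ball_eq_unifMeasure _ fun t ht y => radialSq_smul f ht y]
    congr 1
    refine integral_congr_ae (ae_of_all _ fun x => ?_)
    have hx : ‖(x : Euc a)‖ = 1 := norm_eq_of_mem_sphere x
    simp [radialSq, hx]
  have hrv : ∀ k : Fin a × Fin b, ∫ y, (fderiv ℝ (cone f) y (stdVec k.1)) k.2 ∂μ =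
      a * v * ∫ x : Sph a, (x : Euc a) k.1 * f x k.2 ∂unifMeasure a := by
    intro k
    have h1 := integral_ball_fderiv ((homC1_cone hf).clm_comp (EuclideanSpace.proj (𝕜 := ℝ) k.2))
      k.1
    have h2 : ∫ y, (fderiv ℝ (cone f) y (stdVec k.1)) k.2 ∂μ =
        ∫ y, fderiv ℝ (fun y => EuclideanSpace.proj (𝕜 := ℝ) k.2 (cone f y)) y (stdVec k.1) ∂μ := by
      refine integral_congr_ae (ae_ball_ne_zero.mono fun y hy => ?_)
      simp only [fderiv_clm_comp _ ((homC1_cone hf).differentiableAt hy)]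
      rfl
    rw [h2, hμ, h1]
    congr 1
    refine integral_congr_ae (ae_of_all _ fun x => ?_)
    have hx : ‖(x : Euc a)‖ = 1 := norm_eq_of_mem_sphere x
    simp [cone, hx]
  rw [hD, integral_prod_variation _ hρi hri, hρv]
  simp only [hrv]
  have hvol : μ.real Set.univ = v := by simp [hμ, hv]
  rw [hvol, Fintype.sum_prod_type]
  simp only [mul_pow, ← Finset.mul_sum]
  ring

end SecondVariation

/-! ### Pythagoras for a filtered Hilbert space. -/

section OrthogonalFiltration

variable {E : Type*} [NormedAddCommGroup E] [InnerProductSpace ℝ E] {U W : ℕ → Submodule ℝ E}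
  [∀ n, (U n).HasOrthogonalProjection] [∀ n, (W n).HasOrthogonalProjection]

/-- The difference of consecutive projections is orthogonal to U n, hence by monotonicity to all
earlier spaces, and so it is the projection to W (n + 1). -/
theorem norm_sq_starProjection_succ (hU : Monotone U)
    (hW : ∀ n, W n = U n ⊓ ⨅ j : Fin n, (U j)ᗮ) (x : E) (n : ℕ) :
    ‖(U (n + 1)).starProjection x‖ ^ 2 =
      ‖(U n).starProjection x‖ ^ 2 + ‖(W (n + 1)).starProjection x‖ ^ 2 := by
  set v := (U (n + 1)).starProjection x - (U n).starProjection x with hv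
  have h1 : v ∈ (U n)ᗮ := by
    have e : v = (x - (U n).starProjection x) - (x - (U (n + 1)).starProjection x) := by
      rw [hv]; abel
    rw [e]
    exact Submodule.sub_mem _ ((U n).sub_starProjection_mem_orthogonal x)
      (Submodule.orthogonal_le (hU n.le_succ) ((U (n + 1)).sub_starProjection_mem_orthogonal x))
  have h2 : v ∈ W (n + 1) := by
    rw [hW]
    refine ⟨Submodule.sub_mem _ (Submodule.starProjection_apply_mem _ x)
      (hU n.le_succ (Submodule.starProjection_apply_mem _ x)), Submodule.mem_iInf _ |>.2 fun j => ?_⟩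
    exact Submodule.orthogonal_le (hU (Nat.lt_succ_iff.1 j.2)) h1
  have h3 : (W (n + 1)).starProjection x = v := by
    refine Submodule.eq_starProjection_of_mem_orthogonal h2 ?_
    have e : x - v = (x - (U (n + 1)).starProjection x) + (U n).starProjection x := by
      rw [hv]; abel
    rw [e]
    refine Submodule.add_mem _ (Submodule.orthogonal_le ?_
      ((U (n + 1)).sub_starProjection_mem_orthogonal x)) ?_
    · rw [hW]
      exact inf_le_left
    · refine Submodule.orthogonal_le (?_ : W (n + 1) ≤ (U n)ᗮ)
        (Submodule.le_orthogonal_orthogonal _ (Submodule.starProjection_apply_mem _ x))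
      rw [hW]
      exact inf_le_right.trans (iInf_le (fun j : Fin (n + 1) => (U j)ᗮ) (Fin.last n))
  have h4 : (U (n + 1)).starProjection x = (U n).starProjection x + v := by rw [hv]; abel
  rw [h3, h4, pow_two, pow_two, pow_two]
  exact norm_add_sq_eq_norm_sq_add_norm_sq_of_inner_eq_zero _ _
    (h1 _ (Submodule.starProjection_apply_mem _ x))

/-- The Pythagorean theorem for an exhausting filtration of a Hilbert space. -/
theorem hasSum_norm_sq_starProjection (hU : Monotone U)
    (hW : ∀ n, W n = U n ⊓ ⨅ j : Fin n, (U j)ᗮ) (hd : ⊤ ≤ (⨆ n, U n).topologicalClosure) (x : E) :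
    HasSum (fun n => ‖(W n).starProjection x‖ ^ 2) (‖x‖ ^ 2) := by
  have h0 : (W 0).starProjection x = (U 0).starProjection x := by
    have h : W 0 = U 0 := by rw [hW]; simp
    congr 2
  have h1 : ∀ n, ∑ k ∈ Finset.range (n + 1), ‖(W k).starProjection x‖ ^ 2 =
      ‖(U n).starProjection x‖ ^ 2 := by
    intro n
    induction n with
    | zero => simp [h0]
    | succ n ih => rw [Finset.sum_range_succ, ih, ← norm_sq_starProjection_succ hU hW]
  rw [hasSum_iff_tendsto_nat_of_nonneg fun n => sq_nonneg _]
  refine (tendsto_add_atTop_iff_nat 1).1 ?_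
  simp only [h1]
  exact (Submodule.starProjection_tendsto_self U hU x hd).norm.pow 2

end OrthogonalFiltration

/-! ### Harmonic expansion and the degree one part. -/

section Harmonics

variable {a b : ℕ}

theorem inner_sphereLp {f g : Euc a → Euc b} (hf : Continuous f) (hg : Continuous g) :
    inner ℝ (sphereLp f hf) (sphereLp g hg) =
      ∫ x : Sph a, inner ℝ (f x) (g x) ∂unifMeasure a := by
  rw [L2.inner_def]
  refine integral_congr_ae ?_
  filter_upwards [ContinuousMap.coeFn_toLp (p := 2) (𝕜 := ℝ) (unifMeasure a)
    (⟨fun x : Sph a => f x, hf.comp continuous_subtype_val⟩ : C(Sph a, Euc b)),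
    ContinuousMap.coeFn_toLp (p := 2) (𝕜 := ℝ) (unifMeasure a)
    (⟨fun x : Sph a => g x, hg.comp continuous_subtype_val⟩ : C(Sph a, Euc b))] with x h1 h2
  simp only [sphereLp, h1, h2, ContinuousMap.coe_mk]

theorem norm_sq_sphereLp {f : Euc a → Euc b} (hf : Continuous f) :
    ‖sphereLp f hf‖ ^ 2 = ∫ x : Sph a, ‖f x‖ ^ 2 ∂unifMeasure a := by
  rw [← real_inner_self_eq_norm_sq, inner_sphereLp]
  simp

theorem sphereLp_eq_iff [NeZero a] {f g : Euc a → Euc b} (hf : Continuous f) (hg : Continuous g) :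
    sphereLp f hf = sphereLp g hg ↔ ∀ x : Euc a, ‖x‖ = 1 → f x = g x := by
  rw [sphereLp, sphereLp, (ContinuousMap.toLp_injective (p := 2) (𝕜 := ℝ) (unifMeasure a)).eq_iff]
  constructor
  · intro h x hx
    exact DFunLike.congr_fun h ⟨x, by simpa using hx⟩
  · intro h
    ext1 x
    exact h x (norm_eq_of_mem_sphere x)

theorem monotone_polySpace (a b : ℕ) : Monotone (polySpace a b) := by
  intro m n hmn
  refine Submodule.map_mono (Submodule.pi_mono fun i _ p hp => ?_)
  rw [MvPolynomial.mem_restrictTotalDegree] at hp ⊢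
  exact hp.trans hmn

theorem aeval_apply_eq_eval {X : Type*} [TopologicalSpace X] (c : Fin a → C(X, ℝ))
    (p : MvPolynomial (Fin a) ℝ) (x : X) :
    MvPolynomial.aeval c p x = MvPolynomial.eval (fun i => c i x) p := by
  induction p using MvPolynomial.induction_on with
  | C r => simp
  | add p q hp hq => simp [hp, hq]
  | mul_X p i hp => simp [hp]

theorem norm_le_sum_abs_coord (v : Euc a) : ‖v‖ ≤ ∑ j, |v j| := by
  conv_lhs => rw [euc_eq_sum v]
  refine (norm_sum_le _ _).trans (Finset.sum_le_sum fun j _ => ?_)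
  rw [norm_smul, norm_stdVec, mul_one, Real.norm_eq_abs]

/-- Stone–Weierstrass: the coordinate functions separate the points of the sphere. -/
theorem exists_polynomial_near (g : C(Sph a, ℝ)) {ε : ℝ} (hε : 0 < ε) :
    ∃ p : MvPolynomial (Fin a) ℝ, ∀ x : Sph a,
      |MvPolynomial.eval ((x : Euc a) : Fin a → ℝ) p - g x| < ε := by
  set c : Fin a → C(Sph a, ℝ) := fun i => ⟨fun x => (x : Euc a) i, by fun_prop⟩ with hc
  have hsep : (MvPolynomial.aeval (R := ℝ) c).range.SeparatesPoints := by
    intro x y hxy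
    obtain ⟨i, hi⟩ : ∃ i, (x : Euc a) i ≠ (y : Euc a) i := by
      by_contra! h
      exact hxy (Subtype.ext (PiLp.ext h))
    exact ⟨_, ⟨c i, ⟨MvPolynomial.X i, by simp⟩, rfl⟩, hi⟩
  obtain ⟨⟨_, p, rfl⟩, hh⟩ := ContinuousMap.exists_mem_subalgebra_near_continuous_of_separatesPoints
    _ hsep g g.continuous ε hε
  refine ⟨p, fun x => ?_⟩
  have he : MvPolynomial.eval ((x : Euc a) : Fin a → ℝ) p = MvPolynomial.aeval c p x :=
    (aeval_apply_eq_eval c p x).symm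
  rw [he]
  exact hh x

theorem dense_polySpace (a b : ℕ) : ⊤ ≤ (⨆ n, polySpace a b n).topologicalClosure := by
  have h1 : ∀ g : C(Sph a, Euc b), ContinuousMap.toLp (E := Euc b) 2 (unifMeasure a) ℝ g ∈
      (⨆ n, polySpace a b n).topologicalClosure := by
    intro g
    have hg : g ∈ closure (Set.range fun p : Fin b → MvPolynomial (Fin a) ℝ =>
        (⟨fun x : Sph a => polyFun p x,
          (continuous_polyFun p).comp continuous_subtype_val⟩ : C(Sph a, Euc b))) := by
      refine Metric.mem_closure_iff.2 fun ε hε => ?_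
      have hε' : 0 < ε / (2 * (b + 1)) := by positivity
      choose p hp using fun j : Fin b => exists_polynomial_near
        (⟨fun x => g x j, by fun_prop⟩ : C(Sph a, ℝ)) hε'
      refine ⟨_, ⟨p, rfl⟩, lt_of_le_of_lt ((ContinuousMap.dist_le (C := ε / 2) (by positivity)).2
        fun x => ?_) (half_lt_self hε)⟩
      rw [dist_comm, dist_eq_norm]
      refine (norm_le_sum_abs_coord _).trans ?_
      calc ∑ j, |(polyFun p x - g x) j| ≤ ∑ _j : Fin b, ε / (2 * (b + 1)) :=
            Finset.sum_le_sum fun j _ => (hp j x).le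
        _ = b * (ε / (2 * (b + 1))) := by simp
        _ ≤ ε / 2 := by
          rw [mul_div_assoc', div_le_div_iff₀ (by positivity) (by positivity)]
          nlinarith
    have h2 := image_closure_subset_closure_image
      (ContinuousMap.toLp (E := Euc b) 2 (unifMeasure a) ℝ).continuous (Set.mem_image_of_mem _ hg)
    refine closure_mono ?_ h2
    rintro _ ⟨_, ⟨p, rfl⟩, rfl⟩
    refine Submodule.mem_iSup_of_mem (Finset.univ.sup fun j => (p j).totalDegree) ?_
    refine ⟨p, fun j _ => ?_, rfl⟩
    rw [SetLike.mem_coe, MvPolynomial.mem_restrictTotalDegree]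
    exact Finset.le_sup (f := fun j => (p j).totalDegree) (Finset.mem_univ j)
  intro u _
  have h3 := ContinuousMap.toLp_denseRange (α := Sph a) (Euc b) (unifMeasure a) (p := 2) ℝ
    (by norm_num)
  refine (closure_minimal ?_ (Submodule.isClosed_topologicalClosure _)) (h3 u)
  rintro _ ⟨g, rfl⟩
  exact h1 g

theorem exists_affine_of_totalDegree_le_one {p : MvPolynomial (Fin a) ℝ} (hp : p.totalDegree ≤ 1) :
    ∃ (c : ℝ) (m : Fin a → ℝ), ∀ x : Fin a → ℝ, MvPolynomial.eval x p = c + ∑ i, m i * x i := by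
  rw [← MvPolynomial.support_sum_monomial_coeff p]
  refine Finset.sum_induction _ (fun q : MvPolynomial (Fin a) ℝ => ∃ (c : ℝ) (m : Fin a → ℝ),
    ∀ x : Fin a → ℝ, MvPolynomial.eval x q = c + ∑ i, m i * x i) ?_ ⟨0, 0, by simp⟩ ?_
  · rintro q r ⟨c, m, h⟩ ⟨c', m', h'⟩
    refine ⟨c + c', m + m', fun x => ?_⟩
    simp only [map_add, h, h', Pi.add_apply, add_mul, Finset.sum_add_distrib]
    ring
  · intro s hs
    have h1 : ∑ i, s i ≤ 1 := by
      have := (MvPolynomial.le_totalDegree hs).trans hp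
      rwa [Finsupp.sum_fintype _ _ fun _ => rfl] at this
    rcases eq_or_ne s 0 with rfl | h0
    · exact ⟨p.coeff 0, 0, by simp⟩
    · obtain ⟨i, hi⟩ : ∃ i, s i ≠ 0 := by
        by_contra! h
        exact h0 (Finsupp.ext h)
      have h2 : s = Finsupp.single i 1 := by
        have h3 := Finset.add_sum_erase Finset.univ (fun i => s i) (Finset.mem_univ i)
        have h4 : ∑ j ∈ Finset.univ.erase i, s j = 0 := by omega
        ext j
        rcases eq_or_ne j i with rfl | hj
        · simp only [Finsupp.single_eq_same]
          omega
        · rw [Finsupp.single_eq_of_ne hj]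
          exact Finset.sum_eq_zero_iff.1 h4 j (Finset.mem_erase.2 ⟨hj, Finset.mem_univ j⟩)
      refine ⟨0, Pi.single i (p.coeff s), fun x => ?_⟩
      rw [MvPolynomial.eval_monomial, h2]
      simp [Pi.single_apply]

/-- The polynomial map with constant terms `c` and linear part `L`. -/
def affinePoly (c : Euc b) (L : Euc a →L[ℝ] Euc b) (j : Fin b) : MvPolynomial (Fin a) ℝ :=
  MvPolynomial.C (c j) + ∑ i, MvPolynomial.C (L (stdVec i) j) * MvPolynomial.X i

theorem clm_apply_coord (L : Euc a →L[ℝ] Euc b) (x : Euc a) (j : Fin b) :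
    L x j = ∑ i, L (stdVec i) j * x i := by
  conv_lhs => rw [euc_eq_sum x]
  simp [map_sum, Finset.sum_apply, mul_comm]

theorem polyFun_affinePoly (c : Euc b) (L : Euc a →L[ℝ] Euc b) (x : Euc a) :
    polyFun (affinePoly c L) x = c + L x := by
  ext j
  simp [polyFun, affinePoly, clm_apply_coord L x j]

theorem totalDegree_affinePoly_le (c : Euc b) (L : Euc a →L[ℝ] Euc b) (j : Fin b) :
    (affinePoly c L j).totalDegree ≤ 1 := by
  refine (MvPolynomial.totalDegree_add _ _).trans (max_le (by simp) ?_)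
  refine (MvPolynomial.totalDegree_finsetSum _ _).trans (Finset.sup_le fun i _ => ?_)
  refine (MvPolynomial.totalDegree_mul _ _).trans ?_
  simp

theorem mem_polySpace_zero {u : L2Sphere a b} : u ∈ polySpace a b 0 ↔
    ∃ c : Euc b, u = sphereLp (fun _ => c) continuous_const := by
  constructor
  · rintro ⟨p, hp, rfl⟩
    refine ⟨WithLp.toLp 2 fun j => (p j).coeff 0, ?_⟩
    have h : ∀ x : Euc a, polyFun p x = WithLp.toLp 2 fun j => (p j).coeff 0 := by
      intro x
      ext j
      have hj : p j ∈ MvPolynomial.restrictTotalDegree (Fin a) ℝ 0 := hp j (Set.mem_univ j)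
      rw [MvPolynomial.mem_restrictTotalDegree, Nat.le_zero,
        MvPolynomial.totalDegree_eq_zero_iff_eq_C] at hj
      simp only [polyFun]
      rw [hj]
      simp
    change sphereLp (polyFun p) (continuous_polyFun p) = _
    congr 1
    exact funext h
  · rintro ⟨c, rfl⟩
    refine ⟨fun j => MvPolynomial.C (c j), fun j _ => ?_, ?_⟩
    · rw [SetLike.mem_coe, MvPolynomial.mem_restrictTotalDegree]
      simp
    · change sphereLp _ (continuous_polyFun _) = _
      congr 1
      funext x
      ext j
      simp [polyFun]

theorem mem_polySpace_one {u : L2Sphere a b} : u ∈ polySpace a b 1 ↔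
    ∃ (c : Euc b) (L : Euc a →L[ℝ] Euc b),
      u = sphereLp (fun x => c + L x) (continuous_const.add L.continuous) := by
  constructor
  · rintro ⟨p, hp, rfl⟩
    choose c m h using fun j => exists_affine_of_totalDegree_le_one
      ((MvPolynomial.mem_restrictTotalDegree _ _ _).1 (hp j (Set.mem_univ j)))
    refine ⟨WithLp.toLp 2 c, ∑ i, (EuclideanSpace.proj (𝕜 := ℝ) i).smulRight
      (WithLp.toLp 2 fun j => m j i), ?_⟩
    change sphereLp (polyFun p) (continuous_polyFun p) = _
    congr 1
    funext x
    ext j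
    simp [polyFun, h, Finset.sum_apply, mul_comm]
  · rintro ⟨c, L, rfl⟩
    refine ⟨affinePoly c L, fun j _ => ?_, ?_⟩
    · rw [SetLike.mem_coe, MvPolynomial.mem_restrictTotalDegree]
      exact totalDegree_affinePoly_le c L j
    · change sphereLp _ (continuous_polyFun _) = _
      congr 1
      exact funext (polyFun_affinePoly c L)

theorem inner_sphereLp_clm {f : Euc a → Euc b} (hf : Continuous f) (L : Euc a →L[ℝ] Euc b) :
    inner ℝ (sphereLp f hf) (sphereLp L L.continuous) = ∑ i : Fin a, ∑ j : Fin b,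
      L (stdVec i) j * ∫ x : Sph a, (x : Euc a) i * f x j ∂unifMeasure a := by
  have h1 : ∀ x : Euc a, inner ℝ (f x) (L x) =
      ∑ i : Fin a, ∑ j : Fin b, L (stdVec i) j * (x i * f x j) := by
    intro x
    rw [PiLp.inner_apply, Finset.sum_comm]
    refine Finset.sum_congr rfl fun j _ => ?_
    rw [clm_apply_coord L x j]
    simp only [RCLike.inner_apply, conj_trivial, Finset.sum_mul]
    exact Finset.sum_congr rfl fun i _ => by ring
  have hi : ∀ i j, Integrable (fun x : Sph a => L (stdVec i) j * ((x : Euc a) i * f x j))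
      (unifMeasure a) := fun i j => integrable_sphere (by fun_prop)
  rw [inner_sphereLp]
  simp only [h1]
  rw [integral_finsetSum _ fun i _ => integrable_finsetSum _ fun j _ => hi i j]
  refine Finset.sum_congr rfl fun i _ => ?_
  rw [integral_finsetSum _ fun j _ => hi i j]
  exact Finset.sum_congr rfl fun j _ => integral_const_mul _ _

theorem inner_const_clm [NeZero a] (c : Euc b) (L : Euc a →L[ℝ] Euc b) :
    inner ℝ (sphereLp (fun _ : Euc a => c) continuous_const) (sphereLp L L.continuous) = 0 := by
  rw [inner_sphereLp_clm]
  refine Finset.sum_eq_zero fun i _ => Finset.sum_eq_zero fun j _ => ?_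
  rw [integral_mul_const, integral_sphere_coord, zero_mul, mul_zero]

theorem sphereLp_const_add (c : Euc b) {f : Euc a → Euc b} (hf : Continuous f) :
    sphereLp (fun x => c + f x) (continuous_const.add hf) =
      sphereLp (fun _ => c) continuous_const + sphereLp f hf := by
  unfold sphereLp
  rw [← map_add]
  rfl

/-- The spherical harmonics of degree one are the linear maps. -/
theorem mem_harmonicSpace_one [NeZero a] {u : L2Sphere a b} : u ∈ harmonicSpace a b 1 ↔
    ∃ L : Euc a →L[ℝ] Euc b, u = sphereLp L L.continuous := by
  have h0 : harmonicSpace a b 1 = polySpace a b 1 ⊓ (polySpace a b 0)ᗮ := by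
    rw [harmonicSpace, iInf_unique]
    rfl
  rw [h0]
  constructor
  · rintro ⟨h1, h2⟩
    obtain ⟨c, L, rfl⟩ := mem_polySpace_one.1 h1
    refine ⟨L, ?_⟩
    -- Linear maps are orthogonal to constants, so pairing with c itself leaves ‖c‖² = 0.
    have h3 := h2 _ (mem_polySpace_zero.2 ⟨c, rfl⟩)
    rw [sphereLp_const_add c L.continuous, inner_add_right, inner_const_clm, add_zero,
      inner_self_eq_zero] at h3
    rw [sphereLp_const_add c L.continuous, h3, zero_add]
  · rintro ⟨L, rfl⟩
    refine ⟨mem_polySpace_one.2 ⟨0, L, ?_⟩, fun v hv => ?_⟩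
    · congr 1
      funext x
      simp
    · obtain ⟨c, rfl⟩ := mem_polySpace_zero.1 hv
      exact inner_const_clm c L

/-- The linear map with the same first moments as `f`. -/
def momentMap (f : Euc a → Euc b) : Euc a →L[ℝ] Euc b :=
  ∑ i, (EuclideanSpace.proj (𝕜 := ℝ) i).smulRight (WithLp.toLp 2 fun j =>
    (a : ℝ) * ∫ x : Sph a, (x : Euc a) i * f x j ∂unifMeasure a)

theorem momentMap_stdVec (f : Euc a → Euc b) (i : Fin a) (j : Fin b) :
    momentMap f (stdVec i) j = a * ∫ x : Sph a, (x : Euc a) i * f x j ∂unifMeasure a := by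
  simp [momentMap, stdVec]

theorem integral_coord_mul_clm [NeZero a] (L : Euc a →L[ℝ] Euc b) (i : Fin a) (j : Fin b) :
    ∫ x : Sph a, (x : Euc a) i * L x j ∂unifMeasure a = (a : ℝ)⁻¹ * L (stdVec i) j := by
  have h1 : ∀ x : Sph a, (x : Euc a) i * L x j =
      ∑ k, L (stdVec k) j * ((x : Euc a) i * (x : Euc a) k) := by
    intro x
    rw [clm_apply_coord, Finset.mul_sum]
    exact Finset.sum_congr rfl fun k _ => by ring
  simp only [h1]
  rw [integral_finsetSum _ fun k _ => integrable_sphere (by fun_prop)]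
  simp only [integral_const_mul, integral_sphere_coord_mul_coord]
  simp [mul_comm]

/-- Since ∫ xᵢ xₖ is 1/a for i = k and 0 otherwise, the factor a in `momentMap` makes its first
moments equal to those of f, and the difference is orthogonal to all linear maps. -/
theorem harmonicPart_one [NeZero a] {f : Euc a → Euc b} (hf : Continuous f) :
    harmonicPart 1 (sphereLp f hf) = sphereLp (momentMap f) (momentMap f).continuous := by
  have ha : (a : ℝ) ≠ 0 := by simp [NeZero.ne a]
  refine Submodule.eq_starProjection_of_mem_orthogonal (mem_harmonicSpace_one.2 ⟨_, rfl⟩)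
    fun v hv => ?_
  obtain ⟨L, rfl⟩ := mem_harmonicSpace_one.1 hv
  rw [real_inner_comm, inner_sub_left, inner_sphereLp_clm, inner_sphereLp_clm]
  simp only [integral_coord_mul_clm, momentMap_stdVec]
  simp [ha]

theorem norm_sq_harmonicPart_one [NeZero a] {f : Euc a → Euc b} (hf : Continuous f) :
    ‖harmonicPart 1 (sphereLp f hf)‖ ^ 2 = a * ∑ i : Fin a, ∑ j : Fin b,
      (∫ x : Sph a, (x : Euc a) i * f x j ∂unifMeasure a) ^ 2 := by
  have ha : (a : ℝ) ≠ 0 := by simp [NeZero.ne a]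
  rw [harmonicPart_one, ← real_inner_self_eq_norm_sq, inner_sphereLp_clm]
  simp only [integral_coord_mul_clm, momentMap_stdVec, Finset.mul_sum]
  refine Finset.sum_congr rfl fun i _ => Finset.sum_congr rfl fun j _ => ?_
  field_simp

theorem hasSum_harmonicPart [NeZero a] {f : Euc a → Euc b} (hf : Continuous f) :
    HasSum (fun k : ℕ => if k = 1 then 0 else (a : ℝ) * ‖harmonicPart k (sphereLp f hf)‖ ^ 2)
      (a * (∫ x : Sph a, ‖f x‖ ^ 2 ∂unifMeasure a - a * ∑ i : Fin a, ∑ j : Fin b,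
        (∫ x : Sph a, (x : Euc a) i * f x j ∂unifMeasure a) ^ 2)) := by
  have h1 := hasSum_norm_sq_starProjection (monotone_polySpace a b) (W := harmonicSpace a b)
    (fun n => rfl) (dense_polySpace a b) (sphereLp f hf)
  rw [norm_sq_sphereLp] at h1
  rw [← norm_sq_harmonicPart_one hf]
  refine ((h1.sub (hasSum_ite_eq 1 (‖harmonicPart 1 (sphereLp f hf)‖ ^ 2))).mul_left
    (a : ℝ)).congr_fun ?_
  intro k
  by_cases hk : k = 1
  · subst hk
    simp [harmonicPart]
  · simp [hk, harmonicPart]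

theorem secondVariation_nonneg [NeZero a] {f : Euc a → Euc b} (hf : Continuous f) :
    0 ≤ a * (∫ x : Sph a, ‖f x‖ ^ 2 ∂unifMeasure a - a * ∑ i : Fin a, ∑ j : Fin b,
        (∫ x : Sph a, (x : Euc a) i * f x j ∂unifMeasure a) ^ 2) := by
  rw [← norm_sq_harmonicPart_one hf, ← norm_sq_sphereLp hf]
  refine mul_nonneg a.cast_nonneg (sub_nonneg.2 ?_)
  exact pow_le_pow_left₀ (norm_nonneg _) (Submodule.norm_starProjection_apply_le _ _) 2

/-- Vanishing means that f and its projection f₁ have equal norms, so f is a harmonic of degree one,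
and such harmonics are linear. -/
theorem secondVariation_eq_zero_iff [NeZero a] {f : Euc a → Euc b} (hf : Continuous f) :
    a * (∫ x : Sph a, ‖f x‖ ^ 2 ∂unifMeasure a - a * ∑ i : Fin a, ∑ j : Fin b,
        (∫ x : Sph a, (x : Euc a) i * f x j ∂unifMeasure a) ^ 2) = 0 ↔
      ∃ L : Euc a →ₗ[ℝ] Euc b, ∀ x : Euc a, ‖x‖ = 1 → f x = L x := by
  have ha : (a : ℝ) ≠ 0 := by simp [NeZero.ne a]
  rw [← norm_sq_harmonicPart_one hf, ← norm_sq_sphereLp hf, mul_eq_zero_iff_left ha, sub_eq_zero,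
    eq_comm, sq_eq_sq₀ (norm_nonneg _) (norm_nonneg _), harmonicPart,
    ← Submodule.mem_iff_norm_starProjection, mem_harmonicSpace_one]
  simp only [sphereLp_eq_iff]
  constructor
  · rintro ⟨L, h⟩
    exact ⟨L, h⟩
  · rintro ⟨L, h⟩
    exact ⟨LinearMap.toContinuousLinearMap L, h⟩

end Harmonics

/-! ### Linear variations and infinitesimal isometries. -/

section Rotations

variable {a b : ℕ} {V : Type*} [NormedAddCommGroup V] [NormedSpace ℝ V]

/-- The infinitesimal isometry of the standard inner product with off-diagonal block `L`. -/
def offDiagonal (L : Euc a →ₗ[ℝ] Euc b) : Module.End ℝ (Euc a × Euc b) :=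
  (L.adjoint ∘ₗ LinearMap.snd ℝ _ _).prod (L ∘ₗ LinearMap.fst ℝ _ _)

theorem stdForm_offDiagonal (L : Euc a →ₗ[ℝ] Euc b) (u v : Euc a × Euc b) :
    stdForm a b (offDiagonal L u) v = stdForm a b u (-offDiagonal L v) := by
  change inner ℝ (L.adjoint u.2) v.1 - inner ℝ (L u.1) v.2 =
    inner ℝ u.1 (-L.adjoint v.2) - inner ℝ u.2 (-L v.1)
  rw [inner_neg_right, inner_neg_right, LinearMap.adjoint_inner_left,
    LinearMap.adjoint_inner_right]
  ring

/-- The linear variations are those generated by the infinitesimal isometries. -/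
theorem exists_linear_iff_exists_skewAdjoint {B : LinearMap.BilinForm ℝ V}
    {T : (Euc a × Euc b) ≃ₗ[ℝ] V} (hT : ∀ u v, B (T u) (T v) = stdForm a b u v)
    (f : Euc a → Euc b) :
    (∃ L : Euc a →ₗ[ℝ] Euc b, ∀ x : Euc a, ‖x‖ = 1 → f x = L x) ↔
      ∃ X ∈ skewAdjointLieSubalgebra B, ∀ x : Euc a, ‖x‖ = 1 →
        f x = (T.symm (X (T (x, 0)))).2 := by
  constructor
  · rintro ⟨L, hL⟩
    -- The upper block is the adjoint of L: the opposite signs of the form on the two factors make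
    -- this symmetric block matrix skew-adjoint.
    refine ⟨T.toLinearMap ∘ₗ offDiagonal L ∘ₗ T.symm.toLinearMap, ?_, fun x hx => ?_⟩
    · change _ ∈ LinearMap.skewAdjointSubmodule B
      rw [LinearMap.mem_skewAdjointSubmodule]
      intro u v
      obtain ⟨u, rfl⟩ := T.surjective u
      obtain ⟨v, rfl⟩ := T.surjective v
      have := stdForm_offDiagonal L u v
      simpa [hT, ← map_neg] using this
    · rw [hL x hx]
      simp [offDiagonal]
  · rintro ⟨X, -, hX⟩
    exact ⟨LinearMap.snd ℝ _ _ ∘ₗ T.symm.toLinearMap ∘ₗ X ∘ₗ T.toLinearMap ∘ₗ LinearMap.inl ℝ _ _,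
      hX⟩

end Rotations

end Neck

end

/-- Local stability of flat necks in signature `(a, b)`. The space `V` with inner product `B` is
identified by `T` with the standard space of signature `(a, b)`; as `T` varies, the image of
`S^{a-1}` runs through all flat necks of `V`. -/
theorem mainTheorem6 (a b : ℕ) (ha : 0 < a)
    {V : Type*} [NormedAddCommGroup V] [NormedSpace ℝ V] [FiniteDimensional ℝ V]
    (B : LinearMap.BilinForm ℝ V) (T : (Neck.Euc a × Neck.Euc b) ≃ₗ[ℝ] V)
    (hT : ∀ u v, B (T u) (T v) = Neck.stdForm a b u v) :
    -- the energy of the flat neck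
    Neck.neckEnergy B T 0 = (volume.real (Metric.ball (0 : Neck.Euc a) 1)) ^ 2 ∧
    -- the flat neck is a local minimum in the `C^1` topology
    (∃ ε : ℝ, 0 < ε ∧ ∀ f : Neck.Euc a → Neck.Euc b, ContDiff ℝ 1 f → Neck.C1Small ε f →
      Neck.neckEnergy B T 0 ≤ Neck.neckEnergy B T f) ∧
    ∀ (f : Neck.Euc a → Neck.Euc b) (hf : ContDiff ℝ 1 f),
      -- the first variation vanishes
      HasDerivAt (fun t : ℝ => Neck.neckEnergy B T (t • f)) 0 0 ∧
      -- the second variation in spherical harmonics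
      (∃ s : ℝ,
        HasSum (fun k : ℕ =>
          if k = 1 then 0
          else (a : ℝ) * ‖Neck.harmonicPart k (Neck.sphereLp f hf.continuous)‖ ^ 2) s ∧
        Neck.HasSecondDerivAt (fun t : ℝ => Neck.neckEnergy B T (t • f))
          (2 * (volume.real (Metric.ball (0 : Neck.Euc a) 1)) ^ 2 * s) 0 ∧
        -- positive definiteness except on the linear variations
        0 ≤ s ∧
        (s = 0 ↔ ∃ L : Neck.Euc a →ₗ[ℝ] Neck.Euc b, ∀ x : Neck.Euc a, ‖x‖ = 1 → f x = L x)) ∧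
      -- the linear variations are the normal parts along the neck of the elements of `so(a, b)`
      ((∃ L : Neck.Euc a →ₗ[ℝ] Neck.Euc b, ∀ x : Neck.Euc a, ‖x‖ = 1 → f x = L x) ↔
        ∃ X ∈ skewAdjointLieSubalgebra B, ∀ x : Neck.Euc a, ‖x‖ = 1 →
          f x = (T.symm (X (T (x, 0)))).2) := by
  have : NeZero a := ⟨ha.ne'⟩
  have h0 : Neck.neckEnergy B T 0 = volume.real (Metric.ball (0 : Neck.Euc a) 1) ^ 2 :=
    (Neck.neckEnergy_eq_pairEnergy hT contDiff_zero_fun).trans (Neck.pairEnergy_flat a b)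
  refine ⟨h0, ?_, fun f hf => ?_⟩
  · obtain ⟨ε, hε, h⟩ := Neck.exists_sq_volume_le_pairEnergy a b
    refine ⟨ε, hε, fun f hf hfε => ?_⟩
    rw [h0, Neck.neckEnergy_eq_pairEnergy hT hf]
    exact h f hf hfε
  · have h1 : (fun t : ℝ => Neck.neckEnergy B T (t • f)) =
        fun t : ℝ => Neck.pairEnergy (Neck.cone (Neck.graphMap (t • f))) :=
      funext fun t => Neck.neckEnergy_eq_pairEnergy hT (hf.const_smul t)
    rw [h1]
    obtain ⟨h2, h3⟩ := Neck.hasSecondDerivAt_pairEnergy hf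
    exact ⟨h2, ⟨_, Neck.hasSum_harmonicPart hf.continuous, h3,
      Neck.secondVariation_nonneg hf.continuous,
      Neck.secondVariation_eq_zero_iff hf.continuous⟩,
      Neck.exists_linear_iff_exists_skewAdjoint hT f⟩
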